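/- Let $G=(V,E)$ be a directed graph without loops or parallel edges (antiparallel edges are allowed). For $S\subseteq V$ let $\mathcal P_S$ be the least set of nodes such that (D1) if $v\in S$ then $v$ and all out-neighbours of $v$ are in $\mathcal P_S$, and (D2) if $v\in\mathcal P_S$ and all out-neighbours of $v$ except $w$ are in $\mathcal P_S$, then its out-neighbour $w$ is in $\mathcal P_S$. Directed PDS asks for a set $S\subseteq V$ of minimum size with $\mathcal P_S=V$. A tree decomposition of an undirected graph $H=(V,E_H)$ consists of a tree $T$ on a set $I$ of $T$-nodes and bags $X_i\subseteq V$ $(i\in I)$ such that every node of $H$ lies in some bag, both ends of every edge of $H$ lie in a common bag, and $X_i\cap X_k\subseteq X_j$ whenever $j$ is on the path from $i$ to $k$ in $T$. Its width is $\max_{i\in I}|X_i|-1$ (taken to be $0$ if $V=\emptyset$). **Theorem.** There are a single program $P$ for a unit-cost random access machine (with addition and truncated subtraction as its arithmetic) and global constants $C$ and $c$ such that the following holds. Let $G$ be a directed graph as above with $n$ nodes, and let a tree decomposition of width $k$ with $m$ $T$-nodes of the underlying undirected graph of $G$ be given; the input consists of a list of the edges of $G$, a list of the edges of $T$, and a list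 of the elements of each bag, in any order. Then $P$ outputs a list, without repetitions, of the nodes of an optimal solution $S$ of Directed PDS on $G$, and it halts after at most $C\cdot c^{k^2}\cdot\max(n,m)$ steps. In particular, Directed PDS is solved optimally in $O(c^{k^2}\cdot n)$ time when the given tree decomposition has $O(n)$ $T$-nodes. -/

import Mathlib

/-! ### Directed power domination -/

/-- The set of nodes power dominated by `S` in the directed graph `G`: the least set that contains
`S`, contains every out-neighbour of a node of `S`, and contains the out-neighbour `w` of a node `v`
of the set as soon as it contains all other out-neighbours of `v`. -/
inductive PowerDominated {V : Type*} (G : Digraph V) (S : Set V) : V → Prop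
  | of_mem {v : V} : v ∈ S → PowerDominated G S v
  | of_adj {v w : V} : v ∈ S → G.Adj v w → PowerDominated G S w
  | propagate {v w : V} : PowerDominated G S v → G.Adj v w →
      (∀ u, G.Adj v u → u ≠ w → PowerDominated G S u) → PowerDominated G S w

/-- `S` power dominates all nodes of `G`. -/
def PowerDominates {V : Type*} (G : Digraph V) (S : Finset V) : Prop :=
  ∀ v, PowerDominated G (S : Set V) v

/-- `S` is an optimal solution of Directed PDS on `G`. -/
def IsOptimalPDS {V : Type*} (G : Digraph V) (S : Finset V) : Prop :=
  PowerDominates G S ∧ ∀ S' : Finset V, PowerDominates G S' → S.card ≤ S'.card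

/-! ### Tree decompositions -/

/-- A tree decomposition of the undirected graph `H`, with tree nodes `I`. -/
structure TreeDecomposition {V : Type*} (I : Type*) [DecidableEq V] (H : SimpleGraph V) where
  tree : SimpleGraph I
  isTree : tree.IsTree
  bag : I → Finset V
  vertex_cover : ∀ v, ∃ i, v ∈ bag i
  edge_cover : ∀ u v, H.Adj u v → ∃ i, u ∈ bag i ∧ v ∈ bag i
  inter_subset : ∀ (i j k : I) (p : tree.Walk i k), p.IsPath → j ∈ p.support →
    bag i ∩ bag k ⊆ bag j

/-- The width: the largest size of a bag, minus one. (The truncated subtraction matters only for the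
graph without nodes, which gets width `0`.) -/
def TreeDecomposition.width {V I : Type*} [DecidableEq V] [Fintype I] {H : SimpleGraph V}
    (D : TreeDecomposition I H) : ℕ :=
  (Finset.univ.sup fun i => (D.bag i).card) - 1

/-! ### The machine model

A unit-cost random access machine, programmed in a structured language. The memory consists of
arrays `0, 1, 2, …` of natural numbers (a program mentions only finitely many of them), and the cells
of an array are addressed by computed natural numbers. The arithmetic is addition and truncated
subtraction. Every literal, memory access, arithmetic operation and control decision costs one
step. -/

namespace RAM

/-- Memory contents: `s a i` is the content of cell `i` of array `a`. -/
abbrev Mem := ℕ → ℕ → ℕ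

/-- Expressions; `get a e` reads the cell of array `a` whose address is the value of `e`. -/
inductive Expr
  | lit (c : ℕ)
  | get (a : ℕ) (e : Expr)
  | add (e f : Expr)
  | sub (e f : Expr)

/-- The value of an expression. -/
def Expr.eval (s : Mem) : Expr → ℕ
  | lit c => c
  | get a e => s a (e.eval s)
  | add e f => e.eval s + f.eval s
  | sub e f => e.eval s - f.eval s

/-- The number of steps taken to evaluate an expression. -/
def Expr.cost : Expr → ℕ
  | lit _ => 1
  | get _ e => e.cost + 1
  | add e f => e.cost + f.cost + 1
  | sub e f => e.cost + f.cost + 1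

/-- Programs; `set a e f` writes the value of `f` into the cell of array `a` whose address is the
value of `e`. The condition `e` of a branching or of a loop is true when its value is not zero. -/
inductive Prog
  | skip
  | set (a : ℕ) (e f : Expr)
  | seq (p q : Prog)
  | ite (e : Expr) (p q : Prog)
  | loop (e : Expr) (p : Prog)

/-- `write s a i v` is the memory `s` with cell `i` of array `a` overwritten by `v`. -/
def write (s : Mem) (a i v : ℕ) : Mem :=
  Function.update s a (Function.update (s a) i v)

/-- `Exec p s s' t`: started with memory `s`, the program `p` halts with memory `s'` after exactly
`t` steps. -/
inductive Exec : Prog → Mem → Mem → ℕ → Prop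
  | skip (s : Mem) : Exec .skip s s 1
  | set (s : Mem) (a : ℕ) (e f : Expr) :
      Exec (.set a e f) s (write s a (e.eval s) (f.eval s)) (e.cost + f.cost + 1)
  | seq {p q : Prog} {s s' s'' : Mem} {t t' : ℕ} :
      Exec p s s' t → Exec q s' s'' t' → Exec (.seq p q) s s'' (t + t')
  | ite_true {e : Expr} {p q : Prog} {s s' : Mem} {t : ℕ} :
      e.eval s ≠ 0 → Exec p s s' t → Exec (.ite e p q) s s' (e.cost + 1 + t)
  | ite_false {e : Expr} {p q : Prog} {s s' : Mem} {t : ℕ} :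
      e.eval s = 0 → Exec q s s' t → Exec (.ite e p q) s s' (e.cost + 1 + t)
  | loop_true {e : Expr} {p : Prog} {s s' s'' : Mem} {t t' : ℕ} :
      e.eval s ≠ 0 → Exec p s s' t → Exec (.loop e p) s' s'' t' →
      Exec (.loop e p) s s'' (e.cost + 1 + t + t')
  | loop_false {e : Expr} {p : Prog} {s : Mem} :
      e.eval s = 0 → Exec (.loop e p) s s (e.cost + 1)

/-- The initial memory on input `x`: array `0` holds the length of `x` followed by the entries of
`x`, and all other cells are zero. -/
def init (x : List ℕ) : Mem := fun a i => if a = 0 then (x.length :: x).getD i 0 else 0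

/-- `Computes p x y t`: on input `x` the program `p` halts after exactly `t` steps with output `y`,
that is, array `1` then begins with the length of `y` followed by the entries of `y`. -/
def Computes (p : Prog) (x y : List ℕ) (t : ℕ) : Prop :=
  ∃ s : Mem, Exec p (init x) s t ∧ ∀ i ≤ y.length, s 1 i = (y.length :: y).getD i 0

end RAM

/-! ### The input -/

/-- `A` lists every edge of the directed graph `G` exactly once, as a pair (tail, head). -/
def IsArcList {V : Type*} (G : Digraph V) (A : List (V × V)) : Prop :=
  A.Nodup ∧ ∀ u v, (u, v) ∈ A ↔ G.Adj u v

/-- `F` lists every edge of the undirected graph `T` exactly once, with its ends in either order. -/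
def IsEdgeList {I : Type*} (T : SimpleGraph I) (F : List (I × I)) : Prop :=
  (F.map fun e => s(e.1, e.2)).Nodup ∧ ∀ i j, s(i, j) ∈ (F.map fun e => s(e.1, e.2)) ↔ T.Adj i j

/-- `B i` lists every node of the bag `X i` exactly once. -/
def IsBagLists {V I : Type*} [DecidableEq V] (X : I → Finset V) (B : I → List V) : Prop :=
  ∀ i, (B i).Nodup ∧ (B i).toFinset = X i

/-- The input of the machine: the number `n` of graph nodes, the number `m` of tree nodes, the
numbers of graph edges and of tree edges, then the graph edges, the tree edges, and the bags of the
tree nodes `0, …, m - 1`, each preceded by its size. -/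
def encodeInput {n m : ℕ} (A : List (Fin n × Fin n)) (F : List (Fin m × Fin m))
    (B : Fin m → List (Fin n)) : List ℕ :=
  [n, m, A.length, F.length] ++
  A.flatMap (fun e => [(e.1 : ℕ), (e.2 : ℕ)]) ++
  F.flatMap (fun e => [(e.1 : ℕ), (e.2 : ℕ)]) ++
  (List.finRange m).flatMap (fun i => (B i).length :: (B i).map Fin.val)

/-! The program is a dynamic program over the tree decomposition. Two things need an idea: power
domination is a global process, and everything has to be executed on the machine in linear time.

Certificates. The process is replaced by an order. Each node v has two moments, its observation 2v
and its firing 2v + 1. A schedule (`IsSchedule`) is a strict partial order of the moments such that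
v is observed before it fires, for each arc from u to w the firing of u and the observation of w are
comparable, and at most one out-neighbour of u is observed after u fires. By `powerDominates_iff`, S
power dominates iff there is a schedule in which every node outside S is an out-neighbour of S or is
observed after the firing of some in-neighbour. The rounds of the process give such a schedule;
conversely, one argues by induction along the order.

Locality. Total orders of two parts of the graph need not fit together canonically, but strict
partial orders that agree on the overlap have a transitive union which restricts to both
(`amalgam_left`, `amalgam_trans`). All other conditions concern single nodes or arcs, and each arc
lies in one part. So a partial solution on a part is seen from outside only through its bag: which
bag nodes are selected, are caught, have used up their firing, and how the 2r moments of the bag's r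
nodes are ordered. `Merges.exists_describes` and `Describes.split` say that partial solutions of two
parts can be joined exactly when their states match. A state fits into a square bit matrix of side
2b + 3, where b is the largest bag size, whence 2 ^ O(k²) states.

Tables. The tree is not rooted. Leaves are contracted into their neighbours, and each remaining tree
node keeps, for every state, the least weight of a partial solution on its part of the graph
(`Contraction.step`, `isTable_merge`). Node v weighs 2^n + 2^v. Thus least weight implies least
size, distinct sets have distinct weights, and an optimal set is decoded from the binary digits of
the optimal value without storing any traceback.

Time. Programs are written in a small language in which every inner loop is cut off at the number N
of states and every outer loop at a number M bounded by the length of the lists. A program then runs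
in at most K (N + 1)^D (M + 1)^E steps, with K, D depending on the program text only and E the
nesting depth of outer loops (`Stmt.realizes`). All phases have E at most 1, which gives the linear
bound; `cost_le` collects the constants. -/

/-! ### A small high-level language for the machine

Pure expressions with bounded iteration, and statements with bounded loops, are compiled to machine
programs. Array `3` holds temporary values, and array `4` holds the caps on the number of rounds of
loops; they give uniform bounds on running times. -/

namespace RAM

/-- Pure expressions, in a de Bruijn environment. `fold e i b` iterates `b`, started at the value of
`i`; the environment of `b` is extended by the current value and the round number. -/
inductive PExpr
  | lit (c : ℕ)
  | var (x : ℕ)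
  | get (a : ℕ) (e : PExpr)
  | add (e f : PExpr)
  | sub (e f : PExpr)
  | ite (c e f : PExpr)
  | letE (e f : PExpr)
  | drop (k : ℕ) (e : PExpr)
  | fold (e i b : PExpr)

namespace PExpr

/-- The value of a pure expression. The number of rounds of a `fold` is capped by cell `0` of
array `4`. -/
def eval (s : Mem) : PExpr → List ℕ → ℕ
  | lit c, _ => c
  | var x, env => env.getD x 0
  | get a e, env => if a = 3 then 0 else s a (e.eval s env)
  | add e f, env => e.eval s env + f.eval s env
  | sub e f, env => e.eval s env - f.eval s env
  | ite c e f, env => if c.eval s env = 0 then f.eval s env else e.eval s env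
  | letE e f, env => f.eval s (e.eval s env :: env)
  | drop k e, env => e.eval s (env.drop k)
  | fold e i b, env =>
      Nat.rec (i.eval s env) (fun j acc => b.eval s (acc :: j :: env)) (min (e.eval s env) (s 4 0))

/-- The arrays read by a pure expression. -/
def reads : PExpr → List ℕ
  | lit _ => []
  | var _ => []
  | get a e => a :: e.reads
  | add e f => e.reads ++ f.reads
  | sub e f => e.reads ++ f.reads
  | ite c e f => c.reads ++ e.reads ++ f.reads
  | letE e f => e.reads ++ f.reads
  | drop _ e => e.reads
  | fold e i b => 4 :: (e.reads ++ i.reads ++ b.reads)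

/-- Array `3` cannot be read by a pure expression, so values are unaffected by the temporaries of
compiled code. -/
theorem eval_congr {s s' : Mem} (e : PExpr) : ∀ (env : List ℕ),
    (∀ a ∈ e.reads, a ≠ 3 → s a = s' a) → e.eval s env = e.eval s' env := by
  induction e with
  | lit c => intros; rfl
  | var x => intros; rfl
  | get a e ih =>
    intro env h
    simp only [eval]
    split_ifs with ha
    · rfl
    · rw [ih env fun a' h' => h a' (by simp [reads, h']), h a (by simp [reads]) ha]
  | add e f ihe ihf =>
    intro env h
    simp only [eval]
    rw [ihe env fun a h' => h a (by simp [reads, h']), ihf env fun a h' => h a (by simp [reads, h'])]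
  | sub e f ihe ihf =>
    intro env h
    simp only [eval]
    rw [ihe env fun a h' => h a (by simp [reads, h']), ihf env fun a h' => h a (by simp [reads, h'])]
  | ite c e f ihc ihe ihf =>
    intro env h
    simp only [eval]
    rw [ihc env fun a h' => h a (by simp [reads, h']), ihe env fun a h' => h a (by simp [reads, h']),
      ihf env fun a h' => h a (by simp [reads, h'])]
  | letE e f ihe ihf =>
    intro env h
    simp only [eval]
    rw [ihe env fun a h' => h a (by simp [reads, h']), ihf _ fun a h' => h a (by simp [reads, h'])]
  | drop k e ih => intro env h; exact ih _ h
  | fold e i b ihe ihi ihb =>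
    intro env h
    simp only [eval]
    rw [ihe env fun a h' => h a (by simp [reads, h']), ihi env fun a h' => h a (by simp [reads, h']),
      h 4 (by simp [reads]) (by decide)]
    congr 1
    funext j acc
    exact ihb _ fun a h' => h a (by simp [reads, h'])

/-- The machine program that computes the value of a pure expression into cell `d` of array `3`. The
variables are in the cells of array `3` listed in `ρ`, and cells from `d` on are free. -/
def compile : PExpr → List ℕ → ℕ → Prog
  | lit c, _, d => .set 3 (.lit d) (.lit c)
  | var x, ρ, d => .set 3 (.lit d) (ρ[x]?.elim (.lit 0) fun y => .get 3 (.lit y))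
  | get a e, ρ, d =>
      .seq (e.compile ρ d)
        (.set 3 (.lit d) (if a = 3 then .lit 0 else .get a (.get 3 (.lit d))))
  | add e f, ρ, d =>
      .seq (e.compile ρ d) (.seq (f.compile ρ (d + 1))
        (.set 3 (.lit d) (.add (.get 3 (.lit d)) (.get 3 (.lit (d + 1))))))
  | sub e f, ρ, d =>
      .seq (e.compile ρ d) (.seq (f.compile ρ (d + 1))
        (.set 3 (.lit d) (.sub (.get 3 (.lit d)) (.get 3 (.lit (d + 1))))))
  | ite c e f, ρ, d =>
      .seq (c.compile ρ d) (.ite (.get 3 (.lit d)) (e.compile ρ d) (f.compile ρ d))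
  | letE e f, ρ, d =>
      .seq (e.compile ρ d) (.seq (f.compile (d :: ρ) (d + 1))
        (.set 3 (.lit d) (.get 3 (.lit (d + 1)))))
  | drop k e, ρ, d => e.compile (ρ.drop k) d
  | fold e i b, ρ, d =>
      .seq (i.compile ρ d) (.seq (e.compile ρ (d + 1)) (.seq
        -- a - (a - b) is the minimum of a and b: the round number is cut at the cap before the loop
        -- starts.
        (.set 3 (.lit (d + 1)) (.sub (.get 3 (.lit (d + 1)))
          (.sub (.get 3 (.lit (d + 1))) (.get 4 (.lit 0))))) (.seq
        (.set 3 (.lit (d + 2)) (.lit 0))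
        (.loop (.sub (.get 3 (.lit (d + 1))) (.get 3 (.lit (d + 2))))
          (.seq (b.compile (d :: (d + 2) :: ρ) (d + 3)) (.seq
            (.set 3 (.lit d) (.get 3 (.lit (d + 3))))
            (.set 3 (.lit (d + 2)) (.add (.get 3 (.lit (d + 2))) (.lit 1)))))))))

end PExpr

@[simp] theorem write_apply_same (s : Mem) (a i v : ℕ) : write s a i v a i = v := by
  simp [write]

theorem write_apply (s : Mem) (a i v b j : ℕ) :
    write s a i v b j = if b = a ∧ j = i then v else s b j := by
  unfold write
  by_cases hb : b = a
  · subst hb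
    by_cases hj : j = i <;> simp [hj]
  · simp [hb]

theorem write_of_ne (s : Mem) {a b : ℕ} (i v : ℕ) (h : b ≠ a) : write s a i v b = s b := by
  simp [write, h]

/-- `p` halts after at most `t` steps, started with `s`, with a memory that satisfies `Q`. -/
def Halts (p : Prog) (s : Mem) (t : ℕ) (Q : Mem → Prop) : Prop :=
  ∃ s' t', Exec p s s' t' ∧ t' ≤ t ∧ Q s'

theorem Halts.mono {p : Prog} {s : Mem} {t t' : ℕ} {Q Q' : Mem → Prop} (h : Halts p s t Q)
    (ht : t ≤ t') (hQ : ∀ s', Q s' → Q' s') : Halts p s t' Q' :=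
  let ⟨s', u, h1, h2, h3⟩ := h
  ⟨s', u, h1, h2.trans ht, hQ _ h3⟩

theorem Halts.seq {p q : Prog} {s : Mem} {t t' : ℕ} {Q Q' : Mem → Prop} (hp : Halts p s t Q)
    (hq : ∀ s', Q s' → Halts q s' t' Q') : Halts (.seq p q) s (t + t') Q' :=
  let ⟨s', u, h1, h2, h3⟩ := hp
  let ⟨s'', u', h1', h2', h3'⟩ := hq s' h3
  ⟨s'', u + u', .seq h1 h1', by omega, h3'⟩

theorem Halts.set {s : Mem} {a : ℕ} {e f : Expr} {Q : Mem → Prop}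
    (h : Q (write s a (e.eval s) (f.eval s))) : Halts (.set a e f) s (e.cost + f.cost + 1) Q :=
  ⟨_, _, .set s a e f, le_rfl, h⟩

theorem Halts.ite {p q : Prog} {e : Expr} {s : Mem} {t : ℕ} {Q : Mem → Prop}
    (hp : e.eval s ≠ 0 → Halts p s t Q) (hq : e.eval s = 0 → Halts q s t Q) :
    Halts (.ite e p q) s (e.cost + 1 + t) Q := by
  by_cases h : e.eval s = 0
  · obtain ⟨s', u, h1, h2, h3⟩ := hq h
    exact ⟨s', _, .ite_false h h1, by omega, h3⟩
  · obtain ⟨s', u, h1, h2, h3⟩ := hp h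
    exact ⟨s', _, .ite_true h h1, by omega, h3⟩

theorem Halts.loop {p : Prog} {e : Expr} {n t : ℕ} (I : ℕ → Mem → Prop)
    (hstep : ∀ j < n, ∀ s, I j s → e.eval s ≠ 0 ∧ Halts p s t (I (j + 1)))
    (hend : ∀ s, I n s → e.eval s = 0) {s : Mem} (h0 : I 0 s) :
    Halts (.loop e p) s ((n + 1) * (e.cost + 1 + t)) (I n) := by
  have key : ∀ k j, j + k = n → ∀ s, I j s →
      Halts (.loop e p) s ((k + 1) * (e.cost + 1 + t)) (I n) := by
    intro k
    induction k with
    | zero =>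
      rintro j rfl s hs
      exact ⟨s, _, .loop_false (hend s hs), by simp, hs⟩
    | succ k ih =>
      intro j hj s hs
      obtain ⟨hne, s', u, h1, h2, h3⟩ := hstep j (by omega) s hs
      obtain ⟨s'', u', h1', h2', h3'⟩ := ih (j + 1) (by omega) s' h3
      exact ⟨s'', _, .loop_true hne h1 h1', by rw [Nat.succ_mul]; omega, h3'⟩
  exact key n 0 (by omega) s h0

/-- `s'` differs from `s` only in array `3`, from cell `d` on. -/
structure SameBelow (d : ℕ) (s s' : Mem) : Prop where
  tmp : ∀ y < d, s' 3 y = s 3 y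
  arr : ∀ a, a ≠ 3 → s' a = s a

theorem SameBelow.refl (d : ℕ) (s : Mem) : SameBelow d s s := ⟨fun _ _ => rfl, fun _ _ => rfl⟩

theorem SameBelow.trans {d d' : ℕ} {s s' s'' : Mem} (h : SameBelow d s s')
    (h' : SameBelow d' s' s'') (hd : d ≤ d') : SameBelow d s s'' :=
  ⟨fun y hy => (h'.tmp y (by omega)).trans (h.tmp y hy), fun a ha => (h'.arr a ha).trans (h.arr a ha)⟩

theorem SameBelow.write {d y : ℕ} {s s' : Mem} (v : ℕ) (h : SameBelow d s s') (hy : d ≤ y) :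
    SameBelow d s (write s' 3 y v) := by
  refine ⟨fun z hz => ?_, fun a ha => ?_⟩
  · rw [write_apply, if_neg (by omega), h.tmp z hz]
  · rw [write_of_ne _ _ _ ha, h.arr a ha]

theorem SameBelow.map_eq {d : ℕ} {s s' : Mem} (h : SameBelow d s s') {ρ : List ℕ}
    (hρ : ∀ y ∈ ρ, y < d) : ρ.map (s' 3) = ρ.map (s 3) :=
  List.map_congr_left fun y hy => h.tmp y (hρ y hy)

theorem SameBelow.eval_eq {d : ℕ} {s s' : Mem} (h : SameBelow d s s') (e : PExpr)
    (env : List ℕ) : e.eval s' env = e.eval s env :=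
  e.eval_congr env fun a _ ha => h.arr a ha

/-- Started with `s`, `p` computes `v` into cell `d` of array `3` within `t` steps. -/
def Evaluates (p : Prog) (d : ℕ) (s : Mem) (v t : ℕ) : Prop :=
  Halts p s t fun s' => s' 3 d = v ∧ SameBelow d s s'

theorem mul_succ_pow_le {k K x D E : ℕ} (hK : k ≤ K) (hD : D ≤ E) :
    k * (x + 1) ^ D ≤ K * (x + 1) ^ E :=
  Nat.mul_le_mul hK (Nat.pow_le_pow_right (by omega) hD)

/-- The constants depend on the expression alone: a `fold` runs its body at most `s 4 0` times, so
it raises the exponent by one, and every other construct adds the costs of its parts. -/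
theorem PExpr.compile_spec (e : PExpr) : ∃ K D : ℕ, ∀ (ρ : List ℕ) (d : ℕ) (s : Mem),
    (∀ y ∈ ρ, y < d) →
      Evaluates (e.compile ρ d) d s (e.eval s (ρ.map (s 3))) (K * (s 4 0 + 1) ^ D) := by
  induction e with
  | lit c =>
    refine ⟨3, 0, fun ρ d s hρ => ?_⟩
    exact Halts.set ⟨by simp [Expr.eval, eval], (SameBelow.refl d s).write _ le_rfl⟩
  | var x =>
    refine ⟨4, 0, fun ρ d s hρ => ?_⟩
    unfold compile
    refine (Halts.set ?_).mono (t := _) ?_ fun _ h => h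
    · refine ⟨?_, (SameBelow.refl d s).write _ le_rfl⟩
      cases h : ρ[x]? <;> simp [Expr.eval, eval, h]
    · cases ρ[x]? <;> simp [Expr.cost]
  | get a e ih =>
    obtain ⟨K, D, ih⟩ := ih
    refine ⟨K + 6, D, fun ρ d s hρ => ?_⟩
    refine (Halts.seq (ih ρ d s hρ) (t' := 6) fun s' hs' => ?_).mono ?_ fun _ h => h
    · refine (Halts.set ?_).mono (t := _) ?_ fun _ h => h
      · refine ⟨?_, hs'.2.write _ le_rfl⟩
        by_cases ha : a = 3
        · simp [ha, Expr.eval, eval]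
        · simp [ha, Expr.eval, eval, hs'.1, hs'.2.arr a ha]
      · split_ifs <;> simp [Expr.cost]
    · have := Nat.one_le_pow D (s 4 0 + 1) (by omega)
      nlinarith
  | add e f ihe ihf =>
    obtain ⟨K, D, ihe⟩ := ihe
    obtain ⟨K', D', ihf⟩ := ihf
    refine ⟨K + K' + 10, D + D', fun ρ d s hρ => ?_⟩
    have h1 := mul_succ_pow_le (x := s 4 0) (le_refl K) (Nat.le_add_right D D')
    have h2 := mul_succ_pow_le (x := s 4 0) (le_refl K') (Nat.le_add_left D' D)
    have h3 := Nat.one_le_pow (D + D') (s 4 0 + 1) (by omega)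
    refine (Halts.seq (ihe ρ d s hρ) (t' := K' * (s 4 0 + 1) ^ D' + 10) fun s' hs' => ?_).mono ?_
      fun _ h => h
    · refine Halts.seq (Q := fun s'' => s'' 3 (d + 1) = f.eval s (ρ.map (s 3)) ∧ SameBelow (d + 1) s' s'') ?_
        fun s'' hs'' => ?_
      · have := ihf ρ (d + 1) s' fun y hy => (hρ y hy).trans (Nat.lt_succ_self d)
        rw [hs'.2.arr 4 (by decide), hs'.2.eval_eq, hs'.2.map_eq hρ] at this
        exact this
      · refine (Halts.set ?_).mono (t := _) (by simp [Expr.cost]) fun _ h => h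
        refine ⟨?_, (hs'.2.trans hs''.2 (Nat.le_succ d)).write _ le_rfl⟩
        simp [Expr.eval, eval, hs''.1, hs''.2.tmp d (Nat.lt_succ_self d), hs'.1]
    · nlinarith
  | sub e f ihe ihf =>
    obtain ⟨K, D, ihe⟩ := ihe
    obtain ⟨K', D', ihf⟩ := ihf
    refine ⟨K + K' + 10, D + D', fun ρ d s hρ => ?_⟩
    have h1 := mul_succ_pow_le (x := s 4 0) (le_refl K) (Nat.le_add_right D D')
    have h2 := mul_succ_pow_le (x := s 4 0) (le_refl K') (Nat.le_add_left D' D)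
    have h3 := Nat.one_le_pow (D + D') (s 4 0 + 1) (by omega)
    refine (Halts.seq (ihe ρ d s hρ) (t' := K' * (s 4 0 + 1) ^ D' + 10) fun s' hs' => ?_).mono ?_
      fun _ h => h
    · refine Halts.seq (Q := fun s'' => s'' 3 (d + 1) = f.eval s (ρ.map (s 3)) ∧ SameBelow (d + 1) s' s'') ?_
        fun s'' hs'' => ?_
      · have := ihf ρ (d + 1) s' fun y hy => (hρ y hy).trans (Nat.lt_succ_self d)
        rw [hs'.2.arr 4 (by decide), hs'.2.eval_eq, hs'.2.map_eq hρ] at this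
        exact this
      · refine (Halts.set ?_).mono (t := _) (by simp [Expr.cost]) fun _ h => h
        refine ⟨?_, (hs'.2.trans hs''.2 (Nat.le_succ d)).write _ le_rfl⟩
        simp [Expr.eval, eval, hs''.1, hs''.2.tmp d (Nat.lt_succ_self d), hs'.1]
    · nlinarith
  | ite c e f ihc ihe ihf =>
    obtain ⟨K, D, ihc⟩ := ihc
    obtain ⟨K', D', ihe⟩ := ihe
    obtain ⟨K'', D'', ihf⟩ := ihf
    refine ⟨K + K' + K'' + 3, D + D' + D'', fun ρ d s hρ => ?_⟩
    have h1 := mul_succ_pow_le (x := s 4 0) (le_refl K) (show D ≤ D + D' + D'' by omega)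
    have h2 := mul_succ_pow_le (x := s 4 0) (le_refl K') (show D' ≤ D + D' + D'' by omega)
    have h3 := mul_succ_pow_le (x := s 4 0) (le_refl K'') (show D'' ≤ D + D' + D'' by omega)
    have h4 := Nat.one_le_pow (D + D' + D'') (s 4 0 + 1) (by omega)
    refine (Halts.seq (ihc ρ d s hρ) (t' := 3 + (K' * (s 4 0 + 1) ^ D' + K'' * (s 4 0 + 1) ^ D''))
      fun s' hs' => ?_).mono ?_ fun _ h => h
    · refine Halts.ite (fun hne => ?_) fun heq => ?_
      · have := ihe ρ d s' hρ
        rw [hs'.2.arr 4 (by decide), hs'.2.eval_eq, hs'.2.map_eq hρ] at this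
        refine this.mono (Nat.le_add_right _ _) fun s'' hs'' => ⟨?_, hs'.2.trans hs''.2 le_rfl⟩
        rw [hs''.1]
        simp only [Expr.eval, hs'.1] at hne
        simp [eval, hne]
      · have := ihf ρ d s' hρ
        rw [hs'.2.arr 4 (by decide), hs'.2.eval_eq, hs'.2.map_eq hρ] at this
        refine this.mono (Nat.le_add_left _ _) fun s'' hs'' => ⟨?_, hs'.2.trans hs''.2 le_rfl⟩
        rw [hs''.1]
        simp only [Expr.eval, hs'.1] at heq
        simp [eval, heq]
    · nlinarith
  | letE e f ihe ihf =>
    obtain ⟨K, D, ihe⟩ := ihe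
    obtain ⟨K', D', ihf⟩ := ihf
    refine ⟨K + K' + 10, D + D', fun ρ d s hρ => ?_⟩
    have h1 := mul_succ_pow_le (x := s 4 0) (le_refl K) (Nat.le_add_right D D')
    have h2 := mul_succ_pow_le (x := s 4 0) (le_refl K') (Nat.le_add_left D' D)
    have h3 := Nat.one_le_pow (D + D') (s 4 0 + 1) (by omega)
    refine (Halts.seq (ihe ρ d s hρ) (t' := K' * (s 4 0 + 1) ^ D' + 10) fun s' hs' => ?_).mono ?_
      fun _ h => h
    · refine Halts.seq (Q := fun s'' => s'' 3 (d + 1) =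
        f.eval s (e.eval s (ρ.map (s 3)) :: ρ.map (s 3)) ∧ SameBelow (d + 1) s' s'') ?_
        fun s'' hs'' => ?_
      · have := ihf (d :: ρ) (d + 1) s' (by
          intro y hy
          rcases List.mem_cons.1 hy with rfl | hy
          · omega
          · have := hρ y hy; omega)
        rw [hs'.2.arr 4 (by decide), hs'.2.eval_eq, List.map_cons, hs'.2.map_eq hρ, hs'.1] at this
        exact this
      · refine (Halts.set ?_).mono (t := _) (by simp [Expr.cost]) fun _ h => h
        refine ⟨?_, (hs'.2.trans hs''.2 (Nat.le_succ d)).write _ le_rfl⟩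
        simp [Expr.eval, eval, hs''.1]
    · nlinarith
  | drop k e ih =>
    obtain ⟨K, D, ih⟩ := ih
    refine ⟨K, D, fun ρ d s hρ => ?_⟩
    have := ih (ρ.drop k) d s fun y hy => hρ y (List.mem_of_mem_drop hy)
    rw [List.map_drop] at this
    exact this
  | fold e i b ihe ihi ihb =>
    obtain ⟨K, D, ihe⟩ := ihe
    obtain ⟨K', D', ihi⟩ := ihi
    obtain ⟨K'', D'', ihb⟩ := ihb
    refine ⟨K + K' + K'' + 100, D + D' + D'' + 1, fun ρ d s hρ => ?_⟩
    have h1 := mul_succ_pow_le (x := s 4 0) (le_refl K) (show D ≤ D + D' + D'' + 1 by omega)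
    have h2 := mul_succ_pow_le (x := s 4 0) (le_refl K') (show D' ≤ D + D' + D'' + 1 by omega)
    have h3 := mul_succ_pow_le (x := s 4 0) (le_refl K'') (show D'' + 1 ≤ D + D' + D'' + 1 by omega)
    have h4 := mul_succ_pow_le (x := s 4 0) (le_refl 1) (show 1 ≤ D + D' + D'' + 1 by omega)
    set N := s 4 0 with hN
    set env := ρ.map (s 3) with henv
    set v := e.eval s env with hv
    set n := min v N with hn
    have hnN : n ≤ N := min_le_right _ _
    refine (Halts.seq (ihi ρ d s hρ) (t' := (K * (N + 1) ^ D + (12 + (3 + (N + 1) *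
      (6 + (K'' * (N + 1) ^ D'' + 15)))))) fun s1 hs1 => ?_).mono ?_ fun _ h => h
    · refine Halts.seq (Q := fun s' => s' 3 (d + 1) = v ∧ SameBelow (d + 1) s1 s') ?_
        fun s2 hs2 => ?_
      · have := ihe ρ (d + 1) s1 fun y hy => (hρ y hy).trans (Nat.lt_succ_self d)
        rw [hs1.2.arr 4 (by decide), hs1.2.eval_eq, hs1.2.map_eq hρ] at this
        exact this
      have b2 : SameBelow d s s2 := hs1.2.trans hs2.2 (Nat.le_succ d)
      have a2 : s2 3 d = i.eval s env := (hs2.2.tmp d (Nat.lt_succ_self d)).trans hs1.1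
      refine Halts.seq (Q := fun s' => s' 3 d = i.eval s env ∧ s' 3 (d + 1) = n ∧
        SameBelow d s s') ((Halts.set ?_).mono (t := _) (by simp [Expr.cost]) fun _ h => h)
        fun s3 hs3 => ?_
      · refine ⟨?_, ?_, b2.write _ (Nat.le_succ d)⟩
        · simp [write_apply, a2, Expr.eval]
        · simp only [write_apply, Expr.eval, hs2.1, b2.arr 4 (by decide), true_and, if_true]
          omega
      refine Halts.seq (Q := fun s' => s' 3 d = i.eval s env ∧ s' 3 (d + 1) = n ∧ s' 3 (d + 2) = 0 ∧
        SameBelow d s s') ((Halts.set ?_).mono (t := _) (by simp [Expr.cost]) fun _ h => h)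
        fun s4 hs4 => ?_
      · refine ⟨?_, ?_, ?_, hs3.2.2.write _ (Nat.le_add_right d 2)⟩
        · simp [write_apply, hs3.1, Expr.eval]
        · simp [write_apply, hs3.2.1, Expr.eval]
        · simp [Expr.eval]
      -- Cell d holds the accumulator, d + 1 the number of rounds and d + 2 the current round; the
      -- body works from d + 3 on and leaves these alone.
      refine (Halts.loop (n := n) (t := K'' * (N + 1) ^ D'' + 15)
        (fun j s' => s' 3 d = Nat.rec (i.eval s env) (fun j acc => b.eval s (acc :: j :: env)) j ∧
          s' 3 (d + 1) = n ∧ s' 3 (d + 2) = j ∧ SameBelow d s s') ?_ ?_ hs4).mono ?_ ?_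
      · intro j hj s' hs'
        obtain ⟨c1, c2, c3, c4⟩ := hs'
        refine ⟨by simp [Expr.eval, c2, c3]; omega, ?_⟩
        refine Halts.seq (Q := fun s'' => s'' 3 (d + 3) = b.eval s (Nat.rec (i.eval s env)
          (fun j acc => b.eval s (acc :: j :: env)) j :: j :: env) ∧ SameBelow (d + 3) s' s'') ?_
          fun s'' hs'' => ?_
        · have := ihb (d :: (d + 2) :: ρ) (d + 3) s' (by
            intro y hy
            simp only [List.mem_cons] at hy
            rcases hy with rfl | rfl | hy
            · omega
            · omega
            · have := hρ y hy; omega)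
          rw [c4.arr 4 (by decide), c4.eval_eq, List.map_cons, List.map_cons, c4.map_eq hρ, c1, c3]
            at this
          exact this
        · have e1 := hs''.2.tmp (d + 1) (by omega)
          have e2 := hs''.2.tmp (d + 2) (by omega)
          have e4 : SameBelow d s s'' := c4.trans hs''.2 (by omega)
          refine (Halts.seq (Q := fun s' => s' 3 d = Nat.rec (i.eval s env)
            (fun j acc => b.eval s (acc :: j :: env)) (j + 1) ∧ s' 3 (d + 1) = n ∧
            s' 3 (d + 2) = j ∧ SameBelow d s s') (t' := 6 + 1) ((Halts.set ?_).mono (t := _) (t' := 8)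
            (by simp [Expr.cost]) fun _ h => h) fun s5 hs5 =>
            ((Halts.set ?_).mono (t := _) (by simp [Expr.cost]) fun _ h => h)).mono (by simp) fun _ h => h
          · refine ⟨?_, ?_, ?_, e4.write _ le_rfl⟩
            · simp [Expr.eval, hs''.1]
            · simp [write_apply, Expr.eval, e1, c2]
            · simp [write_apply, Expr.eval, e2, c3]
          · refine ⟨?_, ?_, ?_, hs5.2.2.2.write _ (Nat.le_add_right d 2)⟩
            · simp [write_apply, Expr.eval, hs5.1]
            · simp [write_apply, Expr.eval, hs5.2.1]
            · simp [Expr.eval, hs5.2.2.1]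
      · intro s' hs'
        simp [Expr.eval, hs'.2.1, hs'.2.2.1]
      · simpa [Expr.cost] using hnN
      · intro s' hs'
        refine ⟨?_, hs'.2.2.2⟩
        rw [hs'.1]
        simp only [eval]
        rfl
    · have h5 : K'' * (N + 1) ^ (D'' + 1) = (N + 1) * (K'' * (N + 1) ^ D'') := by ring
      have h6 : 1 ≤ N + 1 := by omega
      rw [pow_one, one_mul, one_mul] at h4
      calc _ = K' * (N + 1) ^ D' + K * (N + 1) ^ D + K'' * (N + 1) ^ (D'' + 1) + 15
            + 21 * (N + 1) := by rw [h5]; ring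
        _ ≤ _ := by nlinarith

end RAM

/-! ### Statements: semantics, compilation and cost -/

namespace RAM

/-- Statements. `letS e p` and `loop κ e p` extend the environment of `p` by the value of `e` and
by the round number, respectively. -/
inductive Stmt
  | skip
  | set (a : ℕ) (e f : PExpr)
  | seq (p q : Stmt)
  | ite (c : PExpr) (p q : Stmt)
  | letS (e : PExpr) (p : Stmt)
  | loop (κ : Bool) (e : PExpr) (p : Stmt)

namespace Stmt

/-- The cell of array `4` that caps the number of rounds of a loop. -/
def capCell (κ : Bool) : ℕ := if κ then 1 else 0

/-- The memory after a statement. -/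
def run : Stmt → List ℕ → Mem → Mem
  | skip, _, s => s
  | set a e f, env, s => if a = 3 then s else write s a (e.eval s env) (f.eval s env)
  | seq p q, env, s => q.run env (p.run env s)
  | ite c p q, env, s => if c.eval s env = 0 then q.run env s else p.run env s
  | letS e p, env, s => p.run (e.eval s env :: env) s
  | loop κ e p, env, s =>
      Nat.rec s (fun j s' => p.run (j :: env) s') (min (e.eval s env) (s 4 (capCell κ)))

/-- The arrays written by a statement. -/
def writes : Stmt → List ℕ
  | skip => []
  | set a _ _ => [a]
  | seq p q => p.writes ++ q.writes
  | ite _ p q => p.writes ++ q.writes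
  | letS _ p => p.writes
  | loop _ _ p => p.writes

/-- The nesting depth of loops with the cap in cell `1` of array `4`. -/
def depth : Stmt → ℕ
  | skip => 0
  | set _ _ _ => 0
  | seq p q => max p.depth q.depth
  | ite _ p q => max p.depth q.depth
  | letS _ p => p.depth
  | loop κ _ p => p.depth + capCell κ

theorem run_frame (p : Stmt) : ∀ (env : List ℕ) (s : Mem) {a : ℕ}, a ∉ p.writes →
    p.run env s a = s a := by
  induction p with
  | skip => intros; rfl
  | set b e f =>
    intro env s a ha
    simp only [writes, List.mem_singleton] at ha
    simp only [run]
    split_ifs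
    · rfl
    · exact write_of_ne _ _ _ ha
  | seq p q ihp ihq =>
    intro env s a ha
    simp only [writes, List.mem_append, not_or] at ha
    simp only [run]
    rw [ihq _ _ ha.2, ihp _ _ ha.1]
  | ite c p q ihp ihq =>
    intro env s a ha
    simp only [writes, List.mem_append, not_or] at ha
    simp only [run]
    split_ifs
    · exact ihq _ _ ha.2
    · exact ihp _ _ ha.1
  | letS e p ih => intro env s a ha; exact ih _ _ ha
  | loop κ e p ih =>
    intro env s a ha
    simp only [run]
    generalize min (e.eval s env) (s 4 (capCell κ)) = n
    induction n with
    | zero => rfl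
    | succ n ihn => exact (ih _ _ ha).trans ihn

theorem run_congr (p : Stmt) : ∀ (env : List ℕ) {s s' : Mem}, (∀ a, a ≠ 3 → s a = s' a) →
    ∀ a, a ≠ 3 → p.run env s a = p.run env s' a := by
  induction p with
  | skip => intro env s s' h; exact h
  | set b e f =>
    intro env s s' h a ha
    simp only [run]
    split_ifs
    · exact h a ha
    · funext j
      rw [e.eval_congr env fun a _ => h a, f.eval_congr env fun a _ => h a, write_apply, write_apply,
        h a ha]
  | seq p q ihp ihq => intro env s s' h; exact ihq _ (ihp _ h)
  | ite c p q ihp ihq =>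
    intro env s s' h a ha
    simp only [run]
    rw [c.eval_congr env fun a _ => h a]
    split_ifs
    · exact ihq _ h a ha
    · exact ihp _ h a ha
  | letS e p ih =>
    intro env s s' h a ha
    simp only [run]
    rw [e.eval_congr env fun a _ => h a]
    exact ih _ h a ha
  | loop κ e p ih =>
    intro env s s' h
    simp only [run]
    rw [e.eval_congr env fun a _ => h a, h 4 (by decide)]
    generalize min (e.eval s' env) (s' 4 (capCell κ)) = n
    induction n with
    | zero => exact h
    | succ n ihn => exact ih _ ihn

/-- The step may assume that arrays not written by the body still have their contents from before
the loop, so invariants need not carry frame conditions. -/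
theorem run_loop_inv {κ : Bool} {e : PExpr} {p : Stmt} {env : List ℕ} {s : Mem}
    (I : ℕ → Mem → Prop) {n : ℕ} (hn : min (e.eval s env) (s 4 (capCell κ)) = n) (h0 : I 0 s)
    (hstep : ∀ j < n, ∀ s', (∀ a ∉ p.writes, s' a = s a) → I j s' → I (j + 1) (p.run (j :: env) s')) :
    I n ((loop κ e p).run env s) := by
  simp only [run]
  rw [hn]
  have : ∀ k ≤ n, (∀ a ∉ p.writes, (Nat.rec s (fun j s' => p.run (j :: env) s') k : Mem) a = s a) ∧
      I k (Nat.rec s (fun j s' => p.run (j :: env) s') k) := by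
    intro k
    induction k with
    | zero => exact fun _ => ⟨fun _ _ => rfl, h0⟩
    | succ k ih =>
      intro hk
      obtain ⟨h1, h2⟩ := ih (by omega)
      exact ⟨fun a ha => (run_frame p _ _ ha).trans (h1 a ha), hstep k (by omega) _ h1 h2⟩
  exact (this n le_rfl).2

/-- A loop that fills pairwise different cells of an array. -/
theorem run_fill {κ : Bool} {e f g : PExpr} {a : ℕ} {env : List ℕ} {s : Mem} {n : ℕ}
    (hn : min (e.eval s env) (s 4 (capCell κ)) = n) (ha : a ≠ 3) (hf : a ∉ f.reads)
    (hg : a ∉ g.reads)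
    (hinj : ∀ j < n, ∀ k < n, f.eval s (j :: env) = f.eval s (k :: env) → j = k) :
    (∀ j < n, (loop κ e (set a f g)).run env s a (f.eval s (j :: env)) = g.eval s (j :: env)) ∧
      ∀ c, (∀ j < n, c ≠ f.eval s (j :: env)) → (loop κ e (set a f g)).run env s a c = s a c := by
  refine run_loop_inv (fun k s' => (∀ j < n, j < k → s' a (f.eval s (j :: env)) =
    g.eval s (j :: env)) ∧ ∀ c, (∀ j < n, c ≠ f.eval s (j :: env)) → s' a c = s a c) hn
    ⟨fun j _ hj => absurd hj (Nat.not_lt_zero j), fun _ _ => rfl⟩ ?_ |>.imp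
    (fun h j hj => h j hj hj) id
  rintro k hk s' hs' ⟨h1, h2⟩
  have e1 : f.eval s' (k :: env) = f.eval s (k :: env) :=
    f.eval_congr _ fun b hb _ => hs' b (by simp only [writes, List.mem_singleton]; rintro rfl; exact hf hb)
  have e2 : g.eval s' (k :: env) = g.eval s (k :: env) :=
    g.eval_congr _ fun b hb _ => hs' b (by simp only [writes, List.mem_singleton]; rintro rfl; exact hg hb)
  simp only [run, if_neg ha, e1, e2, write_apply, true_and]
  refine ⟨fun j hj hjk => ?_, fun c hc => ?_⟩
  · split_ifs with h
    · rw [hinj j hj k hk h]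
    · refine h1 j hj (lt_of_le_of_ne (Nat.le_of_lt_succ hjk) ?_)
      rintro rfl
      exact h rfl
  · rw [if_neg (hc k hk), h2 c hc]

/-- The machine program for a statement; see `PExpr.compile`. -/
def compile : Stmt → List ℕ → ℕ → Prog
  | skip, _, _ => .skip
  | set a e f, ρ, d =>
      .seq (e.compile ρ d) (.seq (f.compile ρ (d + 1))
        (if a = 3 then .skip else .set a (.get 3 (.lit d)) (.get 3 (.lit (d + 1)))))
  | seq p q, ρ, d => .seq (p.compile ρ d) (q.compile ρ d)
  | ite c p q, ρ, d =>
      .seq (c.compile ρ d) (.ite (.get 3 (.lit d)) (p.compile ρ d) (q.compile ρ d))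
  | letS e p, ρ, d => .seq (e.compile ρ d) (p.compile (d :: ρ) (d + 1))
  | loop κ e p, ρ, d =>
      .seq (e.compile ρ d) (.seq
        (.set 3 (.lit d) (.sub (.get 3 (.lit d))
          (.sub (.get 3 (.lit d)) (.get 4 (.lit (capCell κ)))))) (.seq
        (.set 3 (.lit (d + 1)) (.lit 0))
        (.loop (.sub (.get 3 (.lit d)) (.get 3 (.lit (d + 1))))
          (.seq (p.compile ((d + 1) :: ρ) (d + 2))
            (.set 3 (.lit (d + 1)) (.add (.get 3 (.lit (d + 1))) (.lit 1)))))))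

/-- `s'` is `r` except in array `3`, where it agrees with `s` below cell `d`. -/
structure Reaches (d : ℕ) (s r s' : Mem) : Prop where
  tmp : ∀ y < d, s' 3 y = s 3 y
  arr : ∀ a, a ≠ 3 → s' a = r a

theorem Reaches.of_same {d : ℕ} {s r s' s'' : Mem} (h : SameBelow d s s') (h' : Reaches d s' r s'') :
    Reaches d s r s'' :=
  ⟨fun y hy => (h'.tmp y hy).trans (h.tmp y hy), h'.arr⟩

/-- The machine program for `p` does what `p` says, within the given number of steps. -/
def Realizes (p : Stmt) (K D E : ℕ) : Prop :=
  ∀ (ρ : List ℕ) (d : ℕ) (s : Mem), (∀ y ∈ ρ, y < d) →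
    Halts (p.compile ρ d) s (K * (s 4 0 + 1) ^ D * (s 4 1 + 1) ^ E)
      (Reaches d s (p.run (ρ.map (s 3)) s))

theorem Realizes.mono {p : Stmt} {K D E K' D' E' : ℕ} (h : p.Realizes K D E) (hK : K ≤ K')
    (hD : D ≤ D') (hE : E ≤ E') : p.Realizes K' D' E' := fun ρ d s hρ =>
  (h ρ d s hρ).mono (Nat.mul_le_mul (mul_succ_pow_le hK hD)
    (Nat.pow_le_pow_right (Nat.succ_pos _) hE)) fun _ h => h

/-- Here a = 4 is allowed: both operands are evaluated before the write, hence under the old caps.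
This is how the caps themselves get set. -/
theorem realizes_set (a : ℕ) (e f : PExpr) : ∃ K D, (set a e f).Realizes K D 0 := by
  obtain ⟨K, D, ihe⟩ := e.compile_spec
  obtain ⟨K', D', ihf⟩ := f.compile_spec
  refine ⟨K + K' + 6, D + D', fun ρ d s hρ => ?_⟩
  have h1 := mul_succ_pow_le (x := s 4 0) (le_refl K) (Nat.le_add_right D D')
  have h2 := mul_succ_pow_le (x := s 4 0) (le_refl K') (Nat.le_add_left D' D)
  have h3 := Nat.one_le_pow (D + D') (s 4 0 + 1) (by omega)
  refine (Halts.seq (ihe ρ d s hρ) (t' := K' * (s 4 0 + 1) ^ D' + 6) fun s' hs' => ?_).mono ?_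
    fun _ h => h
  · refine Halts.seq (Q := fun s'' => s'' 3 (d + 1) = f.eval s (ρ.map (s 3)) ∧
      SameBelow (d + 1) s' s'') ?_ fun s'' hs'' => ?_
    · have := ihf ρ (d + 1) s' fun y hy => (hρ y hy).trans (Nat.lt_succ_self d)
      rw [hs'.2.arr 4 (by decide), hs'.2.eval_eq, hs'.2.map_eq hρ] at this
      exact this
    · have hb := hs'.2.trans hs''.2 (Nat.le_succ d)
      by_cases ha : a = 3
      · rw [if_pos ha]
        refine ⟨s'', 1, .skip _, by omega, hb.tmp, ?_⟩
        simpa [run, ha] using hb.arr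
      · rw [if_neg ha]
        refine (Halts.set ?_).mono (t := _) (by simp [Expr.cost]) fun _ h => h
        refine ⟨fun y hy => ?_, fun b hb' => ?_⟩
        · rw [write_of_ne _ _ _ (Ne.symm ha), hb.tmp y hy]
        · funext j
          simp only [run, if_neg ha, write_apply, Expr.eval, hs''.1,
            hs''.2.tmp d (Nat.lt_succ_self d), hs'.1, hb.arr b hb']
  · rw [pow_zero, mul_one]
    nlinarith

/-- The caps do not change during p, so one pair of numbers bounds all loops. A loop with cap cell
`1` raises the exponent of the second factor, any other loop that of the first. -/
theorem realizes (p : Stmt) (h4 : 4 ∉ p.writes) : ∃ K D, p.Realizes K D p.depth := by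
  induction p with
  | skip => exact ⟨1, 0, fun ρ d s _ => ⟨s, 1, .skip s, by simp [depth], fun _ _ => rfl,
      fun _ _ => rfl⟩⟩
  | set a e f => exact realizes_set a e f
  | seq p q ihp ihq =>
    simp only [writes, List.mem_append, not_or] at h4
    obtain ⟨K, D, ihp⟩ := ihp h4.1
    obtain ⟨K', D', ihq⟩ := ihq h4.2
    have ihp := ihp.mono le_rfl (Nat.le_add_right D D') (le_max_left p.depth q.depth)
    have ihq := ihq.mono le_rfl (Nat.le_add_left D' D) (le_max_right p.depth q.depth)
    refine ⟨K + K', D + D', fun ρ d s hρ => ?_⟩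
    refine (Halts.seq (ihp ρ d s hρ) fun s' hs' => ?_).mono
      (t := _ + K' * (s 4 0 + 1) ^ (D + D') * (s 4 1 + 1) ^ (max p.depth q.depth))
      (by simp only [depth]; rw [← add_mul, ← add_mul]) fun _ h => h
    have h4' : s' 4 = s 4 := (hs'.arr 4 (by decide)).trans (run_frame _ _ _ h4.1)
    rw [← h4']
    refine (ihq ρ d s' hρ).mono le_rfl fun s'' hs'' => ⟨fun y hy => ?_, fun a ha => ?_⟩
    · rw [hs''.tmp y hy, hs'.tmp y hy]
    · rw [hs''.arr a ha, run, List.map_congr_left fun y hy => hs'.tmp y (hρ y hy)]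
      exact run_congr q _ hs'.arr a ha
  | ite c p q ihp ihq =>
    simp only [writes, List.mem_append, not_or] at h4
    obtain ⟨K, D, ihc⟩ := c.compile_spec
    obtain ⟨K', D', ihp⟩ := ihp h4.1
    obtain ⟨K'', D'', ihq⟩ := ihq h4.2
    have ihp := ihp.mono (Nat.le_add_right K' K'') (show D' ≤ D + D' + D'' by omega)
      (le_max_left p.depth q.depth)
    have ihq := ihq.mono (Nat.le_add_left K'' K') (show D'' ≤ D + D' + D'' by omega)
      (le_max_right p.depth q.depth)
    refine ⟨K + 3 + (K' + K''), D + D' + D'', fun ρ d s hρ => ?_⟩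
    refine (Halts.seq (ihc ρ d s hρ) (t' := 3 + (K' + K'') * (s 4 0 + 1) ^ (D + D' + D'') *
      (s 4 1 + 1) ^ (max p.depth q.depth)) fun s' hs' => ?_).mono ?_ fun _ h => h
    · have h4' : s' 4 = s 4 := hs'.2.arr 4 (by decide)
      refine Halts.ite (fun hne => ?_) fun heq => ?_
      · rw [← h4']
        refine (ihp ρ d s' hρ).mono le_rfl fun s'' hs'' => .of_same hs'.2 ⟨hs''.tmp, fun a ha => ?_⟩
        simp only [Expr.eval, hs'.1] at hne
        rw [hs''.arr a ha, run, if_neg hne, hs'.2.map_eq hρ]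
        exact run_congr p _ hs'.2.arr a ha
      · rw [← h4']
        refine (ihq ρ d s' hρ).mono le_rfl fun s'' hs'' => .of_same hs'.2 ⟨hs''.tmp, fun a ha => ?_⟩
        simp only [Expr.eval, hs'.1] at heq
        rw [hs''.arr a ha, run, if_pos heq, hs'.2.map_eq hρ]
        exact run_congr q _ hs'.2.arr a ha
    · simp only [depth]
      set A := (s 4 0 + 1) ^ (D + D' + D'') with hA
      set B := (s 4 1 + 1) ^ (max p.depth q.depth) with hB
      have h1 : (s 4 0 + 1) ^ D ≤ A := Nat.pow_le_pow_right (by omega) (by omega)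
      have h2 : 1 ≤ A := Nat.one_le_pow _ _ (by omega)
      have h3 : 1 ≤ B := Nat.one_le_pow _ _ (by omega)
      have h5 : A ≤ A * B := Nat.le_mul_of_pos_right _ h3
      calc K * (s 4 0 + 1) ^ D + (3 + (K' + K'') * A * B)
          ≤ K * (A * B) + (3 * (A * B) + (K' + K'') * A * B) := by
            gcongr
            · exact h1.trans h5
            · omega
        _ = (K + 3 + (K' + K'')) * A * B := by ring
  | letS e p ih =>
    obtain ⟨K, D, ihe⟩ := e.compile_spec
    obtain ⟨K', D', ih⟩ := ih h4
    have ih := ih.mono le_rfl (Nat.le_add_left D' D) le_rfl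
    refine ⟨K + K', D + D', fun ρ d s hρ => ?_⟩
    refine (Halts.seq (ihe ρ d s hρ) (t' := K' * (s 4 0 + 1) ^ (D + D') *
      (s 4 1 + 1) ^ p.depth) fun s' hs' => ?_).mono ?_ fun _ h => h
    · have h4' : s' 4 = s 4 := hs'.2.arr 4 (by decide)
      rw [← h4']
      refine (ih (d :: ρ) (d + 1) s' (by
        intro y hy
        rcases List.mem_cons.1 hy with rfl | hy
        · omega
        · have := hρ y hy; omega)).mono le_rfl fun s'' hs'' =>
          ⟨fun y hy => ?_, fun a ha => ?_⟩
      · rw [hs''.tmp y (by omega), hs'.2.tmp y hy]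
      · rw [hs''.arr a ha, run, List.map_cons, hs'.2.map_eq hρ, hs'.1]
        exact run_congr p _ hs'.2.arr a ha
    · simp only [depth]
      set A := (s 4 0 + 1) ^ (D + D') with hA
      set B := (s 4 1 + 1) ^ p.depth with hB
      have h1 : (s 4 0 + 1) ^ D ≤ A := Nat.pow_le_pow_right (by omega) (by omega)
      have h3 : 1 ≤ B := Nat.one_le_pow _ _ (by omega)
      have h5 : A ≤ A * B := Nat.le_mul_of_pos_right _ h3
      calc K * (s 4 0 + 1) ^ D + K' * A * B ≤ K * (A * B) + K' * A * B := by
            gcongr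
            exact h1.trans h5
        _ = (K + K') * A * B := by ring
  | loop κ e p ih =>
    obtain ⟨K, D, ihe⟩ := e.compile_spec
    obtain ⟨K', D', ih⟩ := ih h4
    refine ⟨K + K' + 100, D + D' + 1, fun ρ d s hρ => ?_⟩
    set A := (s 4 0 + 1) ^ (D + D') with hA
    set B := (s 4 1 + 1) ^ p.depth with hB
    set env := ρ.map (s 3) with henv
    set v := e.eval s env with hv
    set n := min v (s 4 (capCell κ)) with hn
    have hnN : n ≤ s 4 (capCell κ) := min_le_right _ _
    set f : ℕ → Mem := Nat.rec s (fun j s' => p.run (j :: env) s') with hf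
    have f4 : ∀ j, f j 4 = s 4 := by
      intro j
      induction j with
      | zero => rfl
      | succ j ihj => exact (run_frame p _ _ h4).trans ihj
    have h1 : (s 4 0 + 1) ^ D ≤ A := Nat.pow_le_pow_right (by omega) (by omega)
    have h1' : (s 4 0 + 1) ^ D' ≤ A := Nat.pow_le_pow_right (by omega) (by omega)
    refine (Halts.seq (ihe ρ d s hρ) (t' := 12 + (3 + (n + 1) * (6 + (K' * A * B + 15))))
      fun s1 hs1 => ?_).mono ?_ fun _ h => h
    · refine Halts.seq (Q := fun s' => s' 3 d = n ∧ SameBelow d s s')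
        ((Halts.set ?_).mono (t := _) (by simp [Expr.cost]) fun _ h => h) fun s3 hs3 => ?_
      · refine ⟨?_, hs1.2.write _ le_rfl⟩
        simp only [write_apply, Expr.eval, hs1.1, hs1.2.arr 4 (by decide), true_and, if_true, ← henv, ← hv]
        omega
      refine Halts.seq (Q := fun s' => s' 3 d = n ∧ s' 3 (d + 1) = 0 ∧ SameBelow d s s')
        ((Halts.set ?_).mono (t := _) (by simp [Expr.cost]) fun _ h => h) fun s4 hs4 => ?_
      · refine ⟨?_, ?_, hs3.2.write _ (Nat.le_add_right d 1)⟩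
        · simp [write_apply, hs3.1, Expr.eval]
        · simp [Expr.eval]
      refine (Halts.loop (n := n) (t := K' * A * B + 15)
        (fun j s' => s' 3 d = n ∧ s' 3 (d + 1) = j ∧ Reaches d s (f j) s') ?_ ?_
          ⟨hs4.1, hs4.2.1, hs4.2.2.tmp, hs4.2.2.arr⟩).mono ?_ ?_
      · rintro j hj s' ⟨c2, c3, c4⟩
        refine ⟨by simp [Expr.eval, c2, c3]; omega, ?_⟩
        have h4' : s' 4 = s 4 := (c4.arr 4 (by decide)).trans (f4 j)
        refine Halts.seq (Q := fun s'' => s'' 3 d = n ∧ s'' 3 (d + 1) = j ∧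
          Reaches d s (f (j + 1)) s'') ?_ fun s'' hs'' => ?_
        · refine (ih ((d + 1) :: ρ) (d + 2) s' (by
            intro y hy
            rcases List.mem_cons.1 hy with rfl | hy
            · omega
            · have := hρ y hy; omega)).mono ?_ fun s'' hs'' => ⟨?_, ?_, fun y hy => ?_, fun a ha => ?_⟩
          · rw [h4', mul_assoc, mul_assoc]
            exact Nat.mul_le_mul_left _ (Nat.mul_le_mul_right _ h1')
          · rw [hs''.tmp d (by omega), c2]
          · rw [hs''.tmp (d + 1) (by omega), c3]
          · rw [hs''.tmp y (by omega), c4.tmp y hy]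
          · rw [hs''.arr a ha, List.map_cons, c3, List.map_congr_left fun y hy => c4.tmp y (hρ y hy)]
            exact run_congr p _ c4.arr a ha
        · refine (Halts.set ?_).mono (t := _) (by simp [Expr.cost]) fun _ h => h
          obtain ⟨e1, e2, e3⟩ := hs''
          refine ⟨?_, ?_, fun y hy => ?_, fun a ha => ?_⟩
          · simp [write_apply, Expr.eval, e1]
          · simp [Expr.eval, e2]
          · rw [write_apply, if_neg (by simp [Expr.eval]; omega), e3.tmp y hy]
          · rw [write_of_ne _ _ _ ha, e3.arr a ha]
      · intro s' hs'
        simp [Expr.eval, hs'.1, hs'.2.1]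
      · simp [Expr.cost]
      · intro s' hs'
        exact hs'.2.2
    · have h2 : 1 ≤ A := Nat.one_le_pow _ _ (by omega)
      have h3 : 1 ≤ B := Nat.one_le_pow _ _ (by omega)
      have h5 : A ≤ A * B := Nat.le_mul_of_pos_right _ h3
      have hA' : (s 4 0 + 1) ^ (D + D' + 1) = (s 4 0 + 1) * A := by rw [pow_succ]; ring
      -- The n + 1 tests of the loop are charged to the factor that belongs to its cap; for κ true a
      -- further factor `s 4 0 + 1` is given away to keep one formula.
      have key : (n + 1) * (A * B) ≤ (s 4 0 + 1) ^ (D + D' + 1) *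
          (s 4 1 + 1) ^ (p.depth + capCell κ) := by
        cases κ
        · simp only [capCell, Bool.false_eq_true, if_false, add_zero, hA'] at hnN ⊢
          rw [mul_assoc]
          exact Nat.mul_le_mul_right _ (by omega)
        · simp only [capCell, if_true, hA', pow_succ] at hnN ⊢
          calc (n + 1) * (A * B) ≤ (s 4 1 + 1) * (A * B) := Nat.mul_le_mul_right _ (by omega)
            _ ≤ (s 4 0 + 1) * ((s 4 1 + 1) * (A * B)) := Nat.le_mul_of_pos_left _ (by omega)
            _ = _ := by rw [← hB]; ring
      have h6 : 1 ≤ A * B := h2.trans h5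
      calc K * (s 4 0 + 1) ^ D + (12 + (3 + (n + 1) * (6 + (K' * A * B + 15))))
          ≤ K * ((n + 1) * (A * B)) + (15 * ((n + 1) * (A * B)) + (21 * ((n + 1) * (A * B)) +
            K' * ((n + 1) * (A * B)))) := by
            have h7 : A * B ≤ (n + 1) * (A * B) := Nat.le_mul_of_pos_left _ (by omega)
            have h8 : (s 4 0 + 1) ^ D ≤ (n + 1) * (A * B) := h1.trans (h5.trans h7)
            have h9 : (n + 1) ≤ (n + 1) * (A * B) := Nat.le_mul_of_pos_right _ (by omega)
            have h10 := Nat.mul_le_mul_left K h8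
            have h11 : (n + 1) * (6 + (K' * A * B + 15)) = 21 * (n + 1) + K' * ((n + 1) * (A * B)) := by
              ring
            rw [h11]
            omega
        _ = (K + K' + 36) * ((n + 1) * (A * B)) := by ring
        _ ≤ (K + K' + 100) * ((s 4 0 + 1) ^ (D + D' + 1) * (s 4 1 + 1) ^ (p.depth + capCell κ)) :=
            Nat.mul_le_mul (by omega) key
        _ = _ := by simp only [depth]; ring

end Stmt

end RAM

/-! ### Logic and arithmetic in the language; bit matrices as numbers -/

namespace RAM

namespace PExpr

/-- `e` is true: its value is not zero. -/
def Holds (s : Mem) (env : List ℕ) (e : PExpr) : Prop := e.eval s env ≠ 0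

def notE (e : PExpr) : PExpr := ite e (lit 0) (lit 1)

def andE (e f : PExpr) : PExpr := ite e f (lit 0)

def orE (e f : PExpr) : PExpr := ite e (lit 1) f

def impE (e f : PExpr) : PExpr := ite e f (lit 1)

def iffE (e f : PExpr) : PExpr := ite e f (notE f)

def eqE (e f : PExpr) : PExpr := notE (add (sub e f) (sub f e))

def ltE (e f : PExpr) : PExpr := sub f e

def leE (e f : PExpr) : PExpr := sub (add f (lit 1)) e

/-- For all `j` below `e`. -/
def allE (e f : PExpr) : PExpr := fold e (lit 1) (ite (var 0) (drop 1 f) (lit 0))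

/-- For some `j` below `e`. -/
def exE (e f : PExpr) : PExpr := fold e (lit 0) (ite (var 0) (lit 1) (drop 1 f))

/-- The sum over `j` below `e`. -/
def sumE (e f : PExpr) : PExpr := fold e (lit 0) (add (var 0) (drop 1 f))

/-- The minimum of `i` and of the values of `f` for `j` below `e`. -/
def minE (e i f : PExpr) : PExpr :=
  fold e i (letE (drop 1 f) (sub (var 1) (sub (var 1) (var 0))))

def mulE (e f : PExpr) : PExpr := fold e (lit 0) (add (var 0) (drop 2 f))

def twoPowE (e : PExpr) : PExpr := fold e (lit 1) (add (var 0) (var 0))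

/-- Counts the j with 2j + 2 ≤ e, as there is no division. The count is cut at the cap, which is why
`bitValue` is full of minima. -/
def halfE (e : PExpr) : PExpr :=
  letE e (fold (var 0) (lit 0)
    (ite (leE (add (var 1) (add (var 1) (lit 2))) (var 2)) (add (var 0) (lit 1)) (var 0)))

def parityE (e : PExpr) : PExpr :=
  letE e (sub (var 0) (add (halfE (var 0)) (halfE (var 0))))

def shiftE (e f : PExpr) : PExpr := fold f e (halfE (var 0))

section

variable {s : Mem} {env : List ℕ} {e f i : PExpr}

@[simp] theorem holds_not : (notE e).Holds s env ↔ ¬ e.Holds s env := by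
  simp [Holds, notE, eval]

@[simp] theorem holds_and : (andE e f).Holds s env ↔ e.Holds s env ∧ f.Holds s env := by
  simp [Holds, andE, eval]

@[simp] theorem holds_or : (orE e f).Holds s env ↔ e.Holds s env ∨ f.Holds s env := by
  simp only [Holds, orE, eval]
  split_ifs with h <;> simp [h]

@[simp] theorem holds_imp : (impE e f).Holds s env ↔ (e.Holds s env → f.Holds s env) := by
  simp only [Holds, impE, eval]
  split_ifs with h <;> simp [h]

@[simp] theorem holds_iff : (iffE e f).Holds s env ↔ (e.Holds s env ↔ f.Holds s env) := by
  simp only [Holds, iffE, notE, eval]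
  split_ifs with h <;> simp_all

@[simp] theorem holds_eq : (eqE e f).Holds s env ↔ e.eval s env = f.eval s env := by
  simp [Holds, eqE, notE, eval]
  omega

@[simp] theorem holds_lt : (ltE e f).Holds s env ↔ e.eval s env < f.eval s env := by
  simp only [Holds, ltE, eval]
  omega

@[simp] theorem holds_le : (leE e f).Holds s env ↔ e.eval s env ≤ f.eval s env := by
  simp only [Holds, leE, eval]
  omega

@[simp] theorem holds_all : (allE e f).Holds s env ↔
    ∀ j < min (e.eval s env) (s 4 0), f.Holds s (j :: env) := by
  simp only [Holds, allE, eval]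
  generalize min (e.eval s env) (s 4 0) = n
  induction n with
  | zero => simp
  | succ n ih =>
    simp only [List.getD_cons_zero, List.drop_succ_cons, List.drop_zero] at ih ⊢
    split_ifs with h
    · simp only [ne_eq, not_true_eq_false, false_iff]
      intro hall
      exact (ih.2 fun j hj => hall j (by omega)) h
    · constructor
      · intro hn j hj
        rcases Nat.lt_succ_iff_lt_or_eq.1 hj with hj | rfl
        · exact ih.1 h j hj
        · exact hn
      · intro hall
        exact hall n (Nat.lt_succ_self n)

@[simp] theorem holds_ex : (exE e f).Holds s env ↔
    ∃ j < min (e.eval s env) (s 4 0), f.Holds s (j :: env) := by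
  simp only [Holds, exE, eval]
  generalize min (e.eval s env) (s 4 0) = n
  induction n with
  | zero => simp
  | succ n ih =>
    simp only [List.getD_cons_zero, List.drop_succ_cons, List.drop_zero] at ih ⊢
    split_ifs with h
    · constructor
      · intro hn
        exact ⟨n, Nat.lt_succ_self n, hn⟩
      · rintro ⟨j, hj, hn⟩
        rcases Nat.lt_succ_iff_lt_or_eq.1 hj with hj | rfl
        · exact absurd h (ih.2 ⟨j, hj, hn⟩)
        · exact hn
    · simp only [ne_eq, one_ne_zero, not_false_eq_true, true_iff]
      obtain ⟨j, hj, hn⟩ := ih.1 h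
      exact ⟨j, by omega, hn⟩

@[simp] theorem eval_sum : (sumE e f).eval s env =
    ∑ j ∈ Finset.range (min (e.eval s env) (s 4 0)), f.eval s (j :: env) := by
  simp only [sumE, eval]
  generalize min (e.eval s env) (s 4 0) = n
  induction n with
  | zero => rfl
  | succ n ih => rw [Finset.sum_range_succ, ← ih]; simp

/-- Minima are only ever compared with thresholds. This form turns nested minima into existential
quantifiers over states. -/
theorem eval_min_le {x : ℕ} : (minE e i f).eval s env ≤ x ↔
    i.eval s env ≤ x ∨ ∃ j < min (e.eval s env) (s 4 0), f.eval s (j :: env) ≤ x := by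
  simp only [minE, eval]
  generalize min (e.eval s env) (s 4 0) = n
  induction n with
  | zero => simp
  | succ n ih =>
    simp only [List.getD_cons_zero, List.drop_succ_cons, List.drop_zero,
      List.getD_cons_succ] at ih ⊢
    have key : ∀ a b : ℕ, a - (a - b) ≤ x ↔ a ≤ x ∨ b ≤ x := by intro a b; omega
    rw [key, ih, or_assoc]
    refine or_congr Iff.rfl ⟨?_, ?_⟩
    · rintro (⟨j, hj, h⟩ | h)
      · exact ⟨j, by omega, h⟩
      · exact ⟨n, by omega, h⟩
    · rintro ⟨j, hj, h⟩
      rcases Nat.lt_succ_iff_lt_or_eq.1 hj with hj | rfl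
      · exact Or.inl ⟨j, hj, h⟩
      · exact Or.inr h

@[simp] theorem eval_mul : (mulE e f).eval s env = min (e.eval s env) (s 4 0) * f.eval s env := by
  simp only [mulE, eval]
  generalize min (e.eval s env) (s 4 0) = n
  induction n with
  | zero => simp
  | succ n ih => simp only at ih ⊢; rw [Nat.succ_mul, ← ih]; simp

@[simp] theorem eval_twoPow : (twoPowE e).eval s env = 2 ^ min (e.eval s env) (s 4 0) := by
  simp only [twoPowE, eval]
  generalize min (e.eval s env) (s 4 0) = n
  induction n with
  | zero => simp
  | succ n ih => simp only at ih ⊢; rw [pow_succ, ← ih]; simp; omega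

@[simp] theorem eval_half : (halfE e).eval s env = min (e.eval s env / 2) (s 4 0) := by
  simp only [halfE, leE, eval, List.getD_cons_zero, List.getD_cons_succ]
  generalize e.eval s env = a
  have : ∀ n, Nat.rec (motive := fun _ => ℕ) 0
      (fun j acc => if a + 1 - (j + (j + 2)) = 0 then acc else acc + 1) n = min (a / 2) n := by
    intro n
    induction n with
    | zero => simp
    | succ n ih => simp only at ih ⊢; rw [ih]; split_ifs <;> omega
  rw [this]
  omega

@[simp] theorem eval_parity : (parityE e).eval s env =
    e.eval s env - 2 * min (e.eval s env / 2) (s 4 0) := by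
  simp [parityE, eval, two_mul]

@[simp] theorem eval_shift : (shiftE e f).eval s env =
    (fun z => min (z / 2) (s 4 0))^[min (f.eval s env) (s 4 0)] (e.eval s env) := by
  simp only [shiftE, eval, eval_half, List.getD_cons_zero]
  generalize min (f.eval s env) (s 4 0) = n
  induction n with
  | zero => rfl
  | succ n ih => rw [Function.iterate_succ_apply', ← ih]

end

/-- The side length of the bit matrix coded by a state. -/
def sideE : PExpr := add (add (get 12 (lit 0)) (get 12 (lit 0))) (lit 3)

/-- The entry in row `x` and column `y` of the bit matrix coded by the number `e`. -/
def bitE (e x y : PExpr) : PExpr := parityE (shiftE e (add (mulE x sideE) y))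

end PExpr

/-- The value of `PExpr.bitE`. -/
def bitValue (N W σ x y : ℕ) : ℕ :=
  let v := (fun z => min (z / 2) N)^[min (min x N * W + y) N] σ
  v - 2 * min (v / 2) N

/-- The bit in row `x` and column `y` of the state `σ` is set. -/
def Bit (s : Mem) (σ x y : ℕ) : Prop := bitValue (s 4 0) (s 12 0 + s 12 0 + 3) σ x y ≠ 0

@[simp] theorem PExpr.holds_bit {s : Mem} {env : List ℕ} {e x y : PExpr} :
    (bitE e x y).Holds s env ↔ Bit s (e.eval s env) (x.eval s env) (y.eval s env) := by
  simp [Holds, Bit, bitE, bitValue, sideE, eval]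

/-- Digit number xW + y of the code is the entry in row x and column y. The minima never bite,
because the code, its quotients and all digit positions are below N. Only existence of a code is
needed, not a bijection. -/
theorem exists_bitValue {N W : ℕ} (hN : N = 2 ^ (W * W)) (M : ℕ → ℕ → Prop) :
    ∃ σ < N, ∀ x < W, ∀ y < W, bitValue N W σ x y ≠ 0 ↔ M x y := by
  classical
  refine ⟨Nat.ofBits fun l : Fin (W * W) => decide (M (l / W) (l % W)), ?_, ?_⟩
  · rw [hN]; exact Nat.ofBits_lt_two_pow _
  set σ := Nat.ofBits fun l : Fin (W * W) => decide (M (l / W) (l % W)) with hσ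
  have hσN : σ < N := by rw [hN]; exact Nat.ofBits_lt_two_pow _
  have hit : ∀ l, (fun z => min (z / 2) N)^[l] σ = σ / 2 ^ l := by
    intro l
    induction l with
    | zero => simp
    | succ l ih =>
      rw [Function.iterate_succ_apply', ih, Nat.div_div_eq_div_mul, ← pow_succ]
      exact min_eq_left ((Nat.div_le_self _ _).trans hσN.le)
  intro x hx y hy
  have hl : x * W + y < W * W := by
    calc x * W + y < x * W + W := by omega
      _ = (x + 1) * W := by ring
      _ ≤ W * W := Nat.mul_le_mul_right _ hx
  have hWN : W * W < N := by rw [hN]; exact Nat.lt_two_pow_self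
  have hxN : x ≤ N := by
    have : W ≤ W * W := Nat.le_mul_of_pos_left _ (by omega)
    omega
  have h1 : bitValue N W σ x y = σ / 2 ^ (x * W + y) % 2 := by
    simp only [bitValue, min_eq_left hxN]
    rw [min_eq_left (by omega : x * W + y ≤ N), hit, min_eq_left]
    · omega
    · exact (Nat.div_le_self _ _).trans ((Nat.div_le_self _ _).trans hσN.le)
  have h2 := Nat.testBit_ofBits_lt (fun l : Fin (W * W) => decide (M (l / W) (l % W)))
    (x * W + y) hl
  rw [← hσ, Nat.testBit_eq_decide_div_mod_eq] at h2
  have h3 : (x * W + y) / W = x := by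
    rw [mul_comm, Nat.mul_add_div (by omega), Nat.div_eq_of_lt hy, add_zero]
  have h4 : (x * W + y) % W = y := by
    rw [mul_comm, Nat.mul_add_mod, Nat.mod_eq_of_lt hy]
  simp only [h3, h4, decide_eq_decide] at h2
  rw [h1, ← h2]
  omega

theorem exists_bit {s : Mem} (hN : s 4 0 = 2 ^ ((s 12 0 + s 12 0 + 3) * (s 12 0 + s 12 0 + 3)))
    (M : ℕ → ℕ → Prop) : ∃ σ < s 4 0, ∀ x < s 12 0 + s 12 0 + 3, ∀ y < s 12 0 + s 12 0 + 3,
      (Bit s σ x y ↔ M x y) :=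
  exists_bitValue hN M

end RAM

/-! ### Certificates for power domination

The elements `2 * v` and `2 * v + 1` stand for the moment when the node `v` is observed and for the
moment when `v` fires, that is, makes its last out-neighbour observed. -/

/-- `R` is an admissible order of the moments of the nodes in `Y`. -/
structure IsSchedule (adj : ℕ → ℕ → Prop) (Y : Finset ℕ) (R : ℕ → ℕ → Prop) : Prop where
  irrefl : ∀ e, e / 2 ∈ Y → ¬ R e e
  trans : ∀ e f g, e / 2 ∈ Y → f / 2 ∈ Y → g / 2 ∈ Y → R e f → R f g → R e g
  fire : ∀ v ∈ Y, R (2 * v) (2 * v + 1)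
  arc : ∀ u ∈ Y, ∀ w ∈ Y, adj u w → R (2 * w) (2 * u + 1) ∨ R (2 * u + 1) (2 * w)
  unique : ∀ u ∈ Y, ∀ w ∈ Y, ∀ w' ∈ Y, adj u w → adj u w' → R (2 * u + 1) (2 * w) →
    R (2 * u + 1) (2 * w') → w = w'

/-- An in-neighbour of `v` in `Y` makes `v` observed. -/
def Caught (adj : ℕ → ℕ → Prop) (Y S : Finset ℕ) (R : ℕ → ℕ → Prop) (v : ℕ) : Prop :=
  ∃ u ∈ Y, adj u v ∧ (u ∈ S ∨ R (2 * u + 1) (2 * v))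

/-- `u` makes an out-neighbour in `Y` observed. -/
def Fires (adj : ℕ → ℕ → Prop) (Y : Finset ℕ) (R : ℕ → ℕ → Prop) (u : ℕ) : Prop :=
  ∃ w ∈ Y, adj u w ∧ R (2 * u + 1) (2 * w)

/-! ### Amalgamation of two strict orders over their overlap -/

section Amalgam

variable {P Q : ℕ → Prop} {R T : ℕ → ℕ → Prop}

/-- The transitive union of the relation `R` on `P` and the relation `T` on `Q`. -/
def Amalgam (P Q : ℕ → Prop) (R T : ℕ → ℕ → Prop) (e f : ℕ) : Prop :=
  (P e ∧ P f ∧ R e f) ∨ (Q e ∧ Q f ∧ T e f) ∨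
  (∃ z, P z ∧ Q z ∧ P e ∧ Q f ∧ R e z ∧ T z f) ∨ (∃ z, P z ∧ Q z ∧ Q e ∧ P f ∧ T e z ∧ R z f)

theorem Amalgam.swap {e f : ℕ} (h : Amalgam P Q R T e f) : Amalgam Q P T R e f := by
  rcases h with h | h | ⟨z, h1, h2, h3, h4, h5, h6⟩ | ⟨z, h1, h2, h3, h4, h5, h6⟩
  · exact Or.inr (Or.inl h)
  · exact Or.inl h
  · exact Or.inr (Or.inr (Or.inr ⟨z, h2, h1, h3, h4, h5, h6⟩))
  · exact Or.inr (Or.inr (Or.inl ⟨z, h2, h1, h3, h4, h5, h6⟩))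

/-- A detour through Q between elements of P enters and leaves Q in the overlap, where T agrees with
R, so it is already an R-step. -/
theorem amalgam_left
    (hR : ∀ e f g, P e → P f → P g → R e f → R f g → R e g)
    (hRT : ∀ e f, P e → Q e → P f → Q f → (R e f ↔ T e f))
    {e f : ℕ} (he : P e) (hf : P f) : Amalgam P Q R T e f ↔ R e f := by
  constructor
  · rintro (⟨-, -, h⟩ | ⟨h1, h2, h⟩ | ⟨z, h1, h2, h3, h4, h5, h6⟩ | ⟨z, h1, h2, h3, h4, h5, h6⟩)
    · exact h
    · exact (hRT e f he h1 hf h2).2 h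
    · exact hR e z f he h1 hf h5 ((hRT z f h1 h2 hf h4).2 h6)
    · exact hR e z f he h1 hf ((hRT e z he h3 h1 h2).2 h5) h6
  · exact fun h => Or.inl ⟨he, hf, h⟩

/-- One change of side is enough in the definition of `Amalgam`: in a chain R, T, R the middle step
joins two elements of the overlap and is an R-step, so the chain collapses. It suffices to prepend a
single R-step (`l1`) or T-step (`l2`). -/
theorem amalgam_trans
    (hR : ∀ e f g, P e → P f → P g → R e f → R f g → R e g)
    (hT : ∀ e f g, Q e → Q f → Q g → T e f → T f g → T e g)
    (hRT : ∀ e f, P e → Q e → P f → Q f → (R e f ↔ T e f))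
    {e f g : ℕ} (h : Amalgam P Q R T e f) (h' : Amalgam P Q R T f g) :
    Amalgam P Q R T e g := by
  have l1 : ∀ {e f g}, P e → P f → R e f → Amalgam P Q R T f g → Amalgam P Q R T e g := by
    rintro e f g he hf h (⟨-, h2, h3⟩ | ⟨h1, h2, h3⟩ | ⟨z, h1, h2, h3, h4, h5, h6⟩ |
      ⟨z, h1, h2, h3, h4, h5, h6⟩)
    · exact Or.inl ⟨he, h2, hR e f g he hf h2 h h3⟩
    · exact Or.inr (Or.inr (Or.inl ⟨f, hf, h1, he, h2, h, h3⟩))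
    · exact Or.inr (Or.inr (Or.inl ⟨z, h1, h2, he, h4, hR e f z he hf h1 h h5, h6⟩))
    · have := hR f z g hf h1 h4 ((hRT f z hf h3 h1 h2).2 h5) h6
      exact Or.inl ⟨he, h4, hR e f g he hf h4 h this⟩
  have l2 : ∀ {e f g}, Q e → Q f → T e f → Amalgam P Q R T f g → Amalgam P Q R T e g := by
    rintro e f g he hf h (⟨h1, h2, h3⟩ | ⟨-, h2, h3⟩ | ⟨z, h1, h2, h3, h4, h5, h6⟩ |
      ⟨z, h1, h2, h3, h4, h5, h6⟩)
    · exact Or.inr (Or.inr (Or.inr ⟨f, h1, hf, he, h2, h, h3⟩))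
    · exact Or.inr (Or.inl ⟨he, h2, hT e f g he hf h2 h h3⟩)
    · have := hT f z g hf h2 h4 ((hRT f z h3 hf h1 h2).1 h5) h6
      exact Or.inr (Or.inl ⟨he, h4, hT e f g he hf h4 h this⟩)
    · exact Or.inr (Or.inr (Or.inr ⟨z, h1, h2, he, h4, hT e f z he hf h2 h h5, h6⟩))
  rcases h with ⟨h1, h2, h3⟩ | ⟨h1, h2, h3⟩ | ⟨z, h1, h2, h3, h4, h5, h6⟩ |
    ⟨z, h1, h2, h3, h4, h5, h6⟩
  · exact l1 h1 h2 h3 h'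
  · exact l2 h1 h2 h3 h'
  · exact l1 h3 h1 h5 (l2 h2 h4 h6 h')
  · exact l2 h3 h2 h5 (l1 h1 h4 h6 h')

end Amalgam

/-! ### States of a bag

A bag is given by its size `r` and the list `x 0, …, x (r - 1)` of its nodes, and a state of the bag
by a bit matrix `B`. Rows `0`, `1` and `2` tell which nodes are selected, caught, and fired, and
row `k + 3` tells which elements come after the element number `k` of the bag. -/

/-- The nodes of a bag. -/
def bagSet (r : ℕ) (x : ℕ → ℕ) : Finset ℕ := (Finset.range r).image x

theorem mem_bagSet {r : ℕ} {x : ℕ → ℕ} {v : ℕ} : v ∈ bagSet r x ↔ ∃ p < r, x p = v := by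
  simp [bagSet]

/-- The elements of a bag: first the observations, then the firings. -/
def bagElem (r : ℕ) (x : ℕ → ℕ) (k : ℕ) : ℕ := if k < r then 2 * x k else 2 * x (k - r) + 1

theorem bagElem_of_lt {r : ℕ} {x : ℕ → ℕ} {p : ℕ} (hp : p < r) : bagElem r x p = 2 * x p :=
  if_pos hp

theorem bagElem_add {r : ℕ} {x : ℕ → ℕ} {p : ℕ} : bagElem r x (r + p) = 2 * x p + 1 := by
  simp [bagElem]

theorem bagElem_div_mem {r : ℕ} {x : ℕ → ℕ} {k : ℕ} (hk : k < r + r) :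
    bagElem r x k / 2 ∈ bagSet r x := by
  rw [mem_bagSet]
  unfold bagElem
  split_ifs with h
  · exact ⟨k, h, by omega⟩
  · exact ⟨k - r, by omega, by omega⟩

theorem exists_bagElem {r : ℕ} {x : ℕ → ℕ} {e : ℕ} (he : e / 2 ∈ bagSet r x) :
    ∃ k < r + r, bagElem r x k = e := by
  obtain ⟨p, hp, h⟩ := mem_bagSet.1 he
  rcases Nat.mod_two_eq_zero_or_one e with h2 | h2
  · exact ⟨p, by omega, by rw [bagElem_of_lt hp]; omega⟩
  · exact ⟨r + p, by omega, by rw [bagElem_add]; omega⟩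

theorem bagElem_injective {r : ℕ} {x : ℕ → ℕ} (hx : ∀ p < r, ∀ q < r, x p = x q → p = q)
    {k l : ℕ} (hk : k < r + r) (hl : l < r + r) (h : bagElem r x k = bagElem r x l) : k = l := by
  unfold bagElem at h
  split_ifs at h with h1 h2 h2
  · exact hx k h1 l h2 (by omega)
  · omega
  · omega
  · have := hx (k - r) (by omega) (l - r) (by omega) (by omega)
    omega

/-- The state `B` of the bag `(r, x)` describes the partial solution `S`, `R` on `Y`. -/
structure Describes (adj : ℕ → ℕ → Prop) (r : ℕ) (x : ℕ → ℕ) (B : ℕ → ℕ → Prop) (Y S : Finset ℕ)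
    (R : ℕ → ℕ → Prop) : Prop where
  sel : ∀ p < r, (B 0 p ↔ x p ∈ S)
  ord : ∀ k < r + r, ∀ l < r + r, (B (k + 3) l ↔ R (bagElem r x k) (bagElem r x l))
  -- One implication is enough: a set bit promises a catching in-neighbour inside the part, an unset
  -- bit promises nothing. Dually, an unset bit of row `2` promises that the node has not fired
  -- within the part.
  caught : ∀ p < r, B 1 p → Caught adj Y S R (x p)
  fired : ∀ p < r, Fires adj Y R (x p) → B 2 p
  inner : ∀ v ∈ Y, v ∉ bagSet r x → v ∈ S ∨ Caught adj Y S R v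

/-- The bit matrix of a partial solution. -/
def stateMatrix (adj : ℕ → ℕ → Prop) (r : ℕ) (x : ℕ → ℕ) (Y S : Finset ℕ)
    (R : ℕ → ℕ → Prop) : ℕ → ℕ → Prop
  | 0, p => x p ∈ S
  | 1, p => Caught adj Y S R (x p)
  | 2, p => Fires adj Y R (x p)
  | k + 3, l => R (bagElem r x k) (bagElem r x l)

/-- The condition on the states `B₁`, `B₂` of two bags to yield the state `B` of the first bag. -/
structure Merges (adj : ℕ → ℕ → Prop) (r₁ : ℕ) (x₁ : ℕ → ℕ) (r₂ : ℕ) (x₂ : ℕ → ℕ)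
    (B₁ B₂ B : ℕ → ℕ → Prop) : Prop where
  sel : ∀ p < r₁, (B 0 p ↔ B₁ 0 p)
  ord : ∀ k < r₁ + r₁, ∀ l < r₁ + r₁, (B (k + 3) l ↔ B₁ (k + 3) l)
  sel' : ∀ p < r₁, ∀ q < r₂, x₁ p = x₂ q → (B₁ 0 p ↔ B₂ 0 q)
  ord' : ∀ k < r₁ + r₁, ∀ k' < r₂ + r₂, bagElem r₁ x₁ k = bagElem r₂ x₂ k' →
    ∀ l < r₁ + r₁, ∀ l' < r₂ + r₂, bagElem r₁ x₁ l = bagElem r₂ x₂ l' →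
      (B₁ (k + 3) l ↔ B₂ (k' + 3) l')
  caught : ∀ p < r₁, B 1 p → B₁ 1 p ∨ ∃ q < r₂, x₁ p = x₂ q ∧ B₂ 1 q
  fired : ∀ p < r₁, B₁ 2 p → B 2 p
  fired' : ∀ p < r₁, ∀ q < r₂, x₁ p = x₂ q → B₂ 2 q → B 2 p
  -- A node has one firing in all. If it is used in both parts, both uses must observe the same
  -- node, which then lies in both bags.
  unique : ∀ p < r₁, ∀ q < r₂, x₁ p = x₂ q → B₁ 2 p → B₂ 2 q →
    ∃ p' < r₁, adj (x₁ p) (x₁ p') ∧ B₁ (r₁ + p + 3) p' ∧ ∃ q' < r₂, x₁ p' = x₂ q'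
  -- Nodes of the second bag outside the first are forgotten now, so they must have been taken care
  -- of within the second part.
  inner : ∀ q < r₂, B₂ 0 q ∨ B₂ 1 q ∨ ∃ p < r₁, x₁ p = x₂ q

/-! ### Joining and splitting partial solutions -/

section Merge

variable {adj : ℕ → ℕ → Prop} {r₁ r₂ : ℕ} {x₁ x₂ : ℕ → ℕ} {B₁ B₂ B : ℕ → ℕ → Prop}
  {Y₁ Y₂ S₁ S₂ S : Finset ℕ} {R₁ R₂ R : ℕ → ℕ → Prop}

theorem IsSchedule.mono (h : IsSchedule adj Y₂ R) (hY : Y₁ ⊆ Y₂) : IsSchedule adj Y₁ R where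
  irrefl e he := h.irrefl e (hY he)
  trans e f g he hf hg := h.trans e f g (hY he) (hY hf) (hY hg)
  fire v hv := h.fire v (hY hv)
  arc u hu w hw := h.arc u (hY hu) w (hY hw)
  unique u hu w hw w' hw' := h.unique u (hY hu) w (hY hw) w' (hY hw')

/-- Partial solutions with matching states are amalgamated. -/
theorem Merges.exists_describes (hm : Merges adj r₁ x₁ r₂ x₂ B₁ B₂ B)
    (h₁ : Describes adj r₁ x₁ B₁ Y₁ S₁ R₁) (h₂ : Describes adj r₂ x₂ B₂ Y₂ S₂ R₂)
    (hR₁ : IsSchedule adj Y₁ R₁) (hR₂ : IsSchedule adj Y₂ R₂)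
    (hX₁ : bagSet r₁ x₁ ⊆ Y₁) (hX₂ : bagSet r₂ x₂ ⊆ Y₂)
    (hY₁ : ∀ v ∈ Y₁, v ∈ Y₂ → v ∈ bagSet r₁ x₁) (hY₂ : ∀ v ∈ Y₁, v ∈ Y₂ → v ∈ bagSet r₂ x₂)
    (harc : ∀ u w, adj u w → u ∈ Y₁ ∪ Y₂ → w ∈ Y₁ ∪ Y₂ → (u ∈ Y₁ ∧ w ∈ Y₁) ∨ (u ∈ Y₂ ∧ w ∈ Y₂)) :
    ∃ R, IsSchedule adj (Y₁ ∪ Y₂) R ∧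
      Describes adj r₁ x₁ B (Y₁ ∪ Y₂) (Y₁ ∩ S₁ ∪ Y₂ ∩ S₂) R := by
  -- The overlap of the parts lies in both bags, so equality of the recorded orders makes R₁ and R₂
  -- agree there.
  have hagree : ∀ e f, e / 2 ∈ Y₁ → e / 2 ∈ Y₂ → f / 2 ∈ Y₁ → f / 2 ∈ Y₂ →
      (R₁ e f ↔ R₂ e f) := by
    intro e f he he' hf hf'
    obtain ⟨k, hk, rfl⟩ := exists_bagElem (hY₁ _ he he')
    obtain ⟨k', hk', hkk⟩ := exists_bagElem (hY₂ _ he he')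
    obtain ⟨l, hl, rfl⟩ := exists_bagElem (hY₁ _ hf hf')
    obtain ⟨l', hl', hll⟩ := exists_bagElem (hY₂ _ hf hf')
    rw [← h₁.ord k hk l hl, hm.ord' k hk k' hk' hkk.symm l hl l' hl' hll.symm,
      h₂.ord k' hk' l' hl', hkk, hll]
  have hsel : ∀ v ∈ Y₁, v ∈ Y₂ → (v ∈ S₁ ↔ v ∈ S₂) := by
    intro v hv hv'
    obtain ⟨p, hp, rfl⟩ := mem_bagSet.1 (hY₁ _ hv hv')
    obtain ⟨q, hq, hpq⟩ := mem_bagSet.1 (hY₂ _ hv hv')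
    rw [← h₁.sel p hp, hm.sel' p hp q hq hpq.symm, h₂.sel q hq, hpq]
  set R := Amalgam (fun e => e / 2 ∈ Y₁) (fun e => e / 2 ∈ Y₂) R₁ R₂ with hR
  have hl : ∀ {e f}, e / 2 ∈ Y₁ → f / 2 ∈ Y₁ → (R e f ↔ R₁ e f) := fun he hf =>
    amalgam_left hR₁.trans hagree he hf
  have hr : ∀ {e f}, e / 2 ∈ Y₂ → f / 2 ∈ Y₂ → (R e f ↔ R₂ e f) := fun he hf =>
    ⟨fun h => (amalgam_left hR₂.trans (fun e f h1 h2 h3 h4 => (hagree e f h2 h1 h4 h3).symm)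
      he hf).1 h.swap, fun h => Or.inr (Or.inl ⟨he, hf, h⟩)⟩
  have d0 : ∀ v, 2 * v / 2 = v := fun v => by omega
  have d1 : ∀ v, (2 * v + 1) / 2 = v := fun v => by omega
  have hfo₁ : ∀ {u w}, u ∈ Y₁ → w ∈ Y₁ → (R (2 * u + 1) (2 * w) ↔ R₁ (2 * u + 1) (2 * w)) :=
    fun hu hw => hl (by rwa [d1]) (by rwa [d0])
  have hfo₂ : ∀ {u w}, u ∈ Y₂ → w ∈ Y₂ → (R (2 * u + 1) (2 * w) ↔ R₂ (2 * u + 1) (2 * w)) :=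
    fun hu hw => hr (by rwa [d1]) (by rwa [d0])
  -- Uniqueness of the firing target across the two parts: both fired bits of u are set, so
  -- `Merges.unique` supplies a common target in both bags, and uniqueness inside each part
  -- identifies w and w' with it.
  have hmix : ∀ u w w', u ∈ Y₁ → u ∈ Y₂ → w ∈ Y₁ → w' ∈ Y₂ → adj u w → adj u w' →
      R₁ (2 * u + 1) (2 * w) → R₂ (2 * u + 1) (2 * w') → w = w' := by
    intro u w w' hu hu' hw hw' ha ha' h h'
    obtain ⟨p, hp, rfl⟩ := mem_bagSet.1 (hY₁ _ hu hu')
    obtain ⟨q, hq, hpq⟩ := mem_bagSet.1 (hY₂ _ hu hu')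
    obtain ⟨p', hp', e1, e2, q', hq', e3⟩ := hm.unique p hp q hq hpq.symm
      (h₁.fired p hp ⟨w, hw, ha, h⟩) (h₂.fired q hq (by rw [hpq]; exact ⟨w', hw', ha', h'⟩))
    rw [h₁.ord (r₁ + p) (by omega) p' (by omega), bagElem_add, bagElem_of_lt hp'] at e2
    have i1 : x₁ p' ∈ Y₁ := hX₁ (mem_bagSet.2 ⟨p', hp', rfl⟩)
    have i2 : x₁ p' ∈ Y₂ := e3 ▸ hX₂ (mem_bagSet.2 ⟨q', hq', rfl⟩)
    have e4 := (hagree _ _ (by rwa [d1]) (by rwa [d1]) (by rwa [d0]) (by rwa [d0])).1 e2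
    rw [hR₁.unique _ hu w hw _ i1 ha e1 h e2, hR₂.unique _ hu' w' hw' _ i2 ha' e1 h' e4]
  have hc₁ : ∀ v ∈ Y₁, Caught adj Y₁ S₁ R₁ v → Caught adj (Y₁ ∪ Y₂) (Y₁ ∩ S₁ ∪ Y₂ ∩ S₂) R v := by
    rintro v hv ⟨u, hu, ha, h⟩
    refine ⟨u, Finset.mem_union_left _ hu, ha, h.imp (fun h => ?_) (hfo₁ hu hv).2⟩
    simp [hu, h]
  have hc₂ : ∀ v ∈ Y₂, Caught adj Y₂ S₂ R₂ v → Caught adj (Y₁ ∪ Y₂) (Y₁ ∩ S₁ ∪ Y₂ ∩ S₂) R v := by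
    rintro v hv ⟨u, hu, ha, h⟩
    refine ⟨u, Finset.mem_union_right _ hu, ha, h.imp (fun h => ?_) (hfo₂ hu hv).2⟩
    simp [hu, h]
  refine ⟨R, ⟨?_, ?_, ?_, ?_, ?_⟩, ⟨?_, ?_, ?_, ?_, ?_⟩⟩
  · intro e he h
    rcases Finset.mem_union.1 he with he | he
    · exact hR₁.irrefl e he ((hl he he).1 h)
    · exact hR₂.irrefl e he ((hr he he).1 h)
  · intro e f g _ _ _ h h'
    exact amalgam_trans hR₁.trans hR₂.trans hagree h h'
  · intro v hv
    rcases Finset.mem_union.1 hv with hv | hv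
    · exact (hl (by rwa [d0]) (by rwa [d1])).2 (hR₁.fire v hv)
    · exact (hr (by rwa [d0]) (by rwa [d1])).2 (hR₂.fire v hv)
  · intro u hu w hw ha
    rcases harc u w ha hu hw with ⟨hu, hw⟩ | ⟨hu, hw⟩
    · rw [hfo₁ hu hw, hl (by rwa [d0]) (by rwa [d1])]
      exact hR₁.arc u hu w hw ha
    · rw [hfo₂ hu hw, hr (by rwa [d0]) (by rwa [d1])]
      exact hR₂.arc u hu w hw ha
  · intro u hu w hw w' hw' ha ha' h h'
    rcases harc u w ha hu hw with ⟨i1, i2⟩ | ⟨i1, i2⟩ <;>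
      rcases harc u w' ha' hu hw' with ⟨j1, j2⟩ | ⟨j1, j2⟩
    · exact hR₁.unique u i1 w i2 w' j2 ha ha' ((hfo₁ i1 i2).1 h) ((hfo₁ j1 j2).1 h')
    · exact hmix u w w' i1 j1 i2 j2 ha ha' ((hfo₁ i1 i2).1 h) ((hfo₂ j1 j2).1 h')
    · exact (hmix u w' w j1 i1 j2 i2 ha' ha ((hfo₁ j1 j2).1 h') ((hfo₂ i1 i2).1 h)).symm
    · exact hR₂.unique u i1 w i2 w' j2 ha ha' ((hfo₂ i1 i2).1 h) ((hfo₂ j1 j2).1 h')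
  · intro p hp
    have i1 : x₁ p ∈ Y₁ := hX₁ (mem_bagSet.2 ⟨p, hp, rfl⟩)
    rw [hm.sel p hp, h₁.sel p hp]
    simp only [Finset.mem_union, Finset.mem_inter, i1, true_and]
    exact ⟨Or.inl, fun h => h.elim id fun h => (hsel _ i1 h.1).2 h.2⟩
  · intro k hk l hl'
    rw [hm.ord k hk l hl', h₁.ord k hk l hl', hl (hX₁ (bagElem_div_mem hk)) (hX₁ (bagElem_div_mem hl'))]
  · intro p hp h
    have i1 : x₁ p ∈ Y₁ := hX₁ (mem_bagSet.2 ⟨p, hp, rfl⟩)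
    rcases hm.caught p hp h with h | ⟨q, hq, hpq, h⟩
    · exact hc₁ _ i1 (h₁.caught p hp h)
    · rw [hpq]
      exact hc₂ _ (hX₂ (mem_bagSet.2 ⟨q, hq, rfl⟩)) (h₂.caught q hq h)
  · rintro p hp ⟨w, hw, ha, h⟩
    have i1 : x₁ p ∈ Y₁ := hX₁ (mem_bagSet.2 ⟨p, hp, rfl⟩)
    rcases harc _ w ha (Finset.mem_union_left _ i1) hw with ⟨j1, j2⟩ | ⟨j1, j2⟩
    · exact hm.fired p hp (h₁.fired p hp ⟨w, j2, ha, (hfo₁ j1 j2).1 h⟩)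
    · obtain ⟨q, hq, hpq⟩ := mem_bagSet.1 (hY₂ _ i1 j1)
      refine hm.fired' p hp q hq hpq.symm (h₂.fired q hq ?_)
      rw [hpq]
      exact ⟨w, j2, ha, (hfo₂ j1 j2).1 h⟩
  · intro v hv hvX
    rcases Finset.mem_union.1 hv with hv | hv
    · refine (h₁.inner v hv hvX).imp (fun h => ?_) (hc₁ v hv)
      simp [hv, h]
    · by_cases hv2 : v ∈ bagSet r₂ x₂
      · obtain ⟨q, hq, rfl⟩ := mem_bagSet.1 hv2
        rcases hm.inner q hq with h | h | ⟨p, hp, h⟩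
        · left
          simp [hv, (h₂.sel q hq).1 h]
        · exact Or.inr (hc₂ _ hv (h₂.caught q hq h))
        · exact absurd (mem_bagSet.2 ⟨p, hp, h⟩) hvX
      · refine (h₂.inner v hv hv2).imp (fun h => ?_) (hc₂ v hv)
        simp [hv, h]

/-- A partial solution splits into partial solutions with matching states. -/
theorem Describes.split (h : Describes adj r₁ x₁ B (Y₁ ∪ Y₂) S R)
    (hR : IsSchedule adj (Y₁ ∪ Y₂) R)
    (hX₁ : bagSet r₁ x₁ ⊆ Y₁) (hX₂ : bagSet r₂ x₂ ⊆ Y₂)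
    (hY₁ : ∀ v ∈ Y₁, v ∈ Y₂ → v ∈ bagSet r₁ x₁) (hY₂ : ∀ v ∈ Y₁, v ∈ Y₂ → v ∈ bagSet r₂ x₂)
    (harc : ∀ u w, adj u w → u ∈ Y₁ ∪ Y₂ → w ∈ Y₁ ∪ Y₂ → (u ∈ Y₁ ∧ w ∈ Y₁) ∨ (u ∈ Y₂ ∧ w ∈ Y₂))
    (hB₁ : ∀ k < r₁ + r₁ + 3, ∀ l < r₁ + r₁, (B₁ k l ↔ stateMatrix adj r₁ x₁ Y₁ S R k l))
    (hB₂ : ∀ k < r₂ + r₂ + 3, ∀ l < r₂ + r₂, (B₂ k l ↔ stateMatrix adj r₂ x₂ Y₂ S R k l)) :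
    Merges adj r₁ x₁ r₂ x₂ B₁ B₂ B ∧ Describes adj r₁ x₁ B₁ Y₁ S R ∧
      Describes adj r₂ x₂ B₂ Y₂ S R := by
  have m1 : ∀ {p}, p < r₁ → x₁ p ∈ Y₁ := fun hp => hX₁ (mem_bagSet.2 ⟨_, hp, rfl⟩)
  have m2 : ∀ {p}, p < r₂ → x₂ p ∈ Y₂ := fun hp => hX₂ (mem_bagSet.2 ⟨_, hp, rfl⟩)
  have a0 : ∀ p < r₁, (B₁ 0 p ↔ x₁ p ∈ S) := fun p hp => hB₁ 0 (by omega) p (by omega)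
  have a1 : ∀ p < r₁, (B₁ 1 p ↔ Caught adj Y₁ S R (x₁ p)) := fun p hp =>
    hB₁ 1 (by omega) p (by omega)
  have a2 : ∀ p < r₁, (B₁ 2 p ↔ Fires adj Y₁ R (x₁ p)) := fun p hp => hB₁ 2 (by omega) p (by omega)
  have a3 : ∀ k < r₁ + r₁, ∀ l < r₁ + r₁,
      (B₁ (k + 3) l ↔ R (bagElem r₁ x₁ k) (bagElem r₁ x₁ l)) :=
    fun k hk l hl => hB₁ (k + 3) (by omega) l hl
  have b0 : ∀ p < r₂, (B₂ 0 p ↔ x₂ p ∈ S) := fun p hp => hB₂ 0 (by omega) p (by omega)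
  have b1 : ∀ p < r₂, (B₂ 1 p ↔ Caught adj Y₂ S R (x₂ p)) := fun p hp =>
    hB₂ 1 (by omega) p (by omega)
  have b2 : ∀ p < r₂, (B₂ 2 p ↔ Fires adj Y₂ R (x₂ p)) := fun p hp => hB₂ 2 (by omega) p (by omega)
  have b3 : ∀ k < r₂ + r₂, ∀ l < r₂ + r₂,
      (B₂ (k + 3) l ↔ R (bagElem r₂ x₂ k) (bagElem r₂ x₂ l)) :=
    fun k hk l hl => hB₂ (k + 3) (by omega) l hl
  have hc : ∀ v, Caught adj (Y₁ ∪ Y₂) S R v → v ∈ Y₁ ∪ Y₂ →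
      (v ∈ Y₁ ∧ Caught adj Y₁ S R v) ∨ (v ∈ Y₂ ∧ Caught adj Y₂ S R v) := by
    rintro v ⟨u, hu, ha, h⟩ hv
    rcases harc u v ha hu hv with ⟨h1, h2⟩ | ⟨h1, h2⟩
    · exact Or.inl ⟨h2, u, h1, ha, h⟩
    · exact Or.inr ⟨h2, u, h1, ha, h⟩
  refine ⟨⟨?_, ?_, ?_, ?_, ?_, ?_, ?_, ?_, ?_⟩, ⟨fun p hp => a0 p hp, a3, fun p hp => (a1 p hp).1,
    fun p hp => (a2 p hp).2, ?_⟩, ⟨fun p hp => b0 p hp, b3, fun p hp => (b1 p hp).1,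
    fun p hp => (b2 p hp).2, ?_⟩⟩
  · intro p hp
    rw [h.sel p hp, a0 p hp]
  · intro k hk l hl
    rw [h.ord k hk l hl, a3 k hk l hl]
  · intro p hp q hq hpq
    rw [a0 p hp, b0 q hq, hpq]
  · intro k hk k' hk' hkk l hl l' hl' hll
    rw [a3 k hk l hl, b3 k' hk' l' hl', hkk, hll]
  · intro p hp hB
    rcases hc _ (h.caught p hp hB) (Finset.mem_union_left _ (m1 hp)) with ⟨-, h'⟩ | ⟨i, h'⟩
    · exact Or.inl ((a1 p hp).2 h')
    · obtain ⟨q, hq, hpq⟩ := mem_bagSet.1 (hY₂ _ (m1 hp) i)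
      exact Or.inr ⟨q, hq, hpq.symm, (b1 q hq).2 (hpq ▸ h')⟩
  · intro p hp hB
    obtain ⟨w, hw, ha, h'⟩ := (a2 p hp).1 hB
    exact h.fired p hp ⟨w, Finset.mem_union_left _ hw, ha, h'⟩
  · intro p hp q hq hpq hB
    obtain ⟨w, hw, ha, h'⟩ := (b2 q hq).1 hB
    exact h.fired p hp (hpq ▸ ⟨w, Finset.mem_union_right _ hw, ha, h'⟩)
  · intro p hp q hq hpq hB hB'
    obtain ⟨w, hw, ha, h1⟩ := (a2 p hp).1 hB
    obtain ⟨w', hw', ha', h2⟩ := (b2 q hq).1 hB'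
    rw [← hpq] at ha' h2
    -- In one schedule the two targets coincide, so the target lies in both parts and hence in both
    -- bags.
    obtain rfl := hR.unique _ (Finset.mem_union_left _ (m1 hp)) w (Finset.mem_union_left _ hw) w'
      (Finset.mem_union_right _ hw') ha ha' h1 h2
    obtain ⟨p', hp', rfl⟩ := mem_bagSet.1 (hY₁ _ hw hw')
    obtain ⟨q', hq', hpq'⟩ := mem_bagSet.1 (hY₂ _ hw hw')
    refine ⟨p', hp', ha, ?_, q', hq', hpq'.symm⟩
    rw [a3 (r₁ + p) (by omega) p' (by omega), bagElem_add, bagElem_of_lt hp']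
    exact h1
  · intro q hq
    rw [b0 q hq, b1 q hq]
    -- Outside the first bag the node is not in Y₁ at all, so it can only be caught by an arc of the
    -- second part.
    by_cases hX : x₂ q ∈ bagSet r₁ x₁
    · exact Or.inr (Or.inr (mem_bagSet.1 hX))
    · have hv := Finset.mem_union_right Y₁ (m2 hq)
      rcases h.inner _ hv hX with h' | h'
      · exact Or.inl h'
      · rcases hc _ h' hv with ⟨i, -⟩ | ⟨-, h'⟩
        · exact absurd (hY₁ _ i (m2 hq)) hX
        · exact Or.inr (Or.inl h')
  · intro v hv hX
    have hv' := Finset.mem_union_left Y₂ hv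
    refine (h.inner v hv' hX).imp id fun h' => ?_
    rcases hc _ h' hv' with ⟨-, h'⟩ | ⟨i, -⟩
    · exact h'
    · exact absurd (hY₁ _ hv i) hX
  · intro v hv hX
    have hv' := Finset.mem_union_right Y₁ hv
    have hX' : v ∉ bagSet r₁ x₁ := fun hv1 => hX (hY₂ _ (hX₁ hv1) hv)
    refine (h.inner v hv' hX').imp id fun h' => ?_
    rcases hc _ h' hv' with ⟨i, -⟩ | ⟨-, h'⟩
    · exact absurd (hY₂ _ i hv) hX
    · exact h'

end Merge

/-- The state `B` of the bag `(r, x)` describes a partial solution on the bag itself. -/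
structure IsLocal (adj : ℕ → ℕ → Prop) (r : ℕ) (x : ℕ → ℕ) (B : ℕ → ℕ → Prop) : Prop where
  irrefl : ∀ k < r + r, ¬ B (k + 3) k
  trans : ∀ k < r + r, ∀ l < r + r, ∀ j < r + r, B (k + 3) l → B (l + 3) j → B (k + 3) j
  fire : ∀ p < r, B (p + 3) (r + p)
  arc : ∀ p < r, ∀ q < r, adj (x p) (x q) → B (q + 3) (r + p) ∨ (B (r + p + 3) q ∧ B 2 p)
  unique : ∀ p < r, ∀ q < r, ∀ q' < r, adj (x p) (x q) → adj (x p) (x q') → B (r + p + 3) q →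
    B (r + p + 3) q' → q = q'
  caught : ∀ p < r, B 1 p → ∃ q < r, adj (x q) (x p) ∧ (B 0 q ∨ B (r + q + 3) p)

/-- S and R are read off from the matrix, injectivity of x making them well defined. Nothing is
forgotten on a single bag, so `inner` is void; the fired bit enters through the clause `arc`. -/
theorem isLocal_iff {adj : ℕ → ℕ → Prop} {r : ℕ} {x : ℕ → ℕ} {B : ℕ → ℕ → Prop}
    (hx : ∀ p < r, ∀ q < r, x p = x q → p = q) : IsLocal adj r x B ↔
      ∃ S R, IsSchedule adj (bagSet r x) R ∧ Describes adj r x B (bagSet r x) S R := by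
  constructor
  · intro h
    classical
    set R : ℕ → ℕ → Prop := fun e f => ∃ k < r + r, ∃ l < r + r, bagElem r x k = e ∧
      bagElem r x l = f ∧ B (k + 3) l with hR
    have key : ∀ k < r + r, ∀ l < r + r, (R (bagElem r x k) (bagElem r x l) ↔ B (k + 3) l) := by
      intro k hk l hl
      constructor
      · rintro ⟨k', hk', l', hl', e1, e2, h⟩
        rwa [← bagElem_injective hx hk' hk e1, ← bagElem_injective hx hl' hl e2]
      · exact fun h => ⟨k, hk, l, hl, rfl, rfl, h⟩
    have ko : ∀ p < r, ∀ q < r, (R (2 * x q) (2 * x p + 1) ↔ B (q + 3) (r + p)) := by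
      intro p hp q hq
      rw [← key q (by omega) (r + p) (by omega), bagElem_add, bagElem_of_lt hq]
    have kf : ∀ p < r, ∀ q < r, (R (2 * x p + 1) (2 * x q) ↔ B (r + p + 3) q) := by
      intro p hp q hq
      rw [← key (r + p) (by omega) q (by omega), bagElem_add, bagElem_of_lt hq]
    refine ⟨((Finset.range r).filter fun p => B 0 p).image x, R, ⟨?_, ?_, ?_, ?_, ?_⟩,
      ⟨?_, fun k hk l hl => (key k hk l hl).symm, ?_, ?_, fun v hv hv' => absurd hv hv'⟩⟩
    · intro e he
      obtain ⟨k, hk, rfl⟩ := exists_bagElem he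
      rw [key k hk k hk]
      exact h.irrefl k hk
    · intro e f g he hf hg
      obtain ⟨k, hk, rfl⟩ := exists_bagElem he
      obtain ⟨l, hl, rfl⟩ := exists_bagElem hf
      obtain ⟨j, hj, rfl⟩ := exists_bagElem hg
      rw [key k hk l hl, key l hl j hj, key k hk j hj]
      exact h.trans k hk l hl j hj
    · intro v hv
      obtain ⟨p, hp, rfl⟩ := mem_bagSet.1 hv
      exact (ko p hp p hp).2 (h.fire p hp)
    · intro u hu w hw
      obtain ⟨p, hp, rfl⟩ := mem_bagSet.1 hu
      obtain ⟨q, hq, rfl⟩ := mem_bagSet.1 hw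
      rw [ko p hp q hq, kf p hp q hq]
      exact fun ha => (h.arc p hp q hq ha).imp id And.left
    · intro u hu w hw w' hw'
      obtain ⟨p, hp, rfl⟩ := mem_bagSet.1 hu
      obtain ⟨q, hq, rfl⟩ := mem_bagSet.1 hw
      obtain ⟨q', hq', rfl⟩ := mem_bagSet.1 hw'
      rw [kf p hp q hq, kf p hp q' hq']
      exact fun ha ha' h1 h2 => congrArg x (h.unique p hp q hq q' hq' ha ha' h1 h2)
    · intro p hp
      simp only [Finset.mem_image, Finset.mem_filter, Finset.mem_range]
      constructor
      · exact fun h => ⟨p, ⟨hp, h⟩, rfl⟩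
      · rintro ⟨q, ⟨hq, h⟩, e⟩
        rwa [← hx q hq p hp e]
    · intro p hp hB
      obtain ⟨q, hq, ha, h'⟩ := h.caught p hp hB
      refine ⟨x q, mem_bagSet.2 ⟨q, hq, rfl⟩, ha, h'.imp (fun h' => ?_) (kf q hq p hp).2⟩
      exact Finset.mem_image_of_mem x (by simp [hq, h'])
    · rintro p hp ⟨w, hw, ha, h'⟩
      obtain ⟨q, hq, rfl⟩ := mem_bagSet.1 hw
      rw [kf p hp q hq] at h'
      rcases h.arc p hp q hq ha with h2 | h2
      · exact absurd (h.trans _ (by omega) _ (by omega) _ (by omega) h' h2)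
          (h.irrefl (r + p) (by omega))
      · exact h2.2
  · rintro ⟨S, R, hR, h⟩
    have m : ∀ {p}, p < r → x p ∈ bagSet r x := fun hp => mem_bagSet.2 ⟨_, hp, rfl⟩
    have ko : ∀ p < r, ∀ q < r, (R (2 * x q) (2 * x p + 1) ↔ B (q + 3) (r + p)) := by
      intro p hp q hq
      rw [h.ord q (by omega) (r + p) (by omega), bagElem_add, bagElem_of_lt hq]
    have kf : ∀ p < r, ∀ q < r, (R (2 * x p + 1) (2 * x q) ↔ B (r + p + 3) q) := by
      intro p hp q hq
      rw [h.ord (r + p) (by omega) q (by omega), bagElem_add, bagElem_of_lt hq]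
    refine ⟨?_, ?_, ?_, ?_, ?_, ?_⟩
    · intro k hk
      rw [h.ord k hk k hk]
      exact hR.irrefl _ (bagElem_div_mem hk)
    · intro k hk l hl j hj
      rw [h.ord k hk l hl, h.ord l hl j hj, h.ord k hk j hj]
      exact hR.trans _ _ _ (bagElem_div_mem hk) (bagElem_div_mem hl) (bagElem_div_mem hj)
    · intro p hp
      exact (ko p hp p hp).1 (hR.fire _ (m hp))
    · intro p hp q hq ha
      rcases hR.arc _ (m hp) _ (m hq) ha with h' | h'
      · exact Or.inl ((ko p hp q hq).1 h')
      · exact Or.inr ⟨(kf p hp q hq).1 h', h.fired p hp ⟨_, m hq, ha, h'⟩⟩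
    · intro p hp q hq q' hq' ha ha' h1 h2
      exact hx q hq q' hq' (hR.unique _ (m hp) _ (m hq) _ (m hq') ha ha' ((kf p hp q hq).2 h1)
        ((kf p hp q' hq').2 h2))
    · intro p hp hB
      obtain ⟨u, hu, ha, h'⟩ := h.caught p hp hB
      obtain ⟨q, hq, rfl⟩ := mem_bagSet.1 hu
      exact ⟨q, hq, ha, h'.imp (h.sel q hq).2 (kf q hq p hp).1⟩

/-! ### Power domination as the existence of a schedule -/

/-- The arcs of a directed graph on `Fin n`, as a relation on the natural numbers. -/
def Digraph.natAdj {n : ℕ} (G : Digraph (Fin n)) (u v : ℕ) : Prop :=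
  ∃ (hu : u < n) (hv : v < n), G.Adj ⟨u, hu⟩ ⟨v, hv⟩

theorem Digraph.natAdj_val {n : ℕ} {G : Digraph (Fin n)} {u v : Fin n} :
    G.natAdj u v ↔ G.Adj u v :=
  ⟨fun ⟨_, _, h⟩ => h, fun h => ⟨u.2, v.2, h⟩⟩

/-- The nodes observed after `t` rounds. -/
def observed {V : Type*} (G : Digraph V) (S : Set V) : ℕ → Set V
  | 0 => {w | w ∈ S ∨ ∃ v ∈ S, G.Adj v w}
  | t + 1 => observed G S t ∪ {w | ∃ v ∈ observed G S t, G.Adj v w ∧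
      ∀ u, G.Adj v u → u ≠ w → u ∈ observed G S t}

theorem observed_mono {V : Type*} (G : Digraph V) (S : Set V) : Monotone (observed G S) :=
  monotone_nat_of_le_succ fun _ => Set.subset_union_left

/-- A propagation step waits for finitely many nodes, so the maximum of their rounds plus one is a
round for it. -/
theorem PowerDominated.exists_observed {V : Type*} [Finite V] {G : Digraph V} {S : Set V} {v : V}
    (h : PowerDominated G S v) : ∃ t, v ∈ observed G S t := by
  induction h with
  | of_mem h => exact ⟨0, Or.inl h⟩
  | of_adj h ha => exact ⟨0, Or.inr ⟨_, h, ha⟩⟩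
  | @propagate v w _ ha _ ihv ih =>
    classical
    obtain ⟨t, ht⟩ := ihv
    have := Fintype.ofFinite V
    choose! f hf using ih
    refine ⟨max t (Finset.univ.sup f) + 1, Or.inr ⟨v, observed_mono G S (le_max_left _ _) ht, ha,
      fun u hu huw => observed_mono G S ?_ (hf u hu huw)⟩⟩
    exact (Finset.le_sup (Finset.mem_univ u)).trans (le_max_right _ _)

/-- From left to right, moments are ranked by rounds. From right to left, every node is shown to be
observed by induction along the order: when u fires and makes v observed, u and all its other
out-neighbours come earlier. -/
theorem powerDominates_iff {n : ℕ} (G : Digraph (Fin n)) (S : Finset (Fin n)) :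
    PowerDominates G S ↔ ∃ R, IsSchedule G.natAdj (Finset.range n) R ∧
      ∀ v < n, v ∈ S.map Fin.valEmbedding ∨
        Caught G.natAdj (Finset.range n) (S.map Fin.valEmbedding) R v := by
  have hmem : ∀ v : Fin n, (v : ℕ) ∈ S.map Fin.valEmbedding ↔ v ∈ S := by
    intro v
    simp [Fin.val_inj]
  constructor
  · intro h
    classical
    set O := observed G (S : Set (Fin n)) with hO
    have hex : ∀ v, ∃ t, v ∈ O t := fun v => (h v).exists_observed
    set τ : Fin n → ℕ := fun v => Nat.find (hex v) with hτ
    have hτle : ∀ v t, τ v ≤ t ↔ v ∈ O t := by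
      intro v t
      exact ⟨fun hle => observed_mono G _ hle (Nat.find_spec (hex v)), fun hv => Nat.find_min' _ hv⟩
    have hfex : ∀ u, ∃ t, u ∈ O t ∧ ∀ w w', G.Adj u w → G.Adj u w' → w ∉ O t → w' ∉ O t →
        w = w' := by
      intro u
      refine ⟨Finset.univ.sup τ, (hτle _ _).1 (Finset.le_sup (Finset.mem_univ u)), ?_⟩
      intro w w' _ _ hw
      exact absurd ((hτle _ _).1 (Finset.le_sup (Finset.mem_univ w))) hw
    -- The firing round: the first at which u is observed and at most one out-neighbour is still
    -- missing.
    set φ : Fin n → ℕ := fun u => Nat.find (hfex u) with hφ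
    have hφ1 : ∀ u, τ u ≤ φ u := fun u => (hτle _ _).2 (Nat.find_spec (hfex u)).1
    have hφ2 : ∀ u w w', G.Adj u w → G.Adj u w' → φ u < τ w → φ u < τ w' → w = w' := by
      intro u w w' ha ha' h1 h2
      refine (Nat.find_spec (hfex u)).2 w w' ha ha' (fun h => ?_) (fun h => ?_)
      · exact absurd ((hτle _ _).2 h) (not_le.2 h1)
      · exact absurd ((hτle _ _).2 h) (not_le.2 h2)
    set τ' : ℕ → ℕ := fun v => if hv : v < n then τ ⟨v, hv⟩ else 0 with hτ'
    set φ' : ℕ → ℕ := fun v => if hv : v < n then φ ⟨v, hv⟩ else 0 with hφ'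
    have t1 : ∀ {v} (hv : v < n), τ' v = τ ⟨v, hv⟩ := fun hv => dif_pos hv
    have f1 : ∀ {v} (hv : v < n), φ' v = φ ⟨v, hv⟩ := fun hv => dif_pos hv
    -- Even ranks for observations and odd ranks for firings exclude ties. A firing of round t lies
    -- after the observations of round t and before those of round t + 1.
    set ρ : ℕ → ℕ := fun e => if e % 2 = 0 then 2 * τ' (e / 2) else 2 * φ' (e / 2) + 1 with hρ
    have r0 : ∀ v, ρ (2 * v) = 2 * τ' v := by
      intro v
      simp [hρ]
    have r1 : ∀ v, ρ (2 * v + 1) = 2 * φ' v + 1 := by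
      intro v
      have h1 : (2 * v + 1) % 2 = 1 := by omega
      have h2 : (2 * v + 1) / 2 = v := by omega
      simp [hρ, h1, h2]
    refine ⟨fun e f => ρ e < ρ f, ⟨fun e _ => lt_irrefl _, fun e f g _ _ _ => lt_trans, ?_, ?_, ?_⟩,
      ?_⟩
    · intro v hv
      have hv := Finset.mem_range.1 hv
      have := hφ1 ⟨v, hv⟩
      rw [← t1, ← f1] at this
      rw [r0, r1]
      omega
    · intro u _ w _ _
      simp only [r0, r1]
      omega
    · rintro u _ w _ w' _ ⟨hu, hw, ha⟩ ⟨_, hw', ha'⟩ h1 h2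
      simp only [r0, r1, t1 hw, t1 hw', f1 hu] at h1 h2
      have := hφ2 _ _ _ ha ha' (by omega) (by omega)
      simpa using this
    · intro v hv
      rcases hc : τ ⟨v, hv⟩ with _ | t
      · rcases (hτle ⟨v, hv⟩ 0).1 hc.le with h | ⟨u, hu, ha⟩
        · exact Or.inl ((hmem ⟨v, hv⟩).2 h)
        · exact Or.inr ⟨u, Finset.mem_range.2 u.2, ⟨u.2, hv, ha⟩, Or.inl ((hmem u).2 hu)⟩
      · have hnot : (⟨v, hv⟩ : Fin n) ∉ O t := fun h' => by
          have := (hτle _ _).2 h'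
          omega
        rcases (hτle ⟨v, hv⟩ (t + 1)).1 hc.le with h | ⟨u, hu, ha, hall⟩
        · exact absurd h hnot
        · refine Or.inr ⟨u, Finset.mem_range.2 u.2, ⟨u.2, hv, ha⟩, Or.inr ?_⟩
          -- At round t all out-neighbours of u but v are observed, so u can fire by then.
          have : φ u ≤ t := by
            refine Nat.find_min' _ ⟨hu, fun w w' hw hw' h1 h2 => ?_⟩
            have e1 : w = ⟨v, hv⟩ := by_contra fun hne => h1 (hall w hw hne)
            have e2 : w' = ⟨v, hv⟩ := by_contra fun hne => h2 (hall w' hw' hne)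
            rw [e1, e2]
          show ρ _ < ρ _
          rw [r0, r1, t1 hv, f1 u.2, hc]
          simp only [Fin.eta]
          omega
  · rintro ⟨R, hR, hv⟩
    have hr : ∀ v : Fin n, (v : ℕ) ∈ Finset.range n := fun v => Finset.mem_range.2 v.2
    have hr0 : ∀ v : Fin n, 2 * (v : ℕ) / 2 ∈ Finset.range n := fun v => by
      rw [Nat.mul_div_cancel_left _ (by omega : 0 < 2)]; exact hr v
    have hr1 : ∀ v : Fin n, (2 * (v : ℕ) + 1) / 2 ∈ Finset.range n := fun v => by
      rw [show (2 * (v : ℕ) + 1) / 2 = v by omega]; exact hr v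
    set T : Fin n → Fin n → Prop := fun v w => R (2 * (v : ℕ)) (2 * (w : ℕ)) with hT
    have : IsTrans (Fin n) T := ⟨fun a b c => hR.trans _ _ _ (hr0 a) (hr0 b) (hr0 c)⟩
    have : Std.Irrefl T := ⟨fun a => hR.irrefl _ (hr0 a)⟩
    -- The order of the observations is a strict order on a finite set, which is all the induction
    -- needs.
    have hwf : WellFounded T := Finite.wellFounded_of_trans_of_irrefl T
    intro v
    induction v using hwf.induction with
    | _ v ih =>
      rcases hv v v.2 with h | ⟨u, hu, ⟨hu', _, ha⟩, h⟩
      · exact .of_mem ((hmem v).1 h)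
      · rcases h with h | h
        · exact .of_adj ((hmem ⟨u, hu'⟩).1 h) ha
        · refine .propagate (v := ⟨u, hu'⟩) (ih _ ?_) ha fun w hw hne => ?_
          · exact hR.trans _ _ _ (hr0 ⟨u, hu'⟩) (hr1 ⟨u, hu'⟩) (hr0 v) (hR.fire u hu) h
          · rcases hR.arc u hu w (hr w) ⟨hu', w.2, hw⟩ with h' | h'
            · exact ih w (hR.trans _ _ _ (hr0 w) (hr1 ⟨u, hu'⟩) (hr0 v) h' h)
            · exact absurd (Fin.ext (hR.unique u hu w (hr w) v (hr v) ⟨hu', w.2, hw⟩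
                ⟨hu', v.2, ha⟩ h' h)) hne

namespace RAM

/-! ### Reading the data of the problem from the memory

Array `5` holds the multiples of the number of nodes, array `6` the powers of two, array `7` the
adjacency matrix, array `10` the addresses of the bags in the input, array `12` the largest size of a
bag, array `13` the addresses of the tables, array `14` the tables and array `19` the value that
stands for infinity. -/

/-- The size of the bag `i`. -/
def bagLen (s : Mem) (i : ℕ) : ℕ := s 0 (s 10 i)

/-- The node number `p` of the bag `i`. -/
def bagNode (s : Mem) (i p : ℕ) : ℕ := s 0 (s 10 i + 1 + p)

/-- The arcs of the graph. -/
def Arc (s : Mem) (u v : ℕ) : Prop := s 7 (s 5 u + v) ≠ 0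

/-- The weight of a node. The sets of least weight are of least size, and a set can be read off from
its weight. -/
def weight (s : Mem) (v : ℕ) : ℕ := s 6 (s 0 1) + s 6 v

/-- The set of nodes of the bag `i`. -/
def bagNodes (s : Mem) (i : ℕ) : Finset ℕ := bagSet (bagLen s i) (bagNode s i)

namespace PExpr

def lenE (i : PExpr) : PExpr := get 0 (get 10 i)

def lenTwiceE (i : PExpr) : PExpr := add (lenE i) (lenE i)

def nodeE (i p : PExpr) : PExpr := get 0 (add (add (get 10 i) (lit 1)) p)

def arcE (u v : PExpr) : PExpr := get 7 (add (get 5 u) v)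

def elemE (i k : PExpr) : PExpr :=
  ite (ltE k (lenE i)) (add (nodeE i k) (nodeE i k))
    (add (add (nodeE i (sub k (lenE i))) (nodeE i (sub k (lenE i)))) (lit 1))

def weightE (v : PExpr) : PExpr := add (get 6 (get 0 (lit 1))) (get 6 v)

def tableE (i σ : PExpr) : PExpr := get 14 (add (get 13 i) σ)

def statesE : PExpr := get 4 (lit 0)

def inftyE : PExpr := get 19 (lit 0)

/-- Entry in row `k + 3` and column `l`. -/
def ordE (σ k l : PExpr) : PExpr := bitE σ (add k (lit 3)) l

section

variable {s : Mem} {env : List ℕ} {i u v k l σ : PExpr}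

@[simp] theorem eval_len : (lenE i).eval s env = bagLen s (i.eval s env) := by
  simp [lenE, eval, bagLen]

@[simp] theorem eval_lenTwice : (lenTwiceE i).eval s env =
    bagLen s (i.eval s env) + bagLen s (i.eval s env) := by
  simp [lenTwiceE, eval]

@[simp] theorem eval_node : (nodeE i k).eval s env = bagNode s (i.eval s env) (k.eval s env) := by
  simp [nodeE, eval, bagNode]

@[simp] theorem holds_arc : (arcE u v).Holds s env ↔ Arc s (u.eval s env) (v.eval s env) := by
  simp [arcE, eval, Arc, Holds]

@[simp] theorem eval_elem : (elemE i k).eval s env =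
    bagElem (bagLen s (i.eval s env)) (bagNode s (i.eval s env)) (k.eval s env) := by
  have h : (ltE k (lenE i)).eval s env = 0 ↔ ¬ k.eval s env < bagLen s (i.eval s env) := by
    rw [← eval_len, ← holds_lt, Holds, not_not]
  simp only [elemE, eval, h, bagElem, eval_node, eval_len]
  split_ifs <;> omega

@[simp] theorem eval_weight : (weightE v).eval s env = weight s (v.eval s env) := by
  simp [weightE, eval, weight]

@[simp] theorem eval_table : (tableE i σ).eval s env =
    s 14 (s 13 (i.eval s env) + σ.eval s env) := by
  simp [tableE, eval]

@[simp] theorem eval_states : statesE.eval s env = s 4 0 := by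
  simp [statesE, eval]

@[simp] theorem eval_infty : inftyE.eval s env = s 19 0 := by
  simp [inftyE, eval]

@[simp] theorem holds_ord : (ordE σ k l).Holds s env ↔
    Bit s (σ.eval s env) (k.eval s env + 3) (l.eval s env) := by
  simp [ordE, eval]

/-- With infinity in the else branch, a conditional passes a finite threshold only if its guard
holds; this is how the tables filter states. -/
theorem eval_ite_le {c e f : PExpr} {x : ℕ} (hx : x < f.eval s env) :
    (ite c e f).eval s env ≤ x ↔ c.Holds s env ∧ e.eval s env ≤ x := by
  simp only [eval, Holds]
  split_ifs with h
  · simp [h]; omega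
  · simp [h]

end

/-- `IsLocal`, in the environment state, bag. -/
def localE : PExpr :=
  andE (allE (lenTwiceE (var 1)) (notE (ordE (var 1) (var 0) (var 0)))) <|
  andE (allE (lenTwiceE (var 1)) <| allE (lenTwiceE (var 2)) <| allE (lenTwiceE (var 3)) <|
    impE (ordE (var 3) (var 2) (var 1)) <| impE (ordE (var 3) (var 1) (var 0)) <|
      ordE (var 3) (var 2) (var 0)) <|
  andE (allE (lenE (var 1)) <| ordE (var 1) (var 0) (add (lenE (var 2)) (var 0))) <|
  andE (allE (lenE (var 1)) <| allE (lenE (var 2)) <|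
    impE (arcE (nodeE (var 3) (var 1)) (nodeE (var 3) (var 0))) <|
      orE (ordE (var 2) (var 0) (add (lenE (var 3)) (var 1))) <|
        andE (ordE (var 2) (add (lenE (var 3)) (var 1)) (var 0)) (bitE (var 2) (lit 2) (var 1))) <|
  andE (allE (lenE (var 1)) <| allE (lenE (var 2)) <| allE (lenE (var 3)) <|
    impE (arcE (nodeE (var 4) (var 2)) (nodeE (var 4) (var 1))) <|
    impE (arcE (nodeE (var 4) (var 2)) (nodeE (var 4) (var 0))) <|
    impE (ordE (var 3) (add (lenE (var 4)) (var 2)) (var 1)) <|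
    impE (ordE (var 3) (add (lenE (var 4)) (var 2)) (var 0)) <| eqE (var 1) (var 0)) <|
  allE (lenE (var 1)) <| impE (bitE (var 1) (lit 1) (var 0)) <| exE (lenE (var 2)) <|
    andE (arcE (nodeE (var 3) (var 0)) (nodeE (var 3) (var 1))) <|
      orE (bitE (var 2) (lit 0) (var 0)) (ordE (var 2) (add (lenE (var 3)) (var 0)) (var 1))

/-- `Merges`, in the environment state of the second bag, state of the first bag, merged state, first
bag, second bag. -/
def mergesE : PExpr :=
  andE (allE (lenE (var 3)) <| iffE (bitE (var 3) (lit 0) (var 0)) (bitE (var 2) (lit 0) (var 0))) <|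
  andE (allE (lenTwiceE (var 3)) <| allE (lenTwiceE (var 4)) <|
    iffE (ordE (var 4) (var 1) (var 0)) (ordE (var 3) (var 1) (var 0))) <|
  andE (allE (lenE (var 3)) <| allE (lenE (var 5)) <|
    impE (eqE (nodeE (var 5) (var 1)) (nodeE (var 6) (var 0))) <|
      iffE (bitE (var 3) (lit 0) (var 1)) (bitE (var 2) (lit 0) (var 0))) <|
  andE (allE (lenTwiceE (var 3)) <| allE (lenTwiceE (var 5)) <|
    impE (eqE (elemE (var 5) (var 1)) (elemE (var 6) (var 0))) <|
    allE (lenTwiceE (var 5)) <| allE (lenTwiceE (var 7)) <|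
    impE (eqE (elemE (var 7) (var 1)) (elemE (var 8) (var 0))) <|
      iffE (ordE (var 5) (var 3) (var 1)) (ordE (var 4) (var 2) (var 0))) <|
  andE (allE (lenE (var 3)) <| impE (bitE (var 3) (lit 1) (var 0)) <|
    orE (bitE (var 2) (lit 1) (var 0)) <| exE (lenE (var 5)) <|
      andE (eqE (nodeE (var 5) (var 1)) (nodeE (var 6) (var 0))) (bitE (var 2) (lit 1) (var 0))) <|
  andE (allE (lenE (var 3)) <| impE (bitE (var 2) (lit 2) (var 0)) (bitE (var 3) (lit 2) (var 0))) <|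
  andE (allE (lenE (var 3)) <| allE (lenE (var 5)) <|
    impE (eqE (nodeE (var 5) (var 1)) (nodeE (var 6) (var 0))) <|
    impE (bitE (var 2) (lit 2) (var 0)) (bitE (var 4) (lit 2) (var 1))) <|
  andE (allE (lenE (var 3)) <| allE (lenE (var 5)) <|
    impE (eqE (nodeE (var 5) (var 1)) (nodeE (var 6) (var 0))) <|
    impE (bitE (var 3) (lit 2) (var 1)) <| impE (bitE (var 2) (lit 2) (var 0)) <|
    exE (lenE (var 5)) <| andE (arcE (nodeE (var 6) (var 2)) (nodeE (var 6) (var 0))) <|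
    andE (ordE (var 4) (add (lenE (var 6)) (var 2)) (var 0)) <| exE (lenE (var 7)) <|
      eqE (nodeE (var 7) (var 1)) (nodeE (var 8) (var 0))) <|
  allE (lenE (var 4)) <| orE (bitE (var 1) (lit 0) (var 0)) <| orE (bitE (var 1) (lit 1) (var 0)) <|
    exE (lenE (var 4)) <| eqE (nodeE (var 5) (var 0)) (nodeE (var 6) (var 1))

/-- The weight of the selected nodes of the second bag that are not in the first one, in the same
environment. -/
def forgetE : PExpr :=
  sumE (lenE (var 4)) <| ite (andE (bitE (var 1) (lit 0) (var 0)) <| notE <| exE (lenE (var 4)) <|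
    eqE (nodeE (var 5) (var 0)) (nodeE (var 6) (var 1))) (weightE (nodeE (var 5) (var 0))) (lit 0)

/-- The initial entry of a table, in the environment state, bag. -/
def initE : PExpr := ite localE (lit 0) inftyE

/-- The new entry of the table of the first bag, in the environment state, first bag, second bag. -/
def mergeE : PExpr :=
  minE statesE inftyE <| minE statesE inftyE <|
    ite mergesE (add (add (tableE (var 3) (var 1)) (tableE (var 4) (var 0))) forgetE) inftyE

/-- The least weight of a solution, in the environment last bag. -/
def bestE : PExpr :=
  minE statesE inftyE <|
    ite (allE (lenE (var 1)) <| orE (bitE (var 1) (lit 0) (var 0)) (bitE (var 1) (lit 1) (var 0)))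
      (add (tableE (var 1) (var 0)) <| sumE (lenE (var 1)) <|
        ite (bitE (var 1) (lit 0) (var 0)) (weightE (nodeE (var 2) (var 0))) (lit 0))
      inftyE

/-- The hypothesis keeps the cap from cutting off the quantifiers over the nodes and the moments of
the bag. -/
theorem holds_local {s : Mem} {env : List ℕ} {σ i : ℕ} (hi : bagLen s i + bagLen s i ≤ s 4 0) :
    localE.Holds s (σ :: i :: env) ↔
      IsLocal (Arc s) (bagLen s i) (bagNode s i) (Bit s σ) := by
  have h1 : min (bagLen s i) (s 4 0) = bagLen s i := min_eq_left (by omega)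
  have h2 := min_eq_left hi
  simp only [localE, holds_and, holds_or, holds_all, holds_ex, holds_imp, holds_not, holds_ord,
    holds_bit, holds_arc, holds_eq, eval_len, eval_lenTwice, eval_node, eval, List.getD_cons_zero,
    List.getD_cons_succ, h1, h2]
  exact ⟨fun ⟨a1, a2, a3, a4, a5, a6⟩ => ⟨a1, a2, a3, a4, a5, a6⟩,
    fun ⟨a1, a2, a3, a4, a5, a6⟩ => ⟨a1, a2, a3, a4, a5, a6⟩⟩

theorem holds_merges {s : Mem} {env : List ℕ} {σ₁ σ₂ τ i j : ℕ}
    (hi : bagLen s i + bagLen s i ≤ s 4 0) (hj : bagLen s j + bagLen s j ≤ s 4 0) :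
    mergesE.Holds s (σ₂ :: σ₁ :: τ :: i :: j :: env) ↔
      Merges (Arc s) (bagLen s i) (bagNode s i) (bagLen s j) (bagNode s j)
        (Bit s σ₁) (Bit s σ₂) (Bit s τ) := by
  have h1 : min (bagLen s i) (s 4 0) = bagLen s i := min_eq_left (by omega)
  have h2 := min_eq_left hi
  have h3 : min (bagLen s j) (s 4 0) = bagLen s j := min_eq_left (by omega)
  have h4 := min_eq_left hj
  simp only [mergesE, holds_and, holds_or, holds_all, holds_ex, holds_imp, holds_iff, holds_ord,
    holds_bit, holds_arc, holds_eq, eval_len, eval_lenTwice, eval_node, eval_elem, eval,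
    List.getD_cons_zero, List.getD_cons_succ, h1, h2, h3, h4]
  exact ⟨fun ⟨a1, a2, a3, a4, a5, a6, a7, a8, a9⟩ => ⟨a1, a2, a3, a4, a5, a6, a7, a8, a9⟩,
    fun ⟨a1, a2, a3, a4, a5, a6, a7, a8, a9⟩ => ⟨a1, a2, a3, a4, a5, a6, a7, a8, a9⟩⟩

open Classical in
theorem eval_forget {s : Mem} {env : List ℕ} {σ₁ σ₂ τ i j : ℕ}
    (hi : bagLen s i + bagLen s i ≤ s 4 0) (hj : bagLen s j + bagLen s j ≤ s 4 0) :
    forgetE.eval s (σ₂ :: σ₁ :: τ :: i :: j :: env) =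
      ∑ q ∈ Finset.range (bagLen s j),
        if Bit s σ₂ 0 q ∧ bagNode s j q ∉ bagNodes s i then weight s (bagNode s j q) else 0 := by
  have h1 : min (bagLen s i) (s 4 0) = bagLen s i := min_eq_left (by omega)
  have h3 : min (bagLen s j) (s 4 0) = bagLen s j := min_eq_left (by omega)
  simp only [forgetE, eval_sum, eval_len, eval, List.getD_cons_zero, List.getD_cons_succ, h3]
  refine Finset.sum_congr rfl fun q _ => ?_
  rw [← ite_not]
  refine if_congr ?_ (by simp [eval]) rfl
  change Holds _ _ _ ↔ _
  simp only [holds_and, holds_not, holds_ex, holds_eq, holds_bit, eval_node, eval, eval_len,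
    List.getD_cons_zero, List.getD_cons_succ, h1, bagNodes, mem_bagSet]

end PExpr

end RAM

/-! ### Tables of least weights and their recurrence -/

namespace RAM

/-- `T` is the table of the bag `i` for the part `Y` of the graph: its entries are the least weights
of partial solutions, not counting the nodes of the bag. -/
def IsTable (s : Mem) (T : ℕ → ℕ) (i : ℕ) (Y : Finset ℕ) : Prop :=
  -- Only thresholds below infinity matter. A state without partial solution may have any entry from
  -- infinity on, so sums of infinite entries do no harm.
  ∀ σ < s 4 0, ∀ x < s 19 0, T σ ≤ x ↔ ∃ S R, IsSchedule (Arc s) Y R ∧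
    Describes (Arc s) (bagLen s i) (bagNode s i) (Bit s σ) Y S R ∧
    ∑ v ∈ (Y \ bagNodes s i) ∩ S, weight s v ≤ x

theorem IsTable.congr {s s' : Mem} {T : ℕ → ℕ} {i : ℕ} {Y : Finset ℕ} (h : IsTable s T i Y)
    (hs : ∀ a ∈ [0, 4, 5, 6, 7, 10, 12, 19], s' a = s a) : IsTable s' T i Y := by
  have e1 : Arc s' = Arc s := by
    funext u v
    simp [Arc, hs 7, hs 5]
  have e2 : bagLen s' = bagLen s := by
    funext u
    simp [bagLen, hs 0, hs 10]
  have e3 : bagNode s' = bagNode s := by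
    funext u v
    simp [bagNode, hs 0, hs 10]
  have e4 : weight s' = weight s := by
    funext u
    simp [weight, hs 6, hs 0]
  have e5 : Bit s' = Bit s := by
    funext u v w
    simp [Bit, hs 4, hs 12]
  have e6 : bagNodes s' = bagNodes s := by
    funext u
    simp [bagNodes, e2, e3]
  unfold IsTable
  rw [e1, e2, e3, e4, e5, e6, hs 4 (by simp), hs 19 (by simp)]
  exact h

/-- The memory holds the sizes of the bags of `m` tree nodes and the number of states. -/
structure Ready (s : Mem) (m : ℕ) : Prop where
  states : s 4 0 = 2 ^ ((s 12 0 + s 12 0 + 3) * (s 12 0 + s 12 0 + 3))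
  len_le : ∀ i < m, bagLen s i ≤ s 12 0
  inj : ∀ i < m, ∀ p < bagLen s i, ∀ q < bagLen s i, bagNode s i p = bagNode s i q → p = q

theorem Ready.len_le_states {s : Mem} {m i : ℕ} (h : Ready s m) (hi : i < m) :
    bagLen s i + bagLen s i ≤ s 4 0 := by
  have h1 := h.len_le i hi
  have h2 := h.states
  set W := s 12 0 + s 12 0 + 3
  have h3 : W ≤ W * W := Nat.le_mul_of_pos_left _ (by omega)
  have h4 : W * W < 2 ^ (W * W) := Nat.lt_two_pow_self
  omega

theorem Ready.exists_state {s : Mem} {m i : ℕ} (h : Ready s m) (hi : i < m)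
    (M : ℕ → ℕ → Prop) : ∃ σ < s 4 0, ∀ k < bagLen s i + bagLen s i + 3,
      ∀ l < bagLen s i + bagLen s i, (Bit s σ k l ↔ M k l) := by
  obtain ⟨σ, hσ, hM⟩ := exists_bit h.states M
  have := h.len_le i hi
  exact ⟨σ, hσ, fun k hk l hl => hM k (by omega) l (by omega)⟩

theorem Ready.congr {s s' : Mem} {m : ℕ} (h : Ready s m)
    (hs : ∀ a ∈ [0, 4, 10, 12], s' a = s a) : Ready s' m := by
  have e2 : bagLen s' = bagLen s := by
    funext u
    simp [bagLen, hs 0, hs 10]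
  have e3 : bagNode s' = bagNode s := by
    funext u v
    simp [bagNode, hs 0, hs 10]
  refine ⟨?_, ?_, ?_⟩
  · rw [hs 4 (by simp), hs 12 (by simp)]; exact h.states
  · rw [e2, hs 12 (by simp)]; exact h.len_le
  · rw [e2, e3]; exact h.inj

open Classical in
theorem sum_range_bag {s : Mem} {m j : ℕ} (h : Ready s m) (hj : j < m) {P : ℕ → Prop}
    {S Z : Finset ℕ} (hP : ∀ q < bagLen s j, (P q ↔ bagNode s j q ∈ S)) :
    (∑ q ∈ Finset.range (bagLen s j), if P q ∧ bagNode s j q ∉ Z then weight s (bagNode s j q)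
      else 0) = ∑ v ∈ (bagNodes s j \ Z) ∩ S, weight s v := by
  rw [← Finset.sum_filter]
  have : (bagNodes s j \ Z) ∩ S = ((Finset.range (bagLen s j)).filter
      fun q => P q ∧ bagNode s j q ∉ Z).image (bagNode s j) := by
    ext v
    simp only [bagNodes, Finset.mem_inter, Finset.mem_sdiff, mem_bagSet, Finset.mem_image,
      Finset.mem_filter, Finset.mem_range]
    constructor
    · rintro ⟨⟨⟨q, hq, rfl⟩, hZ⟩, hS⟩
      exact ⟨q, ⟨hq, (hP q hq).2 hS, hZ⟩, rfl⟩
    · rintro ⟨q, ⟨hq, h1, h2⟩, rfl⟩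
      exact ⟨⟨⟨q, hq, rfl⟩, h2⟩, (hP q hq).1 h1⟩
  rw [this, Finset.sum_image]
  intro p hp q hq hpq
  simp only [Finset.coe_filter, Finset.mem_range, Set.mem_ofPred_eq] at hp hq
  exact h.inj j hj p hp.1 q hq.1 hpq

/-- Weights are charged when a node leaves the bag, so no node is counted twice: the forgotten nodes
of the union are those of each part together with the nodes of the second bag that are not in the
first. -/
theorem sum_merge (w : ℕ → ℕ) {Y₁ Y₂ X₁ X₂ S : Finset ℕ} (hX₁ : X₁ ⊆ Y₁) (hX₂ : X₂ ⊆ Y₂)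
    (hY₁ : ∀ v ∈ Y₁, v ∈ Y₂ → v ∈ X₁) (hY₂ : ∀ v ∈ Y₁, v ∈ Y₂ → v ∈ X₂) :
    ∑ v ∈ ((Y₁ ∪ Y₂) \ X₁) ∩ S, w v = ∑ v ∈ (Y₁ \ X₁) ∩ S, w v + ∑ v ∈ (Y₂ \ X₂) ∩ S, w v +
      ∑ v ∈ (X₂ \ X₁) ∩ S, w v := by
  rw [← Finset.sum_union, ← Finset.sum_union]
  · congr 1
    ext v
    have a1 := @hX₁ v
    have a2 := @hX₂ v
    have a3 := hY₁ v
    have a4 := hY₂ v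
    simp only [Finset.mem_inter, Finset.mem_sdiff, Finset.mem_union]
    tauto
  · rw [Finset.disjoint_left]
    intro v
    have a1 := @hX₁ v
    have a2 := @hX₂ v
    have a3 := hY₁ v
    have a4 := hY₂ v
    simp only [Finset.mem_inter, Finset.mem_sdiff, Finset.mem_union]
    tauto
  · rw [Finset.disjoint_left]
    intro v
    have a3 := hY₁ v
    simp only [Finset.mem_inter, Finset.mem_sdiff]
    tauto

theorem isTable_init {s : Mem} {m i : ℕ} {env : List ℕ} (h : Ready s m) (hi : i < m) :
    IsTable s (fun σ => PExpr.initE.eval s (σ :: i :: env)) i (bagNodes s i) := by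
  intro σ hσ x hx
  simp only [PExpr.initE]
  rw [PExpr.eval_ite_le (by simpa using hx), PExpr.holds_local (h.len_le_states hi),
    isLocal_iff (h.inj i hi)]
  simp [PExpr.eval, bagNodes]

/-- The geometry of two bags whose parts of the graph are merged. -/
structure Joins (s : Mem) (i j : ℕ) (Y₁ Y₂ : Finset ℕ) : Prop where
  bag_left : bagNodes s i ⊆ Y₁
  bag_right : bagNodes s j ⊆ Y₂
  inter_left : ∀ v ∈ Y₁, v ∈ Y₂ → v ∈ bagNodes s i
  inter_right : ∀ v ∈ Y₁, v ∈ Y₂ → v ∈ bagNodes s j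
  arc : ∀ u w, Arc s u w → u ∈ Y₁ ∪ Y₂ → w ∈ Y₁ ∪ Y₂ → (u ∈ Y₁ ∧ w ∈ Y₁) ∨ (u ∈ Y₂ ∧ w ∈ Y₂)

/-- The recurrence of the dynamic program. A finite entry yields a pair of states whose partial
solutions amalgamate; conversely a partial solution restricts to both parts, and the exact states of
the restrictions match. -/
theorem isTable_merge {s : Mem} {m i j : ℕ} {env : List ℕ} {Y₁ Y₂ : Finset ℕ} (h : Ready s m)
    (hi : i < m) (hj : j < m) (hY : Joins s i j Y₁ Y₂)
    (h₁ : IsTable s (fun σ => s 14 (s 13 i + σ)) i Y₁)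
    (h₂ : IsTable s (fun σ => s 14 (s 13 j + σ)) j Y₂) :
    IsTable s (fun τ => PExpr.mergeE.eval s (τ :: i :: j :: env)) i (Y₁ ∪ Y₂) := by
  intro τ hτ x hx
  have hc : ∀ σ₁ σ₂, (PExpr.ite PExpr.mergesE (.add (.add (.tableE (.var 3) (.var 1))
      (.tableE (.var 4) (.var 0))) .forgetE) .inftyE).eval s (σ₂ :: σ₁ :: τ :: i :: j :: env) ≤ x ↔
      Merges (Arc s) (bagLen s i) (bagNode s i) (bagLen s j) (bagNode s j)
        (Bit s σ₁) (Bit s σ₂) (Bit s τ) ∧ s 14 (s 13 i + σ₁) + s 14 (s 13 j + σ₂) +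
          PExpr.forgetE.eval s (σ₂ :: σ₁ :: τ :: i :: j :: env) ≤ x := by
    intro σ₁ σ₂
    rw [PExpr.eval_ite_le (by simpa using hx),
      PExpr.holds_merges (h.len_le_states hi) (h.len_le_states hj)]
    simp [PExpr.eval]
  simp only [PExpr.mergeE]
  rw [PExpr.eval_min_le]
  simp only [PExpr.eval_min_le, PExpr.eval_infty, PExpr.eval_states, min_self, not_le.2 hx,
    false_or, hc]
  constructor
  · rintro ⟨σ₁, hσ₁, σ₂, hσ₂, hm, hle⟩
    -- The entries are at most x, hence finite, and can themselves serve as thresholds.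
    obtain ⟨S₁, R₁, hR₁, hd₁, hw₁⟩ := (h₁ σ₁ hσ₁ (s 14 (s 13 i + σ₁)) (by omega)).1 le_rfl
    obtain ⟨S₂, R₂, hR₂, hd₂, hw₂⟩ := (h₂ σ₂ hσ₂ (s 14 (s 13 j + σ₂)) (by omega)).1 le_rfl
    obtain ⟨R, hR, hd⟩ := hm.exists_describes hd₁ hd₂ hR₁ hR₂ hY.bag_left hY.bag_right
      hY.inter_left hY.inter_right hY.arc
    refine ⟨_, R, hR, hd, le_trans (le_of_eq ?_) ((add_le_add (add_le_add hw₁ hw₂) le_rfl).trans hle)⟩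
    rw [PExpr.eval_forget (h.len_le_states hi) (h.len_le_states hj),
      sum_range_bag h hj (hd₂.sel), sum_merge _ hY.bag_left hY.bag_right hY.inter_left hY.inter_right]
    have a1 := hY.bag_left
    have a2 := hY.bag_right
    congr 1
    · congr 1
      · congr 1
        ext v
        have a3 := hY.inter_left v
        simp only [Finset.mem_inter, Finset.mem_sdiff, Finset.mem_union]
        tauto
      · congr 1
        ext v
        have a3 := hY.inter_right v
        simp only [Finset.mem_inter, Finset.mem_sdiff, Finset.mem_union]
        tauto
    · congr 1
      ext v
      have a3 := hY.inter_left v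
      have a4 := @a2 v
      simp only [Finset.mem_inter, Finset.mem_sdiff, Finset.mem_union]
      tauto
  · rintro ⟨S, R, hR, hd, hw⟩
    obtain ⟨σ₁, hσ₁, hB₁⟩ := h.exists_state hi
      (stateMatrix (Arc s) (bagLen s i) (bagNode s i) Y₁ S R)
    obtain ⟨σ₂, hσ₂, hB₂⟩ := h.exists_state hj
      (stateMatrix (Arc s) (bagLen s j) (bagNode s j) Y₂ S R)
    obtain ⟨hm, hd₁, hd₂⟩ := hd.split hR hY.bag_left hY.bag_right
      hY.inter_left hY.inter_right hY.arc hB₁ hB₂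
    refine ⟨σ₁, hσ₁, σ₂, hσ₂, hm, ?_⟩
    rw [sum_merge _ hY.bag_left hY.bag_right hY.inter_left hY.inter_right] at hw
    rw [PExpr.eval_forget (h.len_le_states hi) (h.len_le_states hj), sum_range_bag h hj (hd₂.sel)]
    have e1 : s 14 (s 13 i + σ₁) ≤ _ := (h₁ σ₁ hσ₁ (∑ v ∈ (Y₁ \ bagNodes s i) ∩ S, weight s v) (by omega)).2
      ⟨S, R, hR.mono Finset.subset_union_left, hd₁, le_rfl⟩
    have e2 : s 14 (s 13 j + σ₂) ≤ _ := (h₂ σ₂ hσ₂ (∑ v ∈ (Y₂ \ bagNodes s j) ∩ S, weight s v) (by omega)).2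
      ⟨S, R, hR.mono Finset.subset_union_right, hd₂, le_rfl⟩
    omega

/-- In the end nothing more can be caught, so the bag nodes must be selected or caught already, and
their so far uncharged weights are added. -/
theorem bestE_le_iff {s : Mem} {m i : ℕ} {env : List ℕ} {Y : Finset ℕ} (h : Ready s m)
    (hi : i < m) (hY : bagNodes s i ⊆ Y) (hT : IsTable s (fun σ => s 14 (s 13 i + σ)) i Y)
    {x : ℕ} (hx : x < s 19 0) : PExpr.bestE.eval s (i :: env) ≤ x ↔
      ∃ S R, IsSchedule (Arc s) Y R ∧ (∀ v ∈ Y, v ∈ S ∨ Caught (Arc s) Y S R v) ∧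
        ∑ v ∈ Y ∩ S, weight s v ≤ x := by
  have h1 : min (bagLen s i) (s 4 0) = bagLen s i := min_eq_left (by
    have := h.len_le_states hi; omega)
  have hsum : ∀ S : Finset ℕ, ∑ v ∈ Y ∩ S, weight s v = ∑ v ∈ (Y \ bagNodes s i) ∩ S, weight s v +
      ∑ v ∈ bagNodes s i ∩ S, weight s v := by
    intro S
    rw [← Finset.sum_union]
    · congr 1
      ext v
      have := @hY v
      simp only [Finset.mem_inter, Finset.mem_sdiff, Finset.mem_union]
      tauto
    · rw [Finset.disjoint_left]
      intro v
      simp only [Finset.mem_inter, Finset.mem_sdiff]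
      tauto
  have hsel : ∀ {σ : ℕ} {S : Finset ℕ}, (∀ p < bagLen s i, (Bit s σ 0 p ↔ bagNode s i p ∈ S)) →
      (PExpr.sumE (.lenE (.var 1)) (.ite (.bitE (.var 1) (.lit 0) (.var 0))
        (.weightE (.nodeE (.var 2) (.var 0))) (.lit 0))).eval s (σ :: i :: env) =
      ∑ v ∈ bagNodes s i ∩ S, weight s v := by
    intro σ S hS
    classical
    have := sum_range_bag h hi (Z := ∅) hS
    rw [Finset.sdiff_empty] at this
    rw [← this]
    simp only [PExpr.eval_sum, PExpr.eval_len, PExpr.eval, List.getD_cons_zero, List.getD_cons_succ,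
      h1]
    refine Finset.sum_congr rfl fun q _ => ?_
    rw [← ite_not]
    refine if_congr ?_ (by simp [PExpr.eval]) rfl
    change PExpr.Holds _ _ _ ↔ _
    simp [PExpr.eval]
  simp only [PExpr.bestE]
  rw [PExpr.eval_min_le]
  simp only [PExpr.eval_infty, PExpr.eval_states, min_self, not_le.2 hx, false_or]
  constructor
  · rintro ⟨σ, hσ, hle⟩
    rw [PExpr.eval_ite_le (by simpa using hx)] at hle
    obtain ⟨hall, hle⟩ := hle
    simp only [PExpr.holds_all, PExpr.holds_or, PExpr.holds_bit, PExpr.eval, PExpr.eval_len,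
      List.getD_cons_zero, List.getD_cons_succ, h1] at hall
    rw [PExpr.eval] at hle
    simp only [PExpr.eval_table, PExpr.eval, List.getD_cons_zero, List.getD_cons_succ] at hle
    obtain ⟨S, R, hR, hd, hw⟩ := (hT σ hσ (s 14 (s 13 i + σ)) (by omega)).1 le_rfl
    refine ⟨S, R, hR, fun v hv => ?_, ?_⟩
    · by_cases hX : v ∈ bagNodes s i
      · obtain ⟨p, hp, rfl⟩ := mem_bagSet.1 hX
        exact (hall p hp).imp (hd.sel p hp).1 (hd.caught p hp)
      · exact hd.inner v hv hX
    · rw [hsum S, ← hsel hd.sel]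
      exact (Nat.add_le_add_right hw _).trans hle
  · rintro ⟨S, R, hR, hall, hw⟩
    obtain ⟨σ, hσ, hB⟩ := h.exists_state hi (stateMatrix (Arc s) (bagLen s i) (bagNode s i) Y S R)
    have hd : Describes (Arc s) (bagLen s i) (bagNode s i) (Bit s σ) Y S R :=
      ⟨fun p hp => hB 0 (by omega) p (by omega), fun k hk l hl => hB (k + 3) (by omega) l hl,
        fun p hp => (hB 1 (by omega) p (by omega)).1, fun p hp => (hB 2 (by omega) p (by omega)).2,
        fun v hv _ => hall v hv⟩
    refine ⟨σ, hσ, ?_⟩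
    rw [PExpr.eval_ite_le (by simpa using hx)]
    constructor
    · simp only [PExpr.holds_all, PExpr.holds_or, PExpr.holds_bit, PExpr.eval, PExpr.eval_len,
        List.getD_cons_zero, List.getD_cons_succ, h1]
      intro p hp
      exact (hall _ (hY (mem_bagSet.2 ⟨p, hp, rfl⟩))).imp (hd.sel p hp).2
        (hB 1 (by omega) p (by omega)).2
    · rw [PExpr.eval, hsel hd.sel]
      simp only [PExpr.eval_table, PExpr.eval, List.getD_cons_zero, List.getD_cons_succ]
      rw [hsum S] at hw
      have : s 14 (s 13 i + σ) ≤ _ := (hT σ hσ (∑ v ∈ (Y \ bagNodes s i) ∩ S, weight s v) (by omega)).2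
        ⟨S, R, hR, hd, le_rfl⟩
      omega

end RAM

/-! ### Contracting the leaves of a tree decomposition -/

section Contraction

variable {m n : ℕ} {T : SimpleGraph (Fin m)} {X : Fin m → Finset ℕ} {A : ℕ → ℕ → Prop}

/-- The tree nodes outside `L` have been contracted into the tree nodes in `L`, and `Y k` is the part
of the graph that belongs to `k`. -/
structure Contraction (T : SimpleGraph (Fin m)) (X : Fin m → Finset ℕ) (A : ℕ → ℕ → Prop) (n : ℕ)
    (L : Finset (Fin m)) (Y : Fin m → Finset ℕ) : Prop where
  conn : (T.induce (L : Set (Fin m))).Preconnected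
  bag_subset : ∀ k ∈ L, X k ⊆ Y k
  lt : ∀ k ∈ L, ∀ v ∈ Y k, v < n
  inter : ∀ i ∈ L, ∀ k ∈ L, i ≠ k → ∀ v ∈ Y i, v ∈ Y k → v ∈ X i
  cover : ∀ v < n, ∃ k ∈ L, v ∈ Y k
  arc : ∀ u w, u < n → w < n → A u w → ∃ k ∈ L, u ∈ Y k ∧ w ∈ Y k

theorem Contraction.start (hT : T.Connected) (hlt : ∀ k, ∀ v ∈ X k, v < n) (hcover : ∀ v < n, ∃ k, v ∈ X k)
    (harc : ∀ u w, u < n → w < n → A u w → ∃ k, u ∈ X k ∧ w ∈ X k) :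
    Contraction T X A n Finset.univ X where
  conn := by
    refine hT.preconnected.map (H := T.induce ((Finset.univ : Finset (Fin m)) : Set (Fin m)))
      ⟨fun v => ⟨v, by simp⟩, fun {a b} hab => hab⟩ fun v => ⟨v.1, rfl⟩
  bag_subset _ _ := subset_rfl
  lt k _ := hlt k
  inter _ _ _ _ _ _ hv _ := hv
  cover v hv := by simpa using hcover v hv
  arc u w hu hw h := by simpa using harc u w hu hw h

variable [DecidableRel T.Adj]

/-- The neighbours of `k` among the remaining tree nodes. -/
def restNeighbors (T : SimpleGraph (Fin m)) [DecidableRel T.Adj] (L : Finset (Fin m))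
    (k : Fin m) : Finset (Fin m) := L.filter (T.Adj k)

theorem mem_restNeighbors {L : Finset (Fin m)} {k l : Fin m} :
    l ∈ restNeighbors T L k ↔ l ∈ L ∧ T.Adj k l := Finset.mem_filter

/-- The remaining nodes induce a connected subgraph of a forest, that is, a tree with at least two
nodes. -/
theorem exists_leaf (hT : T.IsAcyclic) {L : Finset (Fin m)}
    (hL : (T.induce (L : Set (Fin m))).Preconnected) (h2 : 1 < L.card) :
    ∃ k ∈ L, (restNeighbors T L k).card = 1 := by
  classical
  obtain ⟨a, ha, b, hb, hab⟩ := Finset.one_lt_card.1 h2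
  have : Nontrivial (L : Set (Fin m)) := ⟨⟨a, ha⟩, ⟨b, hb⟩, fun h => hab (congrArg Subtype.val h)⟩
  have : Nonempty (L : Set (Fin m)) := ⟨⟨a, ha⟩⟩
  have htree : (T.induce (L : Set (Fin m))).IsTree := ⟨⟨hL⟩, hT.induce _⟩
  obtain ⟨v, hv⟩ := htree.exists_vert_degree_one_of_nontrivial
  refine ⟨v, v.2, ?_⟩
  rw [← hv, ← SimpleGraph.card_neighborFinset_eq_degree,
    ← Finset.card_map (Function.Embedding.subtype _)]
  congr 1
  ext k
  simp only [mem_restNeighbors, Finset.mem_map, SimpleGraph.mem_neighborFinset,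
    SimpleGraph.comap_adj, Function.Embedding.subtype_apply]
  constructor
  · exact fun ⟨h1, h2⟩ => ⟨⟨k, h1⟩, h2, rfl⟩
  · rintro ⟨k, h, rfl⟩
    exact ⟨k.2, h⟩

variable {L : Finset (Fin m)} {i j : Fin m}

theorem preconnected_erase (hL : (T.induce (L : Set (Fin m))).Preconnected)
    (hij : restNeighbors T L j = {i}) :
    (T.induce ((L.erase j : Finset (Fin m)) : Set (Fin m))).Preconnected := by
  have h := hL.induce_of_degree_eq_one (s := {v | v.1 ≠ j}) (by
    rintro v hv a ha b hb
    have hv : v.1 = j := by simpa using hv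
    have hmem : ∀ c, c ∈ (T.induce (L : Set (Fin m))).neighborSet v → c.1 = i := by
      intro c hc
      have : c.1 ∈ restNeighbors T L j := mem_restNeighbors.2 ⟨c.2, hv ▸ hc⟩
      rwa [hij, Finset.mem_singleton] at this
    exact Subtype.ext ((hmem a ha).trans (hmem b hb).symm))
  refine h.map (H := T.induce ((L.erase j : Finset (Fin m)) : Set (Fin m)))
    ⟨fun v => ⟨v.1.1, Finset.mem_coe.2 (Finset.mem_erase.2 ⟨v.2, v.1.2⟩)⟩, fun {a b} hab => hab⟩ ?_
  rintro ⟨v, hv⟩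
  have hv' := Finset.mem_erase.1 (Finset.mem_coe.1 hv)
  exact ⟨⟨⟨v, hv'.2⟩, hv'.1⟩, rfl⟩

/-- A path that leaves the leaf j passes through its only remaining neighbour i in the first step.
-/
theorem inter_subset_of_leaf
    (hX : ∀ (i j k : Fin m) (p : T.Walk i k), p.IsPath → j ∈ p.support → X i ∩ X k ⊆ X j)
    (hL : (T.induce (L : Set (Fin m))).Preconnected) (hij : restNeighbors T L j = {i})
    (hj : j ∈ L) {k : Fin m} (hk : k ∈ L) (hkj : k ≠ j) : X j ∩ X k ⊆ X i := by
  obtain ⟨p, hp⟩ := hL.exists_isPath ⟨j, hj⟩ ⟨k, hk⟩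
  refine hX j i k (p.map (SimpleGraph.Embedding.induce (G := T) (L : Set (Fin m))).toHom)
    (hp.map (SimpleGraph.Embedding.induce (G := T) (L : Set (Fin m))).injective) ?_
  cases p with
  | nil => exact absurd rfl hkj
  | @cons _ b _ hadj q =>
    have : b.1 ∈ restNeighbors T L j := mem_restNeighbors.2 ⟨b.2, hadj⟩
    rw [hij, Finset.mem_singleton] at this
    have hmem : (b : Fin m) ∈ (SimpleGraph.Walk.map (SimpleGraph.Embedding.induce (G := T)
        (L : Set (Fin m))).toHom (SimpleGraph.Walk.cons hadj q)).support := by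
      rw [SimpleGraph.Walk.support_map]
      exact List.mem_map.2 ⟨b, by simp, rfl⟩
    exact this ▸ hmem

namespace Contraction

variable {Y : Fin m → Finset ℕ}

theorem left_mem (hij : restNeighbors T L j = {i}) : i ∈ L ∧ T.Adj j i :=
  mem_restNeighbors.1 (hij ▸ Finset.mem_singleton_self i)

theorem inter_leaf (h : Contraction T X A n L Y)
    (hX : ∀ (i j k : Fin m) (p : T.Walk i k), p.IsPath → j ∈ p.support → X i ∩ X k ⊆ X j)
    (hj : j ∈ L) (hij : restNeighbors T L j = {i}) {k : Fin m} (hk : k ∈ L) (hkj : k ≠ j)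
    {v : ℕ} (h1 : v ∈ Y j) (h2 : v ∈ Y k) : v ∈ X i :=
  inter_subset_of_leaf hX h.conn hij hj hk hkj (Finset.mem_inter.2
    ⟨h.inter j hj k hk hkj.symm v h1 h2, h.inter k hk j hj hkj v h2 h1⟩)

/-- The arc lies in some remaining part Y k. If k is not the leaf j, then any end of it in Y j also
lies in Y k, hence in the bag of i. -/
theorem arc_leaf (h : Contraction T X A n L Y)
    (hX : ∀ (i j k : Fin m) (p : T.Walk i k), p.IsPath → j ∈ p.support → X i ∩ X k ⊆ X j)
    (hj : j ∈ L) (hij : restNeighbors T L j = {i}) {u w : ℕ} (ha : A u w)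
    (hu : u ∈ Y i ∪ Y j) (hw : w ∈ Y i ∪ Y j) :
    (u ∈ Y i ∧ w ∈ Y i) ∨ (u ∈ Y j ∧ w ∈ Y j) := by
  obtain ⟨hi, hadj⟩ := left_mem hij
  have hlt : ∀ v ∈ Y i ∪ Y j, v < n := fun v hv =>
    (Finset.mem_union.1 hv).elim (h.lt i hi v) (h.lt j hj v)
  obtain ⟨k, hk, hku, hkw⟩ := h.arc u w (hlt u hu) (hlt w hw) ha
  by_cases hkj : k = j
  · exact Or.inr ⟨hkj ▸ hku, hkj ▸ hkw⟩
  · have : ∀ v ∈ Y i ∪ Y j, v ∈ Y k → v ∈ Y i := by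
      intro v hv hvk
      rcases Finset.mem_union.1 hv with hv | hv
      · exact hv
      · exact h.bag_subset i hi (h.inter_leaf hX hj hij hk hkj hv hvk)
    exact Or.inl ⟨this u hu hku, this w hw hkw⟩

theorem step (h : Contraction T X A n L Y)
    (hX : ∀ (i j k : Fin m) (p : T.Walk i k), p.IsPath → j ∈ p.support → X i ∩ X k ⊆ X j)
    (hj : j ∈ L) (hij : restNeighbors T L j = {i}) :
    Contraction T X A n (L.erase j) (Function.update Y i (Y i ∪ Y j)) := by
  obtain ⟨hi, hadj⟩ := left_mem hij
  have hne : i ≠ j := hadj.ne'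
  have hmem : ∀ k ∈ L.erase j, k ∈ L ∧ k ≠ j := fun k hk =>
    ⟨Finset.mem_of_mem_erase hk, Finset.ne_of_mem_erase hk⟩
  have hi' : i ∈ L.erase j := Finset.mem_erase.2 ⟨hne, hi⟩
  have hsub : ∀ k, Y k ⊆ Function.update Y i (Y i ∪ Y j) k := by
    intro k
    by_cases hk : k = i
    · subst hk; simp
    · simp [hk]
  have hsub' : Y j ⊆ Function.update Y i (Y i ∪ Y j) i := by simp
  refine ⟨preconnected_erase h.conn hij, ?_, ?_, ?_, ?_, ?_⟩
  · intro k hk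
    exact (h.bag_subset k (hmem k hk).1).trans (hsub k)
  · intro k hk v hv
    by_cases hki : k = i
    · subst hki
      rw [Function.update_self] at hv
      exact (Finset.mem_union.1 hv).elim (h.lt k hi v) (h.lt j hj v)
    · rw [Function.update_of_ne hki] at hv
      exact h.lt k (hmem k hk).1 v hv
  · intro k hk l hl hkl v hv hv'
    obtain ⟨hk, hkj⟩ := hmem k hk
    obtain ⟨hl, hlj⟩ := hmem l hl
    by_cases hki : k = i
    · subst hki
      rw [Function.update_self] at hv
      rw [Function.update_of_ne hkl.symm] at hv'
      rcases Finset.mem_union.1 hv with hv | hv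
      · exact h.inter k hk l hl hkl v hv hv'
      · exact h.inter_leaf hX hj hij hl hlj hv hv'
    · rw [Function.update_of_ne hki] at hv
      by_cases hli : l = i
      · subst hli
        rw [Function.update_self] at hv'
        rcases Finset.mem_union.1 hv' with hv' | hv'
        · exact h.inter k hk l hl hkl v hv hv'
        · exact h.inter k hk j hj hkj v hv hv'
      · rw [Function.update_of_ne hli] at hv'
        exact h.inter k hk l hl hkl v hv hv'
  · intro v hv
    obtain ⟨k, hk, hvk⟩ := h.cover v hv
    by_cases hkj : k = j
    · exact ⟨i, hi', hsub' (hkj ▸ hvk)⟩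
    · exact ⟨k, Finset.mem_erase.2 ⟨hkj, hk⟩, hsub k hvk⟩
  · intro u w hu hw ha
    obtain ⟨k, hk, h1, h2⟩ := h.arc u w hu hw ha
    by_cases hkj : k = j
    · exact ⟨i, hi', hsub' (hkj ▸ h1), hsub' (hkj ▸ h2)⟩
    · exact ⟨k, Finset.mem_erase.2 ⟨hkj, hk⟩, hsub k h1, hsub k h2⟩

end Contraction

theorem restNeighbors_erase_left (hadj : T.Adj j i) (hj : j ∈ L) :
    (restNeighbors T (L.erase j) i).card = (restNeighbors T L i).card - 1 ∧
    ∑ l ∈ restNeighbors T (L.erase j) i, (l : ℕ) = ∑ l ∈ restNeighbors T L i, (l : ℕ) - j := by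
  have hmem : j ∈ restNeighbors T L i := mem_restNeighbors.2 ⟨hj, hadj.symm⟩
  have : restNeighbors T (L.erase j) i = (restNeighbors T L i).erase j := by
    ext k
    simp only [mem_restNeighbors, Finset.mem_erase]
    tauto
  rw [this, Finset.card_erase_of_mem hmem, ← Finset.add_sum_erase _ _ hmem]
  simp

theorem restNeighbors_erase_of_ne (hij : restNeighbors T L j = {i}) {k : Fin m} (hk : k ∈ L)
    (hki : k ≠ i) : restNeighbors T (L.erase j) k = restNeighbors T L k := by
  ext l
  simp only [mem_restNeighbors, Finset.mem_erase]
  constructor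
  · tauto
  · rintro ⟨h1, h2⟩
    refine ⟨⟨?_, h1⟩, h2⟩
    rintro rfl
    have : k ∈ restNeighbors T L l := mem_restNeighbors.2 ⟨hk, h2.symm⟩
    rw [hij, Finset.mem_singleton] at this
    exact hki this

/-- Distinct unordered pairs make each neighbour of k contribute once. Used with g = 1 for degrees
and with g the number of the node for sums of neighbours. -/
theorem sum_edgeList {I : Type*} [DecidableEq I] [Fintype I] (F : List (I × I))
    (hF : (F.map fun e => s(e.1, e.2)).Nodup) (hne : ∀ e ∈ F, e.1 ≠ e.2) (g : I → ℕ) (k : I) :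
    (F.map fun e => (if e.1 = k then g e.2 else 0) + (if e.2 = k then g e.1 else 0)).sum =
      ∑ l ∈ Finset.univ.filter (fun l => s(k, l) ∈ F.map fun e => s(e.1, e.2)), g l := by
  induction F with
  | nil => simp
  | cons e F ih =>
    rw [List.map_cons, List.nodup_cons] at hF
    have ih := ih hF.2 fun e he => hne e (List.mem_cons_of_mem _ he)
    have hne' := hne e List.mem_cons_self
    rw [List.map_cons, List.sum_cons, ih]
    have : Finset.univ.filter (fun l => s(k, l) ∈ (e :: F).map fun e => s(e.1, e.2)) =
        Finset.univ.filter (fun l => s(k, l) = s(e.1, e.2)) ∪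
        Finset.univ.filter (fun l => s(k, l) ∈ F.map fun e => s(e.1, e.2)) := by
      ext l
      simp only [List.map_cons, List.mem_cons, Finset.mem_filter, Finset.mem_univ, true_and,
        Finset.mem_union]
    rw [this, Finset.sum_union]
    · congr 1
      obtain ⟨x, y⟩ := e
      simp only at hne' ⊢
      by_cases hx : x = k
      · subst hx
        have : Finset.univ.filter (fun l => s(x, l) = s(x, y)) = {y} := by
          ext l
          simpa using fun h _ => absurd h hne'
        rw [this, if_pos rfl, if_neg (fun h => hne' h.symm)]
        simp
      · by_cases hy : y = k
        · subst hy
          have : Finset.univ.filter (fun l => s(y, l) = s(x, y)) = {x} := by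
            ext l
            rw [Sym2.eq_swap (a := x)]
            simpa using fun h _ => absurd h.symm hx
          rw [this, if_neg hx, if_pos rfl]
          simp
        · have : Finset.univ.filter (fun l => s(k, l) = s(x, y)) = ∅ := by
            ext l
            simp only [Sym2.eq_iff, Finset.mem_filter, Finset.mem_univ, true_and,
              Finset.notMem_empty, iff_false]
            rintro (⟨h, -⟩ | ⟨h, -⟩)
            · exact hx h.symm
            · exact hy h.symm
          rw [this, if_neg hx, if_neg hy]
          simp
    · rw [Finset.disjoint_left]
      intro l h1 h2
      simp only [Finset.mem_filter, Finset.mem_univ, true_and] at h1 h2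
      exact hF.1 (h1 ▸ h2)

end Contraction

/-! ### The program -/

namespace RAM

open PExpr Stmt

/-- The number of graph nodes. -/
def nodesE : PExpr := get 0 (lit 1)

/-- The number of tree nodes. -/
def bagsE : PExpr := get 0 (lit 2)

/-- The number of graph edges. -/
def arcsE : PExpr := get 0 (lit 3)

/-- The number of tree edges. -/
def linksE : PExpr := get 0 (lit 4)

/-- The outer loops run n, m, 2m, or as often as there are arcs or links; the sum of these numbers
bounds them all and is computed without a loop. -/
def setOuterCap : Stmt :=
  set 4 (lit 1) (add (add nodesE (add bagsE bagsE)) (add arcsE linksE))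

def fillPowers : Stmt :=
  seq (set 6 (lit 0) (lit 1)) <| loop true nodesE <|
    seq (set 6 (add (var 0) (lit 1)) (add (get 6 (var 0)) (get 6 (var 0))))
      (set 5 (add (var 0) (lit 1)) (add (get 5 (var 0)) nodesE))

def setInfty : Stmt :=
  seq (set 19 (lit 0) (lit 1)) <| loop true nodesE <|
    set 19 (lit 0) (add inftyE (weightE (var 0)))

def readArcs : Stmt :=
  -- Cell `0` holds the length and cells `1` to `4` the header, so the arcs start in cell `5`. Only
  -- cells of arcs are written; the rest of the n × n matrix is zero from the start, at no cost.
  loop true arcsE <| set 7 (add (get 5 (get 0 (add (lit 5) (add (var 0) (var 0)))))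
    (get 0 (add (lit 6) (add (var 0) (var 0))))) (lit 1)

/-- Array `8` receives the degrees of the tree nodes, and array `9` the sums of the neighbours. -/
def readTree : Stmt :=
  loop true linksE <|
    letS (get 0 (add (add (lit 5) (add arcsE arcsE)) (add (var 0) (var 0)))) <|
    letS (get 0 (add (add (lit 6) (add arcsE arcsE)) (add (var 1) (var 1)))) <|
    seq (set 8 (var 1) (add (get 8 (var 1)) (lit 1))) <|
    seq (set 8 (var 0) (add (get 8 (var 0)) (lit 1))) <|
    seq (set 9 (var 1) (add (get 9 (var 1)) (var 0))) <|
    set 9 (var 0) (add (get 9 (var 0)) (var 1))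

def readBags : Stmt :=
  seq (set 11 (lit 0) (add (add (lit 5) (add arcsE arcsE)) (add linksE linksE))) <|
  loop true bagsE <|
    seq (set 10 (var 0) (get 11 (lit 0))) <|
    seq (ite (ltE (get 12 (lit 0)) (get 0 (get 11 (lit 0))))
      (set 12 (lit 0) (get 0 (get 11 (lit 0)))) skip) <|
    set 11 (lit 0) (add (add (get 11 (lit 0)) (lit 1)) (get 0 (get 11 (lit 0))))

/-- The folds in `mulE` and `twoPowE` are themselves cut at the cap. It is therefore raised in three
stages, to W, W² and 2 ^ (W²), each computed under the preceding cap. -/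
def setSide : Stmt := set 4 (lit 0) sideE

def setBits : Stmt := set 4 (lit 0) (mulE statesE statesE)

def setStates : Stmt := set 4 (lit 0) (twoPowE statesE)

def fillBases : Stmt :=
  loop true bagsE <| set 13 (add (var 0) (lit 1)) (add (get 13 (var 0)) statesE)

def initTables : Stmt :=
  loop true bagsE <| loop false statesE <| set 14 (add (get 13 (var 1)) (var 0)) initE

/-- The table of the tree node `j` is merged into that of `i`, in the environment `i`, `j`. -/
def mergeTables : Stmt :=
  seq (loop false statesE <| set 15 (var 0) mergeE) <|
    loop false statesE <| set 14 (add (get 13 (var 1)) (var 0)) (get 15 (var 0))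

/-- The leaf `j` with the neighbour `i` is removed from the tree, in the environment `i`, `j`. -/
def removeLeaf : Stmt :=
  seq (set 8 (var 1) (lit 0)) <|
  seq (set 8 (var 0) (sub (get 8 (var 0)) (lit 1))) <|
  seq (set 9 (var 0) (sub (get 9 (var 0)) (var 1))) <|
  seq (set 18 (lit 0) (var 0)) <|
  set 17 (lit 0) (var 0)

/-- Cell `0` of array `16` counts the tree nodes that have been searched for leaves, cell `0` of
array `17` holds the current tree node, and cell `0` of array `18` a remaining one. -/
def contractLeaf : Stmt :=
  ite (eqE (get 8 (get 17 (lit 0))) (lit 1))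
    -- For a leaf the sum of the remaining neighbours is its only neighbour, so no adjacency lists
    -- are needed.
    (letS (get 17 (lit 0)) <| letS (get 9 (var 0)) <| seq mergeTables removeLeaf)
    (seq (set 16 (lit 0) (add (get 16 (lit 0)) (lit 1))) (set 17 (lit 0) (get 16 (lit 0))))

/-- Each round advances the search counter or removes a leaf. There are fewer than m removals, so 2m
rounds carry the counter past all tree nodes. -/
def contractTree : Stmt := loop true (add bagsE bagsE) contractLeaf

def setBest : Stmt := letS (get 18 (lit 0)) <| set 20 (lit 0) bestE

/-- The optimal value is |S| 2^n plus a number below 2^n; this strips off the first summand by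
repeated subtraction. -/
def reduceBest : Stmt :=
  loop true nodesE <| ite (leE (get 6 nodesE) (get 20 (lit 0)))
    (set 20 (lit 0) (sub (get 20 (lit 0)) (get 6 nodesE))) skip

/-- Reads the binary digits from the top. Cell `0` of the output counts the nodes found and thereby
gives the next free cell. -/
def writeOutput : Stmt :=
  loop true nodesE <| letS (sub (sub nodesE (lit 1)) (var 0)) <|
    ite (leE (get 6 (var 0)) (get 20 (lit 0)))
      (seq (set 20 (lit 0) (sub (get 20 (lit 0)) (get 6 (var 0)))) <|
        seq (set 1 (lit 0) (add (get 1 (lit 0)) (lit 1))) (set 1 (get 1 (lit 0)) (var 0)))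
      skip

/-- The program for Directed PDS. -/
def phases : List Stmt :=
  [setOuterCap, fillPowers, setInfty, readArcs, readTree, readBags, setSide, setBits, setStates,
    fillBases, initTables, contractTree, setBest, reduceBest, writeOutput]

/-! ### The phases that read the input and prepare the tables -/

variable {s : Mem}

theorem Stmt.run_seq (p q : Stmt) (env : List ℕ) (s : Mem) :
    (seq p q).run env s = q.run env (p.run env s) := rfl

theorem Stmt.run_letS (e : PExpr) (p : Stmt) (env : List ℕ) (s : Mem) :
    (letS e p).run env s = p.run (e.eval s env :: env) s := rfl

theorem Stmt.run_set {a : ℕ} (ha : a ≠ 3) (e f : PExpr) (env : List ℕ) (s : Mem) :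
    (set a e f).run env s = write s a (e.eval s env) (f.eval s env) := if_neg ha

theorem Stmt.run_ite (c : PExpr) (p q : Stmt) (env : List ℕ) (s : Mem) :
    (ite c p q).run env s = if c.eval s env = 0 then q.run env s else p.run env s := rfl

theorem run_fillPowers {n : ℕ} (hn : s 0 1 = n) (hM : n ≤ s 4 1) (h5 : s 5 0 = 0) :
    ∀ v ≤ n, fillPowers.run [] s 6 v = 2 ^ v ∧ fillPowers.run [] s 5 v = v * n := by
  rw [fillPowers, run_seq, run_set (by decide)]
  refine run_loop_inv (fun k s' => ∀ v ≤ k, s' 6 v = 2 ^ v ∧ s' 5 v = v * n) ?_ ?_ ?_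
  · simp [PExpr.eval, nodesE, write_apply, hn, capCell, hM]
  · intro v hv
    obtain rfl : v = 0 := by omega
    simp [PExpr.eval, write_apply, h5]
  · intro j hj s' hs' ih v hv
    have e0 : s' 0 = s 0 := by
      rw [hs' 0 (by simp [writes]), write_of_ne _ _ _ (by omega)]
    have ihj := ih j le_rfl
    rcases Nat.lt_succ_iff_lt_or_eq.1 (Nat.lt_succ_of_le hv) with hv | rfl
    · have := ih v (by omega)
      have hne : v ≠ j + 1 := by omega
      simp [run, PExpr.eval, write_apply, this, hne]
    · simp [run, PExpr.eval, write_apply, ihj, nodesE, e0, hn, pow_succ]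
      constructor <;> ring

theorem run_setInfty {n : ℕ} (hn : s 0 1 = n) (hM : n ≤ s 4 1) :
    setInfty.run [] s 19 0 = 1 + ∑ v ∈ Finset.range n, weight s v := by
  rw [setInfty, run_seq, run_set (by decide)]
  refine run_loop_inv (fun k s' => s' 19 0 = 1 + ∑ v ∈ Finset.range k, weight s v) ?_ ?_ ?_
  · simp [PExpr.eval, nodesE, write_apply, hn, capCell, hM]
  · simp [PExpr.eval]
  · intro j hj s' hs' ih
    have e0 : s' 0 = s 0 := by
      rw [hs' 0 (by simp [writes]), write_of_ne _ _ _ (by omega)]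
    have e6 : s' 6 = s 6 := by
      rw [hs' 6 (by simp [writes]), write_of_ne _ _ _ (by omega)]
    rw [Finset.sum_range_succ, ← add_assoc, ← ih]
    simp [run, PExpr.eval, weight, e0, e6]

theorem run_readArcs {a : ℕ} (ha : s 0 3 = a) (hM : a ≤ s 4 1) (h7 : ∀ c, s 7 c = 0) (c : ℕ) :
    readArcs.run [] s 7 c ≠ 0 ↔ ∃ j < a, s 5 (s 0 (5 + (j + j))) + s 0 (6 + (j + j)) = c := by
  simp only [readArcs]
  refine run_loop_inv (fun k s' => s' 7 c ≠ 0 ↔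
    ∃ j < k, s 5 (s 0 (5 + (j + j))) + s 0 (6 + (j + j)) = c) ?_ ?_ ?_
  · simp [PExpr.eval, arcsE, ha, capCell, hM]
  · simp [h7]
  · intro j hj s' hs' ih
    have e0 : s' 0 = s 0 := hs' 0 (by simp [writes])
    have e5 : s' 5 = s 5 := hs' 5 (by simp [writes])
    simp only [run, PExpr.eval, write_apply, e0, e5, List.getD_cons_zero, Nat.reduceEqDiff,
      if_false, true_and]
    constructor
    · intro h
      split_ifs at h with hc
      · exact ⟨j, by omega, hc.symm⟩
      · obtain ⟨k, hk, h⟩ := ih.1 h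
        exact ⟨k, by omega, h⟩
    · rintro ⟨k, hk, h⟩
      split_ifs with hc
      · simp
      · refine ih.2 ⟨k, ?_, h⟩
        rcases Nat.lt_succ_iff_lt_or_eq.1 hk with hk | rfl
        · exact hk
        · exact absurd h.symm hc

theorem run_readTree {a f : ℕ} {x y : ℕ → ℕ} (ha : s 0 3 = a) (hf : s 0 4 = f) (hM : f ≤ s 4 1)
    (hx : ∀ j < f, s 0 (5 + (a + a) + (j + j)) = x j)
    (hy : ∀ j < f, s 0 (6 + (a + a) + (j + j)) = y j)
    (h8 : ∀ c, s 8 c = 0) (h9 : ∀ c, s 9 c = 0) (k : ℕ) :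
    readTree.run [] s 8 k =
      ∑ j ∈ Finset.range f, ((if x j = k then 1 else 0) + if y j = k then 1 else 0) ∧
    readTree.run [] s 9 k =
      ∑ j ∈ Finset.range f, ((if x j = k then y j else 0) + if y j = k then x j else 0) := by
  simp only [readTree]
  refine run_loop_inv (fun l s' => s' 8 k =
      ∑ j ∈ Finset.range l, ((if x j = k then 1 else 0) + if y j = k then 1 else 0) ∧
    s' 9 k = ∑ j ∈ Finset.range l, ((if x j = k then y j else 0) + if y j = k then x j else 0))
    ?_ ?_ ?_
  · simp [PExpr.eval, linksE, hf, capCell, hM]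
  · simp [h8, h9]
  · rintro j hj s' hs' ⟨ih1, ih2⟩
    have e0 : s' 0 = s 0 := hs' 0 (by simp [writes])
    rw [Finset.sum_range_succ, Finset.sum_range_succ, ← ih1, ← ih2]
    simp only [run, PExpr.eval, write_apply, e0, arcsE, ha, hx j hj, hy j hj, List.getD_cons_zero,
      List.getD_cons_succ, Nat.reduceEqDiff, if_false, true_and, false_and]
    by_cases h1 : x j = k <;> by_cases h2 : y j = k <;> by_cases h3 : x j = y j <;>
      simp_all [eq_comm] <;> omega

theorem run_readBags {m : ℕ} {ptr r : ℕ → ℕ} (hm : s 0 2 = m) (hM : m ≤ s 4 1)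
    (hptr : ptr 0 = 5 + (s 0 3 + s 0 3) + (s 0 4 + s 0 4))
    (hptr' : ∀ i < m, ptr (i + 1) = ptr i + 1 + r i) (hr : ∀ i < m, s 0 (ptr i) = r i)
    (h12 : s 12 0 = 0) :
    (∀ i < m, readBags.run [] s 10 i = ptr i) ∧
      readBags.run [] s 12 0 = (Finset.range m).sup r := by
  rw [readBags, run_seq, run_set (by decide)]
  refine And.right (run_loop_inv (fun k s' => s' 11 0 = ptr k ∧ (∀ i < k, s' 10 i = ptr i) ∧
    s' 12 0 = (Finset.range k).sup r) ?_ ?_ ?_)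
  · simp [PExpr.eval, bagsE, write_apply, hm, capCell, hM]
  · simp [PExpr.eval, arcsE, linksE, write_apply, h12, hptr]
  · rintro j hj s' hs' ⟨ih1, ih2, ih3⟩
    have e0 : s' 0 = s 0 := by
      rw [hs' 0 (by simp [writes]), write_of_ne _ _ _ (by omega)]
    have hlt : (ltE (get 12 (lit 0)) (get 0 (get 11 (lit 0)))).eval (write s' 10 j (ptr j)) [j] = 0 ↔
        ¬ s' 12 0 < r j := by
      have := holds_lt (s := write s' 10 j (ptr j)) (env := [j]) (e := get 12 (lit 0))
        (f := get 0 (get 11 (lit 0)))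
      simp only [PExpr.eval, write_apply, Nat.reduceEqDiff, false_and, if_false, ih1, e0, hr j hj,
        Holds] at this
      rw [← this, not_not]
    have h0 := hr j hj
    have h1 := hptr' j hj
    have hw : (set 10 (var 0) (get 11 (lit 0))).run [j] s' = write s' 10 j (ptr j) := by
      rw [run_set (by decide), ← ih1]
      rfl
    rw [run_seq, hw, run_seq, run_set (by decide), run_ite, Finset.range_add_one, Finset.sup_insert,
      ← ih3]
    by_cases hc : s' 12 0 < r j
    · rw [if_neg (fun h => hlt.1 h hc), run_set (by decide)]
      simp only [PExpr.eval, write_apply, Nat.reduceEqDiff, false_and, if_false, true_and, if_true,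
        ih1, e0, h0, h1]
      refine ⟨fun i hi => ?_, (max_eq_left hc.le).symm⟩
      split_ifs with h
      · rw [h]
      · exact ih2 i (by omega)
    · rw [if_pos (hlt.2 hc)]
      simp only [run, PExpr.eval, write_apply, Nat.reduceEqDiff, false_and, if_false, true_and,
        if_true, ih1, e0, h0, h1]
      refine ⟨fun i hi => ?_, (max_eq_right (not_lt.1 hc)).symm⟩
      split_ifs with h
      · rw [h]
      · exact ih2 i (by omega)

theorem run_fillBases {m N : ℕ} (hm : s 0 2 = m) (hM : m ≤ s 4 1) (hN : s 4 0 = N)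
    (h13 : s 13 0 = 0) : ∀ i ≤ m, fillBases.run [] s 13 i = i * N := by
  simp only [fillBases]
  refine run_loop_inv (fun k s' => ∀ i ≤ k, s' 13 i = i * N) ?_ ?_ ?_
  · simp [PExpr.eval, bagsE, hm, capCell, hM]
  · intro i hi
    obtain rfl : i = 0 := by omega
    simp [h13]
  · intro j hj s' hs' ih v hv
    have e4 : s' 4 = s 4 := hs' 4 (by simp [writes])
    have ihj := ih j le_rfl
    rcases Nat.lt_succ_iff_lt_or_eq.1 (Nat.lt_succ_of_le hv) with hv | rfl
    · have := ih v (by omega)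
      have hne : v ≠ j + 1 := by omega
      simp [run, PExpr.eval, write_apply, this, hne]
    · simp [run, PExpr.eval, ihj, e4, hN, add_mul]

/-- Division by N recovers the block. This keeps the tables of different bags apart and makes
addresses in the adjacency matrix unambiguous. -/
theorem block_unique {N i j σ τ : ℕ} (hσ : σ < N) (hτ : τ < N) (h : i * N + σ = j * N + τ) :
    i = j := by
  have h1 : (i * N + σ) / N = i := by
    rw [mul_comm, Nat.mul_add_div (by omega), Nat.div_eq_of_lt hσ, add_zero]
  have h2 : (j * N + τ) / N = j := by
    rw [mul_comm, Nat.mul_add_div (by omega), Nat.div_eq_of_lt hτ, add_zero]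
  rw [← h1, h, h2]

theorem run_initTables {m : ℕ} (hm : s 0 2 = m) (hM : m ≤ s 4 1)
    (h13 : ∀ i < m, s 13 i = i * s 4 0) : ∀ i < m, ∀ σ < s 4 0,
      initTables.run [] s 14 (s 13 i + σ) = initE.eval s [σ, i] := by
  simp only [initTables]
  refine (fun h i hi => h i hi hi) (run_loop_inv (fun k s' => ∀ i < m, i < k → ∀ σ < s 4 0,
    s' 14 (s 13 i + σ) = initE.eval s [σ, i]) ?_ ?_ ?_)
  · simp [PExpr.eval, bagsE, hm, capCell, hM]
  · intro i _ hi
    exact absurd hi (Nat.not_lt_zero i)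
  · intro j hj s' hs' ih i hi hij σ hσ
    have e4 : s' 4 = s 4 := hs' 4 (by simp [writes])
    have e13 : s' 13 = s 13 := hs' 13 (by simp [writes])
    obtain ⟨h1, h2⟩ := run_fill (κ := false) (e := statesE) (f := add (get 13 (var 1)) (var 0))
      (g := initE) (a := 14) (env := [j]) (s := s') (n := s 4 0) (by simp [capCell, e4]) (by decide)
      (by decide) (by decide) (by
        intro k _ l _ h
        simpa [PExpr.eval] using h)
    simp only [PExpr.eval, List.getD_cons_zero, List.getD_cons_succ, Nat.reduceEqDiff, if_false,
      e13] at h1 h2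
    rcases Nat.lt_succ_iff_lt_or_eq.1 hij with hij | rfl
    · rw [h2, ih i hi hij σ hσ]
      intro τ hτ h
      rw [h13 i hi, h13 j hj] at h
      exact absurd (block_unique hσ hτ h) (by omega)
    · rw [h1 σ hσ]
      refine initE.eval_congr _ fun b hb _ => hs' b ?_
      simp only [writes, List.mem_singleton]
      rintro rfl
      exact absurd hb (by decide)

end RAM

/-! ### The contraction of the tree in the memory -/

namespace RAM

open PExpr Stmt

theorem IsTable.ext {s : Mem} {T T' : ℕ → ℕ} {i : ℕ} {Y : Finset ℕ} (h : IsTable s T i Y)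
    (hT : ∀ σ < s 4 0, T' σ = T σ) : IsTable s T' i Y := fun σ hσ x hx => by
  rw [hT σ hσ]
  exact h σ hσ x hx

/-- The new entries depend on the whole old table, so they are collected in array `15` before array
`14` is overwritten. -/
theorem run_mergeTables (s : Mem) (i j : ℕ) (env : List ℕ) :
    (∀ σ < s 4 0, mergeTables.run (i :: j :: env) s 14 (s 13 i + σ) =
      mergeE.eval s (σ :: i :: j :: env)) ∧
    ∀ c, (∀ σ < s 4 0, c ≠ s 13 i + σ) → mergeTables.run (i :: j :: env) s 14 c = s 14 c := by
  rw [mergeTables, run_seq]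
  have h1 := run_fill (κ := false) (e := statesE) (f := var 0) (g := mergeE) (a := 15)
    (env := i :: j :: env) (s := s) (n := s 4 0) (by simp [capCell]) (by decide) (by decide)
    (by decide) (by
      intro k _ l _ h
      simpa [PExpr.eval] using h)
  have hs : ∀ a ≠ 15, (loop false statesE (set 15 (var 0) mergeE)).run (i :: j :: env) s a = s a :=
    fun a ha => run_frame _ _ _ (by simpa [writes] using ha)
  generalize (loop false statesE (set 15 (var 0) mergeE)).run (i :: j :: env) s = u at h1 hs
  have h2 := run_fill (κ := false) (e := statesE) (f := add (get 13 (var 1)) (var 0))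
    (g := get 15 (var 0)) (a := 14) (env := i :: j :: env) (s := u) (n := s 4 0)
    (by simp [capCell, hs 4]) (by decide) (by decide) (by decide) (by
      intro k _ l _ h
      simpa [PExpr.eval] using h)
  simp only [PExpr.eval, List.getD_cons_zero, List.getD_cons_succ, hs 13 (by decide)] at h1 h2
  exact ⟨fun σ hσ => (h2.1 σ hσ).trans (h1.1 σ hσ), fun c hc => (h2.2 c hc).trans
    (congrFun (hs 14 (by decide)) c)⟩

variable {m n : ℕ} {T : SimpleGraph (Fin m)} [DecidableRel T.Adj]

/-- The memory `s'` after `t` rounds of the contraction of the tree, started in memory `s`. -/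
structure Contracting (T : SimpleGraph (Fin m)) [DecidableRel T.Adj] (n : ℕ) (s : Mem) (t : ℕ)
    (s' : Mem) (L : Finset (Fin m)) (Y : Fin m → Finset ℕ) : Prop where
  contraction : Contraction T (fun k => bagNodes s k) (Arc s) n L Y
  degree : ∀ k ∈ L, s' 8 k = (restNeighbors T L k).card
  neighbor : ∀ k ∈ L, s' 9 k = ∑ l ∈ restNeighbors T L k, (l : ℕ)
  removed : ∀ c : ℕ, (∀ k ∈ L, c ≠ (k : ℕ)) → s' 8 c = 0
  table : ∀ k ∈ L, IsTable s (fun σ => s' 14 (s 13 k + σ)) k (Y k)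
  rest : ∃ k ∈ L, s' 18 0 = k
  -- Each round either raises the counter or shrinks L by one.
  count : s' 16 0 + m = t + L.card
  current : s' 17 0 = s' 16 0 ∨ (s' 17 0 < m ∧ s' 16 0 < m)
  -- The current node is exempt: after a removal it is the neighbour whose degree has just dropped,
  -- even if the search had passed it before.
  searched : ∀ k ∈ L, k ≤ s' 16 0 → k ≠ s' 17 0 → s' 8 k ≠ 1

theorem Contracting.search {s s' : Mem} {t : ℕ} {L : Finset (Fin m)} {Y : Fin m → Finset ℕ}
    (h : Contracting T n s t s' L Y) (h8 : s' 8 (s' 17 0) ≠ 1) :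
    Contracting T n s (t + 1) (write (write s' 16 0 (s' 16 0 + 1)) 17 0 (s' 16 0 + 1)) L Y where
  contraction := h.contraction
  degree k hk := by simpa [write_apply] using h.degree k hk
  neighbor k hk := by simpa [write_apply] using h.neighbor k hk
  removed c hc := by simpa [write_apply] using h.removed c hc
  table k hk := by simpa [write_apply] using h.table k hk
  rest := by simpa [write_apply] using h.rest
  count := by
    have := h.count
    simp [write_apply]
    omega
  current := by simp [write_apply]
  searched k hk h1 h2 := by
    simp only [write_apply, Nat.reduceEqDiff, false_and, if_false, true_and, if_true] at h1 h2 ⊢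
    by_cases hc : (k : ℕ) = s' 17 0
    · rwa [hc]
    · exact h.searched k hk (by omega) hc

/-- Among the remaining nodes only i loses a neighbour, so only i can become a leaf; making it the
current node preserves `searched` without moving the counter back. The other tables lie in other
blocks and are untouched. -/
theorem Contracting.merge {s s' : Mem} {t : ℕ} {L : Finset (Fin m)} {Y : Fin m → Finset ℕ}
    {env : List ℕ} (h : Contracting T n s t s' L Y)
    (hX : ∀ (i j k : Fin m) (p : T.Walk i k), p.IsPath → j ∈ p.support →
      bagNodes s i ∩ bagNodes s k ⊆ bagNodes s j) (hR : Ready s m)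
    (h13 : ∀ i < m, s 13 i = i * s 4 0)
    (hs : ∀ a ∈ [0, 4, 5, 6, 7, 10, 12, 13, 19], s' a = s a) {i j : Fin m} (hj : j ∈ L)
    (hcur : s' 17 0 = j) (hij : restNeighbors T L j = {i}) :
    Contracting T n s (t + 1) ((seq mergeTables removeLeaf).run (i :: j :: env) s') (L.erase j)
      (Function.update Y i (Y i ∪ Y j)) := by
  have hC := h.contraction
  obtain ⟨hi, hadj⟩ := Contraction.left_mem hij
  have hne : i ≠ j := hadj.ne'
  have hne' : (i : ℕ) ≠ j := fun h => hne (Fin.ext h)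
  have hsub : ∀ a ∈ [0, 4, 5, 6, 7, 10, 12, 19], s' a = s a := fun a ha => hs a (by
    simp only [List.mem_cons] at ha ⊢
    tauto)
  have hsub' : ∀ a ∈ [0, 4, 5, 6, 7, 10, 12, 19], s a = s' a := fun a ha => (hsub a ha).symm
  have hR' : Ready s' m := hR.congr fun a ha => hs a (by
    simp only [List.mem_cons] at ha ⊢
    tauto)
  have e4 : s' 4 = s 4 := hs 4 (by simp)
  have e13 : s' 13 = s 13 := hs 13 (by simp)
  have eb : bagNodes s' = bagNodes s := by
    have : bagNode s' = bagNode s := by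
      funext u v
      simp [bagNode, hs 0, hs 10]
    funext u
    simp [bagNodes, bagLen, this, hs 0, hs 10]
  have ea : Arc s' = Arc s := by
    funext u v
    simp [Arc, hs 5, hs 7]
  have hjoin : Joins s' i j (Y i) (Y j) := by
    refine ⟨?_, ?_, ?_, ?_, ?_⟩
    · rw [eb]; exact hC.bag_subset i hi
    · rw [eb]; exact hC.bag_subset j hj
    · rw [eb]; exact fun v h1 h2 => hC.inter i hi j hj hne v h1 h2
    · rw [eb]; exact fun v h1 h2 => hC.inter j hj i hi hne.symm v h2 h1
    · rw [ea]; exact fun u w ha hu hw => hC.arc_leaf hX hj hij ha hu hw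
  have ht : ∀ k ∈ L, IsTable s' (fun σ => s' 14 (s' 13 k + σ)) k (Y k) := fun k hk => by
    rw [e13]
    exact (h.table k hk).congr hsub
  have hm := (isTable_merge (env := env) hR' i.2 j.2 hjoin (ht i hi) (ht j hj)).congr hsub'
  obtain ⟨hm1, hm2⟩ := run_mergeTables s' i j env
  have hframe : ∀ a, a ≠ 14 → a ≠ 15 → mergeTables.run (i :: j :: env) s' a = s' a :=
    fun a h1 h2 => run_frame _ _ _ (by
      simp only [mergeTables, writes, List.mem_append, List.mem_singleton]
      omega)
  rw [run_seq]
  generalize mergeTables.run (i :: j :: env) s' = u at hm1 hm2 hframe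
  have hr : removeLeaf.run (i :: j :: env) u =
      write (write (write (write (write u 8 j 0) 8 i (s' 8 i - 1)) 9 i (s' 9 i - j)) 18 0 i)
        17 0 i := by
    simp only [removeLeaf, run, PExpr.eval, List.getD_cons_zero, List.getD_cons_succ,
      Nat.reduceEqDiff, if_false, write_apply, false_and, true_and, if_neg hne', hframe 8 (by decide)
      (by decide), hframe 9 (by decide) (by decide)]
  rw [hr]
  have e8 : ∀ c, (write (write (write (write (write u 8 j 0) 8 i (s' 8 i - 1)) 9 i (s' 9 i - j))
      18 0 i) 17 0 i) 8 c = if c = i then s' 8 i - 1 else if c = j then 0 else s' 8 c := fun c => by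
    simp [write_apply, hframe 8]
  have e9 : ∀ c, (write (write (write (write (write u 8 j 0) 8 i (s' 8 i - 1)) 9 i (s' 9 i - j))
      18 0 i) 17 0 i) 9 c = if c = i then s' 9 i - j else s' 9 c := fun c => by
    simp [write_apply, hframe 9]
  have e14 : (write (write (write (write (write u 8 j 0) 8 i (s' 8 i - 1)) 9 i (s' 9 i - j))
      18 0 i) 17 0 i) 14 = u 14 := by
    funext c
    simp [write_apply]
  have hmem : ∀ k ∈ L.erase j, k ∈ L ∧ k ≠ j ∧ (k : ℕ) ≠ j := fun k hk =>
    ⟨Finset.mem_of_mem_erase hk, Finset.ne_of_mem_erase hk, fun h =>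
      Finset.ne_of_mem_erase hk (Fin.ext h)⟩
  refine ⟨hC.step hX hj hij, fun k hk => ?_, fun k hk => ?_, fun c hc => ?_, fun k hk => ?_, ?_, ?_,
    ?_, fun k hk h1 h2 => ?_⟩
  · obtain ⟨hk, hkj, hkj'⟩ := hmem k hk
    rw [e8, if_neg hkj']
    by_cases hki : k = i
    · rw [if_pos (congrArg Fin.val hki), hki, (restNeighbors_erase_left hadj hj).1, h.degree i hi]
    · rw [if_neg fun h => hki (Fin.ext h), restNeighbors_erase_of_ne hij hk hki, h.degree k hk]
  · obtain ⟨hk, hkj, hkj'⟩ := hmem k hk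
    rw [e9]
    by_cases hki : k = i
    · rw [if_pos (congrArg Fin.val hki), hki, (restNeighbors_erase_left hadj hj).2, h.neighbor i hi]
    · rw [if_neg fun h => hki (Fin.ext h), restNeighbors_erase_of_ne hij hk hki, h.neighbor k hk]
  · rw [e8, if_neg (hc i (Finset.mem_erase.2 ⟨hne, hi⟩))]
    split_ifs with hcj
    · rfl
    · exact h.removed c fun k hk hck => hc k (Finset.mem_erase.2 ⟨fun h => hcj (h ▸ hck), hk⟩) hck
  · obtain ⟨hk, hkj, hkj'⟩ := hmem k hk
    rw [e14]
    by_cases hki : k = i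
    · subst hki
      rw [Function.update_self]
      refine hm.ext fun σ hσ => ?_
      rw [← e4] at hσ
      rw [← hm1 σ hσ, e13]
    · rw [Function.update_of_ne hki]
      refine (h.table k hk).ext fun σ hσ => hm2 _ fun τ hτ heq => hki (Fin.ext ?_)
      rw [e13, h13 k k.2, h13 i i.2] at heq
      rw [e4] at hτ
      exact block_unique hσ hτ heq
  · exact ⟨i, Finset.mem_erase.2 ⟨hne, hi⟩, by simp [write_apply]⟩
  · have h1 := h.count
    have h2 := Finset.card_erase_of_mem hj
    have h3 := Finset.card_pos.2 ⟨j, hj⟩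
    simp [write_apply, hframe 16]
    omega
  · refine Or.inr ⟨by simp, ?_⟩
    have h1 := h.current
    have h2 := j.2
    simp [write_apply, hframe 16]
    omega
  · obtain ⟨hk, hkj, hkj'⟩ := hmem k hk
    simp only [write_apply, Nat.reduceEqDiff, false_and, if_false, true_and, if_true,
      hframe 16 (by decide) (by decide)] at h1 h2
    rw [e8, if_neg h2, if_neg hkj']
    exact h.searched k hk h1 (by rwa [hcur])

/-- In the end a single tree node is left, and its part is the whole graph. -/
theorem run_contractTree {s : Mem} (hT : T.IsTree)
    (hX : ∀ (i j k : Fin m) (p : T.Walk i k), p.IsPath → j ∈ p.support →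
      bagNodes s i ∩ bagNodes s k ⊆ bagNodes s j)
    (hlt : ∀ k : Fin m, ∀ v ∈ bagNodes s k, v < n)
    (hcover : ∀ v < n, ∃ k : Fin m, v ∈ bagNodes s k)
    (harc : ∀ u w, u < n → w < n → Arc s u w → ∃ k : Fin m, u ∈ bagNodes s k ∧ w ∈ bagNodes s k)
    (hR : Ready s m) (hm : s 0 2 = m) (hM : m + m ≤ s 4 1) (h13 : ∀ i < m, s 13 i = i * s 4 0)
    (h8 : ∀ k : Fin m, s 8 k = (restNeighbors T Finset.univ k).card)
    (h9 : ∀ k : Fin m, s 9 k = ∑ l ∈ restNeighbors T Finset.univ k, (l : ℕ))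
    (h8' : ∀ c, m ≤ c → s 8 c = 0)
    (h14 : ∀ k : Fin m, IsTable s (fun σ => s 14 (s 13 k + σ)) k (bagNodes s k))
    (h16 : s 16 0 = 0) (h17 : s 17 0 = 0) (h18 : s 18 0 = 0) :
    ∃ l < m, contractTree.run [] s 18 0 = l ∧ bagNodes s l ⊆ Finset.range n ∧
      IsTable s (fun σ => contractTree.run [] s 14 (s 13 l + σ)) l (Finset.range n) := by
  have hpos : 0 < m := by
    obtain ⟨k⟩ := hT.1.nonempty
    exact k.pos
  have hinv : ∃ L Y, Contracting T n s (m + m) (contractTree.run [] s) L Y := by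
    refine run_loop_inv (fun t s' => ∃ L Y, Contracting T n s t s' L Y) ?_ ?_ ?_
    · simp [PExpr.eval, bagsE, hm, capCell, hM]
    · exact ⟨Finset.univ, fun k => bagNodes s k, .start hT.1 hlt hcover harc, fun k _ => h8 k,
        fun k _ => h9 k, fun c hc => h8' c (not_lt.1 fun h => hc ⟨c, h⟩ (Finset.mem_univ _) rfl),
        fun k _ => h14 k, ⟨⟨0, hpos⟩, Finset.mem_univ _, h18⟩, by simp [h16], Or.inl (by rw [h16, h17]),
        fun k _ h1 h2 => absurd (by omega) h2⟩
    · rintro t ht s' hs' ⟨L, Y, h⟩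
      rw [contractLeaf, run_ite]
      have hce : (eqE (get 8 (get 17 (lit 0))) (lit 1)).Holds s' [t] ↔ s' 8 (s' 17 0) = 1 := by
        rw [holds_eq]
        rfl
      by_cases hc : s' 8 (s' 17 0) = 1
      · rw [if_neg (hce.2 hc), run_letS, run_letS]
        obtain ⟨j, hj, hcur⟩ : ∃ j ∈ L, s' 17 0 = (j : Fin m) := by
          by_contra! hno
          rw [h.removed _ hno] at hc
          omega
        have hc' := hc
        rw [hcur, h.degree j hj, Finset.card_eq_one] at hc'
        obtain ⟨i, hij⟩ := hc'
        have h9j : s' 9 j = i := by rw [h.neighbor j hj, hij, Finset.sum_singleton]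
        have e1 : PExpr.eval s' (get 17 (lit 0)) [t] = j := hcur
        have e2 : PExpr.eval s' (get 9 (var 0)) [j, t] = i := h9j
        rw [e1, e2]
        exact ⟨_, _, h.merge hX hR h13 (fun a ha => hs' a (by
          clear hs'
          revert a
          decide)) hj hcur hij⟩
      · rw [if_pos (not_not.1 fun h => hc (hce.1 h)), run_seq, run_set (by decide),
          run_set (by decide)]
        refine ⟨L, Y, ?_⟩
        simpa [PExpr.eval] using h.search hc
  obtain ⟨L, Y, h⟩ := hinv
  obtain ⟨k, hk, h18'⟩ := h.rest
  -- After 2m rounds the counter is m + |L|, beyond every tree node. So the current node is the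
  -- counter, all remaining nodes have been searched, and none of them is a leaf.
  have hcard : ¬ 1 < L.card := fun h2 => by
    obtain ⟨l, hl, hd⟩ := exists_leaf hT.2 h.contraction.conn h2
    have h1 := h.count
    have h3 := h.current
    have h4 := l.2
    exact h.searched l hl (by omega) (by omega) ((h.degree l hl).trans hd)
  have hL : ∀ l ∈ L, l = k := fun l hl => Finset.card_le_one.1 (not_lt.1 hcard) l hl k hk
  have hY : Y k = Finset.range n := by
    ext v
    rw [Finset.mem_range]
    refine ⟨h.contraction.lt k hk v, fun hv => ?_⟩
    obtain ⟨l, hl, hv⟩ := h.contraction.cover v hv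
    exact hL l hl ▸ hv
  have := h.table k hk
  rw [hY] at this
  exact ⟨k, k.2, h18', hY ▸ h.contraction.bag_subset k hk, this⟩

end RAM

/-! ### Decoding an optimal set from its weight -/

namespace RAM

open PExpr Stmt

variable {s : Mem} {n : ℕ}

theorem run_setSide : setSide.run [] s = write s 4 0 (s 12 0 + s 12 0 + 3) := run_set (by decide) ..

theorem run_setBits : setBits.run [] s = write s 4 0 (s 4 0 * s 4 0) := by
  rw [setBits, run_set (by decide)]
  simp [PExpr.eval]

theorem run_setStates : setStates.run [] s = write s 4 0 (2 ^ s 4 0) := by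
  rw [setStates, run_set (by decide)]
  simp [PExpr.eval]

theorem run_reduceBest {k d : ℕ} (hn : s 0 1 = n) (hM : n ≤ s 4 1) (h6 : s 6 n = 2 ^ n)
    (hd : d < 2 ^ n) (hk : k ≤ n) (h20 : s 20 0 = k * 2 ^ n + d) :
    reduceBest.run [] s 20 0 = d := by
  -- Truncation of k - j covers the rounds after the quotient is used up.
  have : reduceBest.run [] s 20 0 = (k - n) * 2 ^ n + d := by
    refine run_loop_inv (fun j s' => s' 20 0 = (k - j) * 2 ^ n + d) ?_ h20 ?_
    · simp [PExpr.eval, nodesE, hn, capCell, hM]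
    · intro j hj s' hs' ih
      have e0 : s' 0 = s 0 := hs' 0 (by decide)
      have e6 : s' 6 = s 6 := hs' 6 (by decide)
      have hc : (leE (get 6 nodesE) (get 20 (lit 0))).Holds s' [j] ↔ 2 ^ n ≤ s' 20 0 := by
        rw [holds_le]
        simp only [PExpr.eval, nodesE, Nat.reduceEqDiff, OfNat.zero_ne_ofNat, if_false, e0, hn, e6, h6]
      rw [run_ite]
      split_ifs with h
      · have h1 : ¬ 2 ^ n ≤ s' 20 0 := fun h' => hc.2 h' h
        have h2 : k - j = 0 := by
          by_contra hne
          rw [ih] at h1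
          have := Nat.le_mul_of_pos_left (2 ^ n) (Nat.pos_of_ne_zero hne)
          omega
        have h3 : k - (j + 1) = 0 := by omega
        simpa only [run, h3, h2] using ih
      · have h1 : 2 ^ n ≤ s' 20 0 := hc.1 h
        obtain ⟨x, hx⟩ : ∃ x, k - j = x + 1 := Nat.exists_eq_succ_of_ne_zero fun h0 => by
          rw [ih, h0] at h1
          omega
        have h3 : k - (j + 1) = x := by omega
        rw [run_set (by decide), h3]
        simp only [PExpr.eval, nodesE, write_apply, Nat.reduceEqDiff, OfNat.zero_ne_ofNat, if_false,
          e0, hn, e6, h6, ih, hx, true_and, if_true, add_mul, one_mul]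
        omega
  rw [this, Nat.sub_eq_zero_of_le hk]
  simp

theorem sum_two_pow_lt {S : Finset ℕ} (hS : ∀ v ∈ S, v < n) : ∑ v ∈ S, 2 ^ v < 2 ^ n :=
  Nat.geomSum_lt le_rfl hS

/-- The elements of `S` that are at least `n - k`, in decreasing order. -/
def topElements (S : Finset ℕ) (n k : ℕ) : List ℕ :=
  ((List.range k).map fun j => n - 1 - j).filter (· ∈ S)

theorem topElements_succ {S : Finset ℕ} {k : ℕ} : topElements S n (k + 1) =
    topElements S n k ++ if n - 1 - k ∈ S then [n - 1 - k] else [] := by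
  simp only [topElements, List.range_succ, List.map_append, List.filter_append, List.map_cons,
    List.map_nil, List.filter_cons, List.filter_nil, decide_eq_true_eq]

theorem mem_topElements {S : Finset ℕ} (hS : ∀ v ∈ S, v < n) {v : ℕ} :
    v ∈ topElements S n n ↔ v ∈ S := by
  simp only [topElements, List.mem_filter, List.mem_map, List.mem_range, decide_eq_true_eq,
    and_iff_right_iff_imp]
  intro hv
  have := hS v hv
  exact ⟨n - 1 - v, by omega, by omega⟩

theorem nodup_topElements {S : Finset ℕ} : (topElements S n n).Nodup := by
  refine List.Nodup.filter _ ((List.nodup_map_iff_inj_on List.nodup_range).2 fun x hx y hy h => ?_)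
  rw [List.mem_range] at hx hy
  omega

theorem run_writeOutput {S : Finset ℕ} (hS : ∀ v ∈ S, v < n) (hn : s 0 1 = n) (hM : n ≤ s 4 1)
    (h6 : ∀ v ≤ n, s 6 v = 2 ^ v) (h20 : s 20 0 = ∑ v ∈ S, 2 ^ v) (h1 : s 1 0 = 0) :
    ∀ i ≤ (topElements S n n).length, writeOutput.run [] s 1 i =
      ((topElements S n n).length :: topElements S n n).getD i 0 := by
  refine And.right (run_loop_inv (fun k s' => s' 20 0 = ∑ v ∈ S.filter (· < n - k), 2 ^ v ∧
    ∀ i ≤ (topElements S n k).length, s' 1 i =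
      ((topElements S n k).length :: topElements S n k).getD i 0) ?_ ?_ ?_)
  · simp [PExpr.eval, nodesE, hn, capCell, hM]
  · refine ⟨by rw [h20, Finset.filter_true_of_mem (by simpa using hS)], fun i hi => ?_⟩
    obtain rfl : i = 0 := by simpa [topElements] using hi
    simpa [topElements] using h1
  · rintro k hk s' hs' ⟨ih1, ih2⟩
    have e0 : s' 0 = s 0 := hs' 0 (by decide)
    have e6 : s' 6 = s 6 := hs' 6 (by decide)
    have hv : PExpr.eval s' (sub (sub nodesE (lit 1)) (var 0)) [k] = n - 1 - k := by
      simp [PExpr.eval, nodesE, e0, hn]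
    rw [run_letS, hv, topElements_succ]
    generalize topElements S n k = l at ih2
    have hnk : n - k = n - 1 - k + 1 := by omega
    have hnk' : n - (k + 1) = n - 1 - k := by omega
    have hle : n - 1 - k ≤ n := by omega
    rw [hnk'] at *
    rw [hnk] at ih1
    generalize n - 1 - k = v at *
    have hlt := sum_two_pow_lt (S := S.filter (· < v)) (n := v) (by simp)
    have hfilter : S.filter (· < v + 1) = if v ∈ S then insert v (S.filter (· < v)) else
        S.filter (· < v) := by
      ext u
      split_ifs with h
      · simp only [Finset.mem_filter, Finset.mem_insert, Nat.lt_succ_iff_lt_or_eq]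
        constructor
        · tauto
        · rintro (rfl | h')
          · exact ⟨h, Or.inr rfl⟩
          · tauto
      · simp only [Finset.mem_filter, Nat.lt_succ_iff_lt_or_eq]
        constructor
        · rintro ⟨h1, h2 | rfl⟩
          · exact ⟨h1, h2⟩
          · exact absurd h1 h
        · tauto
    have hc : (leE (get 6 (var 0)) (get 20 (lit 0))).Holds s' [v, k] ↔ 2 ^ v ≤ s' 20 0 := by
      rw [holds_le]
      simp only [PExpr.eval, Nat.reduceEqDiff, if_false, e6, List.getD_cons_zero, h6 v hle]
    -- What is left is the sum over the elements up to v, and those below v contribute less than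
    -- 2^v.
    have hc' : 2 ^ v ≤ s' 20 0 ↔ v ∈ S := by
      rw [ih1, hfilter]
      split_ifs with h
      · rw [Finset.sum_insert (by simp)]
        simpa using h
      · simp only [h, iff_false]
        omega
    rw [run_ite]
    by_cases h : v ∈ S
    · rw [if_neg (hc.2 (hc'.2 h)), if_pos h]
      rw [hfilter, if_pos h, Finset.sum_insert (by simp)] at ih1
      simp only [run, PExpr.eval, write_apply, List.getD_cons_zero, Nat.reduceEqDiff, if_false,
        false_and, true_and, if_true, e6, h6 v hle, ih1]
      have h0 : s' 1 0 = l.length := ih2 0 (Nat.zero_le _)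
      refine ⟨by omega, fun i hi => ?_⟩
      rw [h0]
      rw [List.length_append, List.length_singleton] at hi
      rcases Nat.lt_succ_iff_lt_or_eq.1 (Nat.lt_succ_of_le hi) with hi | rfl
      · rw [if_neg (by omega)]
        cases i with
        | zero => simp
        | succ i =>
          rw [if_neg (by omega), ih2 _ (by omega), List.getD_cons_succ, List.getD_cons_succ,
            List.getD_append _ _ _ _ (by omega)]
      · rw [if_pos rfl, List.getD_cons_succ]
        simp
    · rw [if_pos (not_not.1 fun h' => h (hc'.1 (hc.1 h'))), if_neg h, List.append_nil]
      rw [hfilter, if_neg h] at ih1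
      exact ⟨ih1, ih2⟩

end RAM

/-! ### The layout of the input -/

/-- An address in a concatenation is the total length of the preceding blocks plus an offset; the
addresses of arcs, links and bags all come from this. -/
theorem List.getD_flatMap {α : Type*} (l : List α) (f : α → List ℕ) {i c : ℕ} (hi : i < l.length)
    (hc : c < (f l[i]).length) :
    (l.flatMap f).getD (((l.take i).map fun a => (f a).length).sum + c) 0 = (f l[i]).getD c 0 := by
  have : l.flatMap f = (l.take i).flatMap f ++ (f l[i] ++ (l.drop (i + 1)).flatMap f) := by
    rw [← List.flatMap_cons, ← List.drop_eq_getElem_cons hi, ← List.flatMap_append,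
      List.take_append_drop]
  rw [this, List.getD_append_right _ _ _ _ (by simp [List.length_flatMap]), List.length_flatMap,
    Nat.add_sub_cancel_left, List.getD_append _ _ _ _ hc]

theorem List.getD_flatMap_pair {α : Type*} (l : List α) (f g : α → ℕ) {j : ℕ} (hj : j < l.length) :
    (l.flatMap fun e => [f e, g e]).getD (j + j) 0 = f l[j] ∧
      (l.flatMap fun e => [f e, g e]).getD (j + j + 1) 0 = g l[j] := by
  have hs : ((l.take j).map fun a => ([f a, g a] : List ℕ).length).sum = j + j := by
    simp only [List.length_cons, List.length_nil, List.map_const', List.sum_replicate,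
      List.length_take, smul_eq_mul]
    omega
  have h0 := l.getD_flatMap (fun e => [f e, g e]) hj (c := 0) (by simp)
  have h1 := l.getD_flatMap (fun e => [f e, g e]) hj (c := 1) (by simp)
  rw [hs] at h0 h1
  exact ⟨by simpa using h0, by simpa using h1⟩

namespace RAM

variable {n m : ℕ} (A : List (Fin n × Fin n)) (F : List (Fin m × Fin m))
  (B : Fin m → List (Fin n))

/-- The size of a bag. -/
def bagSize (i : ℕ) : ℕ := if h : i < m then (B ⟨i, h⟩).length else 0

/-- The address of a bag. -/
def bagAddress (i : ℕ) : ℕ :=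
  5 + (A.length + A.length) + (F.length + F.length) + ∑ k ∈ Finset.range i, (bagSize B k + 1)

theorem init_nodes : init (encodeInput A F B) 0 1 = n := by simp [init, encodeInput]

theorem init_bags : init (encodeInput A F B) 0 2 = m := by simp [init, encodeInput]

theorem init_arcs : init (encodeInput A F B) 0 3 = A.length := by simp [init, encodeInput]

theorem init_links : init (encodeInput A F B) 0 4 = F.length := by simp [init, encodeInput]

theorem init_zero (x : List ℕ) {a : ℕ} (ha : a ≠ 0) (i : ℕ) : init x a i = 0 := if_neg ha

theorem length_pairs {α : Type*} (l : List α) (f g : α → ℕ) :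
    (l.flatMap fun e => [f e, g e]).length = l.length + l.length := by
  rw [List.length_flatMap]
  simp
  omega

theorem init_arc {j : ℕ} (hj : j < A.length) :
    init (encodeInput A F B) 0 (5 + (j + j)) = A[j].1 ∧
      init (encodeInput A F B) 0 (6 + (j + j)) = A[j].2 := by
  obtain ⟨h1, h2⟩ := A.getD_flatMap_pair (fun e => (e.1 : ℕ)) (fun e => (e.2 : ℕ)) hj
  have hl := length_pairs A (fun e => (e.1 : ℕ)) (fun e => (e.2 : ℕ))
  -- Five successors peel off the length and the four header numbers.
  have e1 : 5 + (j + j) = (j + j) + 1 + 1 + 1 + 1 + 1 := by omega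
  have e2 : 6 + (j + j) = (j + j + 1) + 1 + 1 + 1 + 1 + 1 := by omega
  simp only [init, encodeInput, if_true, e1, e2, List.cons_append, List.nil_append,
    List.getD_cons_succ, List.append_assoc]
  rw [List.getD_append _ _ _ _ (by omega), List.getD_append _ _ _ _ (by omega)]
  exact ⟨h1, h2⟩

theorem init_link {j : ℕ} (hj : j < F.length) :
    init (encodeInput A F B) 0 (5 + (A.length + A.length) + (j + j)) = F[j].1 ∧
      init (encodeInput A F B) 0 (6 + (A.length + A.length) + (j + j)) = F[j].2 := by
  obtain ⟨h1, h2⟩ := F.getD_flatMap_pair (fun e => (e.1 : ℕ)) (fun e => (e.2 : ℕ)) hj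
  have hA := length_pairs A (fun e => (e.1 : ℕ)) (fun e => (e.2 : ℕ))
  have hF := length_pairs F (fun e => (e.1 : ℕ)) (fun e => (e.2 : ℕ))
  have e1 : 5 + (A.length + A.length) + (j + j) =
      (A.length + A.length + (j + j)) + 1 + 1 + 1 + 1 + 1 := by omega
  have e2 : 6 + (A.length + A.length) + (j + j) =
      (A.length + A.length + (j + j + 1)) + 1 + 1 + 1 + 1 + 1 := by omega
  simp only [init, encodeInput, if_true, e1, e2, List.cons_append, List.nil_append,
    List.getD_cons_succ, List.append_assoc]
  constructor
  · rw [List.getD_append_right _ _ _ _ (by omega), hA, Nat.add_sub_cancel_left,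
      List.getD_append _ _ _ _ (by omega), h1]
  · rw [List.getD_append_right _ _ _ _ (by omega), hA, Nat.add_sub_cancel_left,
      List.getD_append _ _ _ _ (by omega), h2]

theorem sum_take_finRange (g : Fin m → ℕ) {i : ℕ} (hi : i ≤ m) :
    (((List.finRange m).take i).map g).sum =
      ∑ k ∈ Finset.range i, if h : k < m then g ⟨k, h⟩ else 0 := by
  induction i with
  | zero => simp
  | succ i ih =>
    have hl : i < (List.finRange m).length := by simpa using hi
    rw [Finset.sum_range_succ, ← ih (by omega), List.take_succ_eq_append_getElem hl, List.map_append,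
      List.sum_append, dif_pos (show i < m by omega)]
    simp

theorem init_bag (i : Fin m) :
    init (encodeInput A F B) 0 (bagAddress A F B i) = (B i).length ∧
      ∀ (p : ℕ) (hp : p < (B i).length),
        init (encodeInput A F B) 0 (bagAddress A F B i + 1 + p) = (B i)[p] := by
  set f : Fin m → List ℕ := fun i => (B i).length :: (B i).map Fin.val with hf
  have hA := length_pairs A (fun e => (e.1 : ℕ)) (fun e => (e.2 : ℕ))
  have hF := length_pairs F (fun e => (e.1 : ℕ)) (fun e => (e.2 : ℕ))
  have hsum : (((List.finRange m).take i).map fun a => (f a).length).sum =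
      ∑ k ∈ Finset.range i, (bagSize B k + 1) := by
    rw [sum_take_finRange _ i.2.le]
    refine Finset.sum_congr rfl fun k hk => ?_
    have : k < m := (Finset.mem_range.1 hk).trans i.2
    simp [hf, bagSize, this]
  have key : ∀ c < (B i).length + 1, init (encodeInput A F B) 0 (bagAddress A F B i + c) =
      (f i).getD c 0 := by
    intro c hc
    have h := (List.finRange m).getD_flatMap f (i := i) (by simp) (c := c) (by simpa [hf] using hc)
    rw [hsum] at h
    have e : bagAddress A F B i + c = (A.length + A.length + (F.length + F.length +
        (∑ k ∈ Finset.range i, (bagSize B k + 1) + c))) + 1 + 1 + 1 + 1 + 1 := by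
      rw [bagAddress]
      omega
    simp only [init, encodeInput, if_true, e, List.cons_append, List.nil_append,
      List.getD_cons_succ, List.append_assoc]
    rw [List.getD_append_right _ _ _ _ (by omega), hA, Nat.add_sub_cancel_left,
      List.getD_append_right _ _ _ _ (by omega), hF, Nat.add_sub_cancel_left, h]
    simp
  refine ⟨by simpa [hf] using key 0 (by omega), fun p hp => ?_⟩
  have := key (p + 1) (by omega)
  rw [List.getD_cons_succ] at this
  rw [add_assoc, add_comm 1 p, this, List.getD_eq_getElem _ _ (by simpa using hp)]
  simp

end RAM

/-! ### The run of the program -/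

namespace RAM

open PExpr Stmt

/-- The memory after some statements. -/
def runAll (l : List Stmt) (s : Mem) : Mem := l.foldl (fun s p => p.run [] s) s

theorem runAll_frame (l : List Stmt) (s : Mem) {a : ℕ} (ha : a ∉ l.flatMap writes) :
    runAll l s a = s a := by
  induction l generalizing s with
  | nil => rfl
  | cons p l ih =>
    rw [List.flatMap_cons, List.mem_append, not_or] at ha
    exact (ih _ ha.2).trans (run_frame p [] s ha.1)

/-- The memory after the first `k` phases of the program. -/
def stage (x : List ℕ) (k : ℕ) : Mem := runAll (phases.take k) (init x)

/-- Which phases write which arrays is visible in the program text, so at concrete stages the side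
condition is settled by `decide`. -/
theorem stage_frame (x : List ℕ) {j k a : ℕ} (hjk : j ≤ k)
    (ha : a ∉ ((phases.take k).drop j).flatMap writes) : stage x k a = stage x j a := by
  have h : phases.take k = phases.take j ++ (phases.take k).drop j := by
    conv_lhs => rw [← List.take_append_drop j (phases.take k), List.take_take, min_eq_left hjk]
  rw [stage, h, runAll, List.foldl_append]
  exact runAll_frame _ _ ha

theorem stage_succ (x : List ℕ) (k : ℕ) {p : Stmt} (h : phases[k]? = some p) :
    stage x (k + 1) = p.run [] (stage x k) := by
  rw [stage, List.take_add_one, h, runAll, List.foldl_append]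
  rfl

theorem stage_init (x : List ℕ) {k a : ℕ} (ha : a ∉ (phases.take k).flatMap writes) :
    stage x k a = init x a := runAll_frame _ _ ha

variable {n m : ℕ} (A : List (Fin n × Fin n)) (F : List (Fin m × Fin m))
  (B : Fin m → List (Fin n))

/-- A bound on the numbers of rounds of the outer loops. -/
def outerCap : ℕ := n + (m + m) + (A.length + F.length)

/-- The largest size of a bag. -/
def maxSize : ℕ := (Finset.range m).sup (bagSize B)

/-- The number of rows of the matrices that code states. -/
def side : ℕ := maxSize B + maxSize B + 3

/-- The number of states. -/
def numStates : ℕ := 2 ^ (side B * side B)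

theorem stage_input (k : ℕ) : stage (encodeInput A F B) k 0 = init (encodeInput A F B) 0 :=
  stage_init _ fun h => by
    obtain ⟨p, hp, h⟩ := List.mem_flatMap.1 h
    have : 0 ∉ phases.flatMap writes := by decide
    exact this (List.mem_flatMap.2 ⟨p, List.mem_of_mem_take hp, h⟩)

theorem stage_one : stage (encodeInput A F B) 1 =
    write (init (encodeInput A F B)) 4 1 (outerCap A F) := by
  have : stage (encodeInput A F B) 1 = setOuterCap.run [] (init (encodeInput A F B)) :=
    stage_succ _ 0 rfl
  rw [this, setOuterCap, run_set (by decide)]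
  simp [PExpr.eval, nodesE, bagsE, arcsE, linksE, init_nodes, init_bags, init_arcs, init_links,
    outerCap]

/-- The first six phases run with inner cap 0, so their specifications do not rely on any fold or
inner loop. -/
theorem stage_caps_six {k : ℕ} (h1 : 1 ≤ k) (h6 : k ≤ 6) :
    stage (encodeInput A F B) k 4 0 = 0 ∧ stage (encodeInput A F B) k 4 1 = outerCap A F := by
  have : stage (encodeInput A F B) k 4 = stage (encodeInput A F B) 1 4 := by
    interval_cases k <;> exact stage_frame _ (by decide) (by decide)
  rw [this, stage_one]
  simp [write_apply, init_zero]

theorem stage_powers {k : ℕ} (h2 : 2 ≤ k) (h15 : k ≤ 15) : ∀ v ≤ n,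
    stage (encodeInput A F B) k 6 v = 2 ^ v ∧ stage (encodeInput A F B) k 5 v = v * n := by
  have h := run_fillPowers (s := stage (encodeInput A F B) 1) (n := n)
    (by rw [stage_input, init_nodes])
    (by rw [(stage_caps_six A F B (by omega) (by omega)).2, outerCap]; omega)
    (by rw [stage_init _ (by decide), init_zero _ (by decide)])
  have e6 : stage (encodeInput A F B) k 6 = stage (encodeInput A F B) 2 6 := by
    interval_cases k <;> exact stage_frame _ (by decide) (by decide)
  have e5 : stage (encodeInput A F B) k 5 = stage (encodeInput A F B) 2 5 := by
    interval_cases k <;> exact stage_frame _ (by decide) (by decide)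
  rw [e5, e6, stage_succ _ 1 rfl]
  exact h

theorem stage_weight {k : ℕ} (h2 : 2 ≤ k) (h15 : k ≤ 15) {v : ℕ} (hv : v ≤ n) :
    weight (stage (encodeInput A F B) k) v = 2 ^ n + 2 ^ v := by
  rw [weight, stage_input, init_nodes, (stage_powers A F B h2 h15 n le_rfl).1,
    (stage_powers A F B h2 h15 v hv).1]

theorem stage_infty {k : ℕ} (h3 : 3 ≤ k) (h15 : k ≤ 15) :
    stage (encodeInput A F B) k 19 0 = 1 + ∑ v ∈ Finset.range n, (2 ^ n + 2 ^ v) := by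
  have h := run_setInfty (s := stage (encodeInput A F B) 2) (n := n)
    (by rw [stage_input, init_nodes])
    (by rw [(stage_caps_six A F B (by omega) (by omega)).2, outerCap]; omega)
  have e : stage (encodeInput A F B) k 19 = stage (encodeInput A F B) 3 19 := by
    interval_cases k <;> exact stage_frame _ (by decide) (by decide)
  rw [e, stage_succ _ 2 rfl]
  refine Eq.trans h (congrArg (1 + ·) (Finset.sum_congr rfl fun v hv => ?_))
  exact stage_weight A F B le_rfl (by omega) (Finset.mem_range.1 hv).le

theorem stage_arc {k : ℕ} (h4 : 4 ≤ k) (h15 : k ≤ 15) (u v : Fin n) :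
    Arc (stage (encodeInput A F B) k) u v ↔ (u, v) ∈ A := by
  have h := run_readArcs (s := stage (encodeInput A F B) 3) (a := A.length)
    (by rw [stage_input, init_arcs])
    (by rw [(stage_caps_six A F B (by omega) (by omega)).2, outerCap]; omega)
    (fun c => by rw [stage_init _ (by decide), init_zero _ (by decide)])
  have e : stage (encodeInput A F B) k 7 = stage (encodeInput A F B) 4 7 := by
    interval_cases k <;> exact stage_frame _ (by decide) (by decide)
  rw [Arc, e, stage_succ _ 3 rfl, (stage_powers A F B (by omega) h15 u u.2.le).2]
  refine Iff.trans (h _) ?_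
  constructor
  · rintro ⟨j, hj, h⟩
    rw [stage_input, (init_arc A F B hj).1, (init_arc A F B hj).2,
      (stage_powers A F B (by omega) (by omega) _ A[j].1.2.le).2] at h
    have h1 := block_unique A[j].2.2 v.2 h
    have h2 : (A[j].2 : ℕ) = v := by
      rw [h1] at h
      exact Nat.add_left_cancel h
    have : A[j] = (u, v) := Prod.ext (Fin.ext h1) (Fin.ext h2)
    exact this ▸ List.getElem_mem hj
  · intro h
    obtain ⟨j, hj, h⟩ := List.getElem_of_mem h
    refine ⟨j, hj, ?_⟩
    rw [stage_input, (init_arc A F B hj).1, (init_arc A F B hj).2,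
      (stage_powers A F B (by omega) (by omega) _ A[j].1.2.le).2, h]

theorem sum_range_getElem {α : Type*} (l : List α) (f : ℕ → ℕ) (g : α → ℕ)
    (h : ∀ (j : ℕ) (hj : j < l.length), f j = g l[j]) :
    ∑ j ∈ Finset.range l.length, f j = (l.map g).sum := by
  induction l generalizing f with
  | nil => simp
  | cons a l ih =>
    rw [List.length_cons, Finset.sum_range_succ', List.map_cons, List.sum_cons, add_comm,
      h 0 (by simp), ih (fun j => f (j + 1)) fun j hj => h (j + 1) (by simpa using hj)]
    simp

theorem stage_tree (k : ℕ) :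
    stage (encodeInput A F B) 11 8 k =
      (F.map fun e => (if (e.1 : ℕ) = k then 1 else 0) + if (e.2 : ℕ) = k then 1 else 0).sum ∧
    stage (encodeInput A F B) 11 9 k = (F.map fun e => (if (e.1 : ℕ) = k then (e.2 : ℕ) else 0) +
      if (e.2 : ℕ) = k then (e.1 : ℕ) else 0).sum := by
  set x : ℕ → ℕ := fun j => if h : j < F.length then F[j].1 else 0 with hx
  set y : ℕ → ℕ := fun j => if h : j < F.length then F[j].2 else 0 with hy
  have h := run_readTree (s := stage (encodeInput A F B) 4) (a := A.length) (f := F.length)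
    (x := x) (y := y) (by rw [stage_input, init_arcs]) (by rw [stage_input, init_links])
    (by rw [(stage_caps_six A F B (by omega) (by omega)).2, outerCap]; omega)
    (fun j hj => by rw [stage_input, (init_link A F B hj).1, hx]; simp [hj])
    (fun j hj => by rw [stage_input, (init_link A F B hj).2, hy]; simp [hj])
    (fun c => by rw [stage_init _ (by decide), init_zero _ (by decide)])
    (fun c => by rw [stage_init _ (by decide), init_zero _ (by decide)]) k
  have e8 : stage (encodeInput A F B) 11 8 = stage (encodeInput A F B) 5 8 :=
    stage_frame _ (by decide) (by decide)
  have e9 : stage (encodeInput A F B) 11 9 = stage (encodeInput A F B) 5 9 :=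
    stage_frame _ (by decide) (by decide)
  rw [e8, e9, stage_succ _ 4 rfl]
  refine ⟨h.1.trans (sum_range_getElem _ _ _ fun j hj => ?_),
    h.2.trans (sum_range_getElem _ _ _ fun j hj => ?_)⟩ <;> simp [hx, hy, hj]

theorem stage_bags {k : ℕ} (h6 : 6 ≤ k) (h15 : k ≤ 15) :
    (∀ i < m, stage (encodeInput A F B) k 10 i = bagAddress A F B i) ∧
      stage (encodeInput A F B) k 12 0 = maxSize B := by
  have h := run_readBags (s := stage (encodeInput A F B) 5) (m := m) (ptr := bagAddress A F B)
    (r := bagSize B) (by rw [stage_input, init_bags])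
    (by rw [(stage_caps_six A F B (by omega) (by omega)).2, outerCap]; omega)
    (by simp [stage_input, init_arcs, init_links, bagAddress])
    (fun i _ => by simp only [bagAddress, Finset.sum_range_succ]; omega)
    (fun i hi => by rw [stage_input, (init_bag A F B ⟨i, hi⟩).1, bagSize, dif_pos hi])
    (by rw [stage_init _ (by decide), init_zero _ (by decide)])
  have e10 : stage (encodeInput A F B) k 10 = stage (encodeInput A F B) 6 10 := by
    interval_cases k <;> exact stage_frame _ (by decide) (by decide)
  have e12 : stage (encodeInput A F B) k 12 = stage (encodeInput A F B) 6 12 := by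
    interval_cases k <;> exact stage_frame _ (by decide) (by decide)
  rw [e10, e12, stage_succ _ 5 rfl]
  exact h

theorem stage_seven : stage (encodeInput A F B) 7 4 0 = side B ∧
    stage (encodeInput A F B) 7 4 1 = outerCap A F := by
  have : stage (encodeInput A F B) 7 = setSide.run [] (stage (encodeInput A F B) 6) :=
    stage_succ _ 6 rfl
  rw [this, run_setSide, (stage_bags A F B le_rfl (by omega)).2]
  simp [write_apply, side, (stage_caps_six A F B (k := 6) (by omega) le_rfl).2]

theorem stage_eight : stage (encodeInput A F B) 8 4 0 = side B * side B ∧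
    stage (encodeInput A F B) 8 4 1 = outerCap A F := by
  have : stage (encodeInput A F B) 8 = setBits.run [] (stage (encodeInput A F B) 7) :=
    stage_succ _ 7 rfl
  rw [this, run_setBits, (stage_seven A F B).1]
  simp [write_apply, (stage_seven A F B).2]

theorem stage_caps {k : ℕ} (h9 : 9 ≤ k) (h15 : k ≤ 15) :
    stage (encodeInput A F B) k 4 0 = numStates B ∧
    stage (encodeInput A F B) k 4 1 = outerCap A F := by
  have e : stage (encodeInput A F B) k 4 = stage (encodeInput A F B) 9 4 := by
    interval_cases k <;> exact stage_frame _ (by decide) (by decide)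
  have : stage (encodeInput A F B) 9 = setStates.run [] (stage (encodeInput A F B) 8) :=
    stage_succ _ 8 rfl
  rw [e, this, run_setStates, (stage_eight A F B).1]
  simp [write_apply, (stage_eight A F B).2, numStates]

/-- The running time needs bounds at every stage, including those at which the caps are still being
built up. -/
theorem stage_caps_le {k : ℕ} (h15 : k ≤ 15) : stage (encodeInput A F B) k 4 0 ≤ numStates B ∧
    stage (encodeInput A F B) k 4 1 ≤ outerCap A F := by
  have h1 : side B * side B < numStates B := Nat.lt_two_pow_self
  have h2 : side B ≤ side B * side B := Nat.le_mul_self _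
  rcases Nat.lt_or_ge k 9 with h | h
  · rcases Nat.lt_or_ge k 7 with h | h
    · rcases Nat.eq_zero_or_pos k with rfl | h0
      · have : stage (encodeInput A F B) 0 4 = init (encodeInput A F B) 4 := rfl
        simp [this, init_zero]
      · rw [(stage_caps_six A F B h0 (by omega)).1, (stage_caps_six A F B h0 (by omega)).2]
        omega
    · obtain rfl | rfl : k = 7 ∨ k = 8 := by omega
      · rw [(stage_seven A F B).1, (stage_seven A F B).2]
        omega
      · rw [(stage_eight A F B).1, (stage_eight A F B).2]
        omega
  · rw [(stage_caps A F B h h15).1, (stage_caps A F B h h15).2]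
    omega

theorem stage_bagLen {k : ℕ} (h6 : 6 ≤ k) (h15 : k ≤ 15) (i : Fin m) :
    bagLen (stage (encodeInput A F B) k) i = (B i).length := by
  rw [bagLen, stage_input, (stage_bags A F B h6 h15).1 i i.2, (init_bag A F B i).1]

theorem stage_bagNode {k : ℕ} (h6 : 6 ≤ k) (h15 : k ≤ 15) (i : Fin m) {p : ℕ}
    (hp : p < (B i).length) :
    bagNode (stage (encodeInput A F B) k) i p = (B i)[p] := by
  rw [bagNode, stage_input, (stage_bags A F B h6 h15).1 i i.2, (init_bag A F B i).2 p hp]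

theorem mem_stage_bagNodes {k : ℕ} (h6 : 6 ≤ k) (h15 : k ≤ 15) (i : Fin m) {v : ℕ} :
    v ∈ bagNodes (stage (encodeInput A F B) k) i ↔ ∃ w ∈ B i, (w : ℕ) = v := by
  rw [bagNodes, mem_bagSet, stage_bagLen A F B h6 h15]
  constructor
  · rintro ⟨p, hp, h⟩
    rw [stage_bagNode A F B h6 h15 i hp] at h
    exact ⟨_, List.getElem_mem hp, h⟩
  · rintro ⟨w, hw, rfl⟩
    obtain ⟨p, hp, h⟩ := List.getElem_of_mem hw
    exact ⟨p, hp, by rw [stage_bagNode A F B h6 h15 i hp, h]⟩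

theorem length_le_maxSize (i : Fin m) : (B i).length ≤ maxSize B := by
  have h := Finset.le_sup (f := bagSize B) (Finset.mem_range.2 i.2)
  rwa [bagSize, dif_pos i.2] at h

theorem stage_ready (hB : ∀ i, (B i).Nodup) {k : ℕ} (h9 : 9 ≤ k) (h15 : k ≤ 15) :
    Ready (stage (encodeInput A F B) k) m := by
  refine ⟨?_, fun i hi => ?_, fun i hi p hp q hq h => ?_⟩
  · rw [(stage_caps A F B h9 h15).1, (stage_bags A F B (by omega) h15).2]
    rfl
  · rw [stage_bagLen A F B (by omega) h15 ⟨i, hi⟩, (stage_bags A F B (by omega) h15).2]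
    exact length_le_maxSize B ⟨i, hi⟩
  · rw [stage_bagLen A F B (by omega) h15 ⟨i, hi⟩] at hp hq
    rw [stage_bagNode A F B (by omega) h15 ⟨i, hi⟩ hp,
      stage_bagNode A F B (by omega) h15 ⟨i, hi⟩ hq] at h
    exact (List.Nodup.getElem_inj_iff (hB ⟨i, hi⟩)).1 (Fin.ext h)

theorem stage_bases {k : ℕ} (h10 : 10 ≤ k) (h15 : k ≤ 15) : ∀ i ≤ m,
    stage (encodeInput A F B) k 13 i = i * numStates B := by
  have h := run_fillBases (s := stage (encodeInput A F B) 9) (m := m)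
    (by rw [stage_input, init_bags])
    (by rw [(stage_caps A F B (by omega) (by omega)).2, outerCap]; omega)
    (stage_caps A F B (by omega) (by omega)).1
    (by rw [stage_init _ (by decide), init_zero _ (by decide)])
  have e : stage (encodeInput A F B) k 13 = stage (encodeInput A F B) 10 13 := by
    interval_cases k <;> exact stage_frame _ (by decide) (by decide)
  rw [e, stage_succ _ 9 rfl]
  exact h

theorem stage_tables (hB : ∀ i, (B i).Nodup) (k : Fin m) :
    IsTable (stage (encodeInput A F B) 11) (fun σ => stage (encodeInput A F B) 11 14
      (stage (encodeInput A F B) 11 13 k + σ)) k (bagNodes (stage (encodeInput A F B) 11) k) := by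
  have h := run_initTables (s := stage (encodeInput A F B) 10) (m := m)
    (by rw [stage_input, init_bags])
    (by rw [(stage_caps A F B (by omega) (by omega)).2, outerCap]; omega)
    (fun i hi => by
      rw [stage_bases A F B le_rfl (by omega) i hi.le, (stage_caps A F B (by omega) (by omega)).1])
  have h1 := (isTable_init (env := []) (stage_ready A F B hB (k := 10) (by omega) (by omega)) k.2).congr
    (s' := stage (encodeInput A F B) 11) fun a ha => stage_frame _ (by omega) (by
      revert a
      decide)
  have e : bagNodes (stage (encodeInput A F B) 11) k = bagNodes (stage (encodeInput A F B) 10) k := by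
    ext v
    rw [mem_stage_bagNodes A F B (by omega) (by omega), mem_stage_bagNodes A F B (by omega) (by omega)]
  rw [e]
  refine h1.ext fun σ hσ => ?_
  rw [stage_bases A F B (by omega) (by omega) k k.2.le,
    ← stage_bases A F B (k := 10) (by omega) (by omega) k k.2.le]
  rw [stage_succ _ 10 rfl]
  refine h k k.2 σ ?_
  rwa [(stage_caps A F B (by omega) (by omega)).1] at hσ ⊢

end RAM

/-! ### Correctness -/

theorem IsSchedule.congr {adj adj' : ℕ → ℕ → Prop} {Y : Finset ℕ} {R : ℕ → ℕ → Prop}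
    (h : IsSchedule adj Y R) (ha : ∀ u ∈ Y, ∀ w ∈ Y, adj' u w → adj u w) : IsSchedule adj' Y R where
  irrefl := h.irrefl
  trans := h.trans
  fire := h.fire
  arc u hu w hw huw := h.arc u hu w hw (ha u hu w hw huw)
  unique u hu w hw w' hw' h1 h2 :=
    h.unique u hu w hw w' hw' (ha u hu w hw h1) (ha u hu w' hw' h2)

namespace RAM

open PExpr Stmt

variable {n m : ℕ} {G : Digraph (Fin n)} {D : TreeDecomposition (Fin m) G.toSimpleGraphInclusive}
  {A : List (Fin n × Fin n)} {F : List (Fin m × Fin m)} {B : Fin m → List (Fin n)}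

theorem stage_natAdj (hA : IsArcList G A) {k : ℕ} (h4 : 4 ≤ k) (h15 : k ≤ 15) {u v : ℕ} (hu : u < n)
    (hv : v < n) : Arc (stage (encodeInput A F B) k) u v ↔ G.natAdj u v :=
  (stage_arc A F B h4 h15 ⟨u, hu⟩ ⟨v, hv⟩).trans ((hA.2 _ _).trans Digraph.natAdj_val.symm)

/-- The underlying simple graph forgets loops, so their absence is what puts every arc into a bag.
-/
theorem exists_bag_of_adj (hG : ∀ v, ¬ G.Adj v v) {u v : Fin n} (h : G.Adj u v) :
    ∃ i, u ∈ D.bag i ∧ v ∈ D.bag i := by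
  refine D.edge_cover u v ?_
  rw [Digraph.toSimpleGraphInclusive, SimpleGraph.fromRel_adj]
  refine ⟨?_, Or.inl h⟩
  rintro rfl
  exact hG _ h

theorem mem_bag_list (hB : IsBagLists D.bag B) {i : Fin m} {v : Fin n} : v ∈ B i ↔ v ∈ D.bag i := by
  rw [← (hB i).2, List.mem_toFinset]

theorem mem_bagNodes_iff (hB : IsBagLists D.bag B) {k : ℕ} (h6 : 6 ≤ k) (h15 : k ≤ 15) {i : Fin m}
    {v : ℕ} (hv : v < n) :
    v ∈ bagNodes (stage (encodeInput A F B) k) i ↔ (⟨v, hv⟩ : Fin n) ∈ D.bag i := by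
  rw [mem_stage_bagNodes A F B h6 h15, ← mem_bag_list hB]
  constructor
  · rintro ⟨w, hw, rfl⟩
    exact hw
  · exact fun h => ⟨_, h, rfl⟩

theorem lt_of_mem_bagNodes {k : ℕ} (h6 : 6 ≤ k) (h15 : k ≤ 15) {i : Fin m} {v : ℕ}
    (h : v ∈ bagNodes (stage (encodeInput A F B) k) i) : v < n := by
  obtain ⟨w, -, rfl⟩ := (mem_stage_bagNodes A F B h6 h15 i).1 h
  exact w.2

open Classical in
theorem stage_degree (hF : IsEdgeList D.tree F) (k : Fin m) :
    stage (encodeInput A F B) 11 8 k = (restNeighbors D.tree Finset.univ k).card ∧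
      stage (encodeInput A F B) 11 9 k = ∑ l ∈ restNeighbors D.tree Finset.univ k, (l : ℕ) := by
  have hne : ∀ e ∈ F, e.1 ≠ e.2 := by
    intro e he h
    have := (hF.2 e.1 e.2).1 (List.mem_map.2 ⟨e, he, rfl⟩)
    exact D.tree.irrefl (h ▸ this)
  have hr : restNeighbors D.tree Finset.univ k =
      Finset.univ.filter (fun l => s(k, l) ∈ F.map fun e => s(e.1, e.2)) := by
    ext l
    simp only [mem_restNeighbors, Finset.mem_univ, true_and, Finset.mem_filter, hF.2]
  obtain ⟨h1, h2⟩ := stage_tree A F B k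
  rw [hr, Finset.card_eq_sum_ones, h1, h2]
  simp only [Fin.val_inj]
  exact ⟨sum_edgeList F hF.1 hne (fun _ => 1) k, sum_edgeList F hF.1 hne (fun l => (l : ℕ)) k⟩

theorem stage_outside {c : ℕ} (hc : m ≤ c) : stage (encodeInput A F B) 11 8 c = 0 := by
  rw [(stage_tree A F B c).1, List.sum_eq_zero]
  intro x hx
  obtain ⟨e, -, rfl⟩ := List.mem_map.1 hx
  have h1 := e.1.2
  have h2 := e.2.2
  rw [if_neg (by omega), if_neg (by omega), add_zero]

/-- The weight of a set of nodes. -/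
def setWeight (S : Finset (Fin n)) : ℕ := ∑ v ∈ S, (2 ^ n + 2 ^ (v : ℕ))

/-- The final table is translated back to the graph. Thresholds up to the total weight are exactly
those below infinity, so every set of nodes is covered. -/
theorem stage_best_le_iff (hG : ∀ v, ¬ G.Adj v v) (hA : IsArcList G A) (hF : IsEdgeList D.tree F)
    (hB : IsBagLists D.bag B) {x : ℕ} (hx : x ≤ ∑ v ∈ Finset.range n, (2 ^ n + 2 ^ v)) :
    stage (encodeInput A F B) 13 20 0 ≤ x ↔ ∃ S, PowerDominates G S ∧ setWeight S ≤ x := by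
  classical
  have hB' := fun i => (hB i).1
  obtain ⟨l, hl, h18, hsub, htab⟩ := run_contractTree (s := stage (encodeInput A F B) 11) (n := n)
    D.isTree (fun i j k p hp hj v hv => by
      rw [Finset.mem_inter] at hv
      have hv' := lt_of_mem_bagNodes (by omega) (by omega) hv.1
      rw [mem_bagNodes_iff hB (by omega) (by omega) hv',
        mem_bagNodes_iff hB (by omega) (by omega) hv'] at hv
      rw [mem_bagNodes_iff hB (by omega) (by omega) hv']
      exact D.inter_subset i j k p hp hj (Finset.mem_inter.2 hv))
    (fun k v => lt_of_mem_bagNodes (by omega) (by omega))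
    (fun v hv => by
      obtain ⟨k, hk⟩ := D.vertex_cover ⟨v, hv⟩
      exact ⟨k, (mem_bagNodes_iff hB (by omega) (by omega) hv).2 hk⟩)
    (fun u w hu hw h => by
      rw [stage_natAdj hA (by omega) (by omega) hu hw] at h
      obtain ⟨_, _, h⟩ := h
      obtain ⟨k, h1, h2⟩ := exists_bag_of_adj (D := D) hG h
      exact ⟨k, (mem_bagNodes_iff hB (by omega) (by omega) hu).2 h1,
        (mem_bagNodes_iff hB (by omega) (by omega) hw).2 h2⟩)
    (stage_ready A F B hB' (by omega) (by omega)) (by rw [stage_input, init_bags])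
    (by rw [(stage_caps A F B (by omega) (by omega)).2, outerCap]; omega)
    (fun i hi => by
      rw [stage_bases A F B (by omega) (by omega) i hi.le, (stage_caps A F B (by omega) (by omega)).1])
    (fun k => (stage_degree hF k).1) (fun k => (stage_degree hF k).2) (fun c => stage_outside)
    (stage_tables A F B hB')
    (by rw [stage_init _ (by decide), init_zero _ (by decide)])
    (by rw [stage_init _ (by decide), init_zero _ (by decide)])
    (by rw [stage_init _ (by decide), init_zero _ (by decide)])
  rw [← stage_succ _ 11 rfl] at h18 htab
  have htab' := htab.congr (s' := stage (encodeInput A F B) 12) fun a ha =>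
    stage_frame _ (by omega) (by
      clear h18 htab
      revert a
      decide)
  have hsub' : bagNodes (stage (encodeInput A F B) 12) l ⊆ Finset.range n := by
    intro v hv
    exact Finset.mem_range.2 (lt_of_mem_bagNodes (i := ⟨l, hl⟩) (by omega) (by omega) hv)
  have e13 : stage (encodeInput A F B) 11 13 = stage (encodeInput A F B) 12 13 :=
    (stage_frame _ (by omega) (by decide)).symm
  rw [e13] at htab'
  have hbest := bestE_le_iff (env := []) (stage_ready A F B hB' (k := 12) (by omega) (by omega)) hl
    hsub' htab' (x := x) (by rw [stage_infty A F B (by omega) (by omega)]; omega)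
  have hset : stage (encodeInput A F B) 13 20 0 =
      bestE.eval (stage (encodeInput A F B) 12) [l] := by
    rw [stage_succ _ 12 rfl, setBest, run_letS, run_set (by decide), ← h18]
    exact write_apply_same ..
  rw [hset, hbest]
  have hw : ∀ S : Finset ℕ, ∑ v ∈ Finset.range n ∩ S, weight (stage (encodeInput A F B) 12) v =
      setWeight (Finset.univ.filter fun v : Fin n => (v : ℕ) ∈ S) := by
    intro S
    rw [setWeight, Finset.sum_filter, Fin.sum_univ_eq_sum_range (fun v => if v ∈ S then 2 ^ n + 2 ^ v
      else 0) n, ← Finset.sum_filter, Finset.filter_mem_eq_inter]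
    refine Finset.sum_congr rfl fun v hv => stage_weight A F B (by omega) (by omega) ?_
    exact (Finset.mem_range.1 (Finset.mem_inter.1 hv).1).le
  have harc : ∀ u ∈ Finset.range n, ∀ w ∈ Finset.range n,
      (Arc (stage (encodeInput A F B) 12) u w ↔ G.natAdj u w) := fun u hu w hw =>
    stage_natAdj hA (by omega) (by omega) (Finset.mem_range.1 hu) (Finset.mem_range.1 hw)
  constructor
  · rintro ⟨S, R, h1, h2, h3⟩
    rw [hw] at h3
    refine ⟨_, (powerDominates_iff G _).2 ⟨R, h1.congr fun u hu w hw => (harc u hu w hw).2,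
      fun v hv => ?_⟩, h3⟩
    have hmem : ∀ v < n, v ∈ S → v ∈ (Finset.univ.filter fun v : Fin n => (v : ℕ) ∈ S).map
        Fin.valEmbedding := fun v hv h => Finset.mem_map.2 ⟨⟨v, hv⟩, by simpa using h, rfl⟩
    refine (h2 v (Finset.mem_range.2 hv)).imp (hmem v hv) ?_
    rintro ⟨u, hu, ha, h⟩
    exact ⟨u, hu, (harc u hu v (Finset.mem_range.2 hv)).1 ha,
      h.imp_left (hmem u (Finset.mem_range.1 hu))⟩
  · rintro ⟨S, h1, h2⟩
    obtain ⟨R, h3, h4⟩ := (powerDominates_iff G S).1 h1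
    refine ⟨S.map Fin.valEmbedding, R, h3.congr fun u hu w hw => (harc u hu w hw).1, fun v hv => ?_,
      ?_⟩
    · refine (h4 v (Finset.mem_range.1 hv)).imp_right ?_
      rintro ⟨u, hu, ha, h⟩
      exact ⟨u, hu, (harc u hu v hv).2 ha, h⟩
    · rw [hw]
      convert h2
      ext v
      simp [Fin.val_inj]

theorem setWeight_eq (S : Finset (Fin n)) :
    setWeight S = S.card * 2 ^ n + ∑ v ∈ S.map Fin.valEmbedding, 2 ^ v := by
  rw [setWeight, Finset.sum_add_distrib, Finset.sum_const, smul_eq_mul, Finset.sum_map]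
  rfl

theorem lt_of_mem_map {S : Finset (Fin n)} : ∀ v ∈ S.map Fin.valEmbedding, v < n := by
  intro v hv
  obtain ⟨w, -, rfl⟩ := Finset.mem_map.1 hv
  exact w.2

/-- A smaller solution would save at least 2^n in the leading term, more than the low-order terms
can make up for. -/
theorem stage_best (hG : ∀ v, ¬ G.Adj v v) (hA : IsArcList G A) (hF : IsEdgeList D.tree F)
    (hB : IsBagLists D.bag B) :
    ∃ S, IsOptimalPDS G S ∧ stage (encodeInput A F B) 13 20 0 = setWeight S := by
  have huniv : ∀ S : Finset (Fin n), setWeight S ≤ ∑ v ∈ Finset.range n, (2 ^ n + 2 ^ v) := by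
    intro S
    rw [← Fin.sum_univ_eq_sum_range (fun v => 2 ^ n + 2 ^ v) n]
    exact Finset.sum_le_sum_of_subset (Finset.subset_univ S)
  have hle : ∀ S, PowerDominates G S → stage (encodeInput A F B) 13 20 0 ≤ setWeight S := fun S hS =>
    (stage_best_le_iff hG hA hF hB (huniv S)).2 ⟨S, hS, le_rfl⟩
  -- The set of all nodes is a solution, so the computed value is finite and can be its own
  -- threshold.
  obtain ⟨S, hS, h⟩ := (stage_best_le_iff hG hA hF hB ((hle Finset.univ fun v =>
    .of_mem (by simp)).trans (huniv _))).1 le_rfl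
  refine ⟨S, ⟨hS, fun S' hS' => ?_⟩, le_antisymm (hle S hS) h⟩
  have h1 := h.trans (hle S' hS')
  rw [setWeight_eq, setWeight_eq] at h1
  have h2 := sum_two_pow_lt (lt_of_mem_map (S := S'))
  by_contra! h3
  have h4 : (S'.card + 1) * 2 ^ n ≤ S.card * 2 ^ n := Nat.mul_le_mul_right _ h3
  rw [add_mul, one_mul] at h4
  omega

theorem stage_output (hG : ∀ v, ¬ G.Adj v v) (hA : IsArcList G A) (hF : IsEdgeList D.tree F)
    (hB : IsBagLists D.bag B) : ∃ S : List (Fin n), S.Nodup ∧ IsOptimalPDS G S.toFinset ∧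
      ∀ i ≤ (S.map Fin.val).length, stage (encodeInput A F B) 15 1 i =
        ((S.map Fin.val).length :: S.map Fin.val).getD i 0 := by
  obtain ⟨S, hS, h⟩ := stage_best hG hA hF hB
  rw [setWeight_eq] at h
  have hlt := sum_two_pow_lt (lt_of_mem_map (S := S))
  have hM : ∀ k, 9 ≤ k → k ≤ 15 → n ≤ stage (encodeInput A F B) k 4 1 := by
    intro k h1 h2
    rw [(stage_caps A F B h1 h2).2, outerCap]
    omega
  -- The quotient is |S|, at most n, so n subtractions suffice.
  have h14 := run_reduceBest (by rw [stage_input, init_nodes]) (hM 13 (by omega) (by omega))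
    (stage_powers A F B (k := 13) (by omega) (by omega) n le_rfl).1 hlt (by
      simpa using Finset.card_le_univ S) h
  rw [← stage_succ _ 13 rfl] at h14
  have h15 := run_writeOutput (lt_of_mem_map (S := S)) (by rw [stage_input, init_nodes])
    (hM 14 (by omega) (by omega))
    (fun v hv => (stage_powers A F B (k := 14) (by omega) (by omega) v hv).1) h14
    (by rw [stage_init _ (by decide), init_zero _ (by decide)])
  rw [← stage_succ _ 14 rfl] at h15
  have hmem : ∀ v, v ∈ topElements (S.map Fin.valEmbedding) n n ↔ v ∈ S.map Fin.valEmbedding :=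
    fun v => mem_topElements lt_of_mem_map
  have hnodup := nodup_topElements (S := S.map Fin.valEmbedding) (n := n)
  generalize topElements (S.map Fin.valEmbedding) n n = l at h15 hmem hnodup
  lift l to List (Fin n) using fun v hv => lt_of_mem_map v ((hmem v).1 hv)
  refine ⟨l, List.Nodup.of_map _ hnodup, ?_, h15⟩
  have : l.toFinset = S := by
    ext v
    have := hmem v
    simpa [Fin.val_inj] using this
  rwa [this]

end RAM

/-! ### Running time -/

namespace RAM

open PExpr Stmt

/-- The machine program for a list of statements. -/
def compileAll (l : List Stmt) : Prog := l.foldr (fun p q => .seq (p.compile [] 0) q) .skip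

/-- Each phase is charged with the caps in force when it starts, uniformly bounded by N and M.
Memories are compared outside array `3`, where phases leave debris. -/
theorem halts_compileAll {l : List Stmt} {K D N M : ℕ} (hl : ∀ p ∈ l, p.Realizes K D 1) {s r : Mem}
    (hsr : ∀ a, a ≠ 3 → s a = r a)
    (hcap : ∀ k < l.length, runAll (l.take k) r 4 0 ≤ N ∧ runAll (l.take k) r 4 1 ≤ M) :
    Halts (compileAll l) s (l.length * (K * (N + 1) ^ D * (M + 1)) + 1)
      fun s' => ∀ a, a ≠ 3 → s' a = runAll l r a := by
  induction l generalizing s r with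
  | nil => exact ⟨s, 1, .skip s, by simp, hsr⟩
  | cons p l ih =>
    have h0 := hcap 0 (by simp)
    have h4 : s 4 = r 4 := hsr 4 (by decide)
    change r 4 0 ≤ N ∧ r 4 1 ≤ M at h0
    rw [← h4] at h0
    refine (Halts.seq ((hl p List.mem_cons_self [] 0 s (by simp)).mono
      (t' := K * (N + 1) ^ D * (M + 1)) ?_ fun _ h => h) fun s' hs' =>
      ih (fun q hq => hl q (List.mem_cons_of_mem _ hq)) (s := s') (r := p.run [] r) (fun a ha => ?_)
        fun k hk => hcap (k + 1) (by simpa using hk)).mono ?_ fun _ h => h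
    · rw [pow_one]
      exact Nat.mul_le_mul (Nat.mul_le_mul_left _ (Nat.pow_le_pow_left (by omega) _)) (by omega)
    · rw [hs'.arr a ha]
      exact run_congr p _ hsr a ha
    · rw [List.length_cons, add_mul, one_mul]
      omega

/-- Linearity of the running time: no phase nests outer loops. The phases that write caps are single
assignments, and all others leave array `4` alone. -/
theorem exists_realizes : ∃ K D, ∀ p ∈ phases, p.Realizes K D 1 := by
  have key : ∀ l : List Stmt, (∀ p ∈ l, ∃ K D, p.Realizes K D 1) →
      ∃ K D, ∀ p ∈ l, p.Realizes K D 1 := by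
    intro l
    induction l with
    | nil => exact fun _ => ⟨0, 0, by simp⟩
    | cons p l ih =>
      intro h
      obtain ⟨K, D, hp⟩ := h p List.mem_cons_self
      obtain ⟨K', D', hl⟩ := ih fun q hq => h q (List.mem_cons_of_mem _ hq)
      refine ⟨max K K', max D D', fun q hq => ?_⟩
      rcases List.mem_cons.1 hq with rfl | hq
      · exact hp.mono (le_max_left _ _) (le_max_left _ _) le_rfl
      · exact (hl q hq).mono (le_max_right _ _) (le_max_right _ _) le_rfl
  have hset : ∀ a e f, ∃ K D, (set a e f).Realizes K D 1 := by
    intro a e f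
    obtain ⟨K, D, h⟩ := realizes_set a e f
    exact ⟨K, D, h.mono le_rfl le_rfl zero_le_one⟩
  have hrun : ∀ p : Stmt, 4 ∉ p.writes → p.depth ≤ 1 → ∃ K D, p.Realizes K D 1 := by
    intro p h4 h1
    obtain ⟨K, D, h⟩ := realizes p h4
    exact ⟨K, D, h.mono le_rfl le_rfl h1⟩
  refine key _ fun p hp => ?_
  simp only [phases, List.mem_cons, List.not_mem_nil, or_false] at hp
  rcases hp with rfl | rfl | rfl | rfl | rfl | rfl | rfl | rfl | rfl | rfl | rfl | rfl | rfl | rfl |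
    rfl
  all_goals first
    | exact hset _ _ _
    | exact hrun _ (by decide) (by decide)

variable {n m : ℕ} {G : Digraph (Fin n)} {D : TreeDecomposition (Fin m) G.toSimpleGraphInclusive}
  {A : List (Fin n × Fin n)} {F : List (Fin m × Fin m)} {B : Fin m → List (Fin n)}

theorem maxSize_le_width (hB : IsBagLists D.bag B) : maxSize B ≤ D.width + 1 := by
  refine Finset.sup_le fun i hi => ?_
  rw [bagSize, dif_pos (Finset.mem_range.1 hi), ← List.toFinset_card_of_nodup (hB _).1, (hB _).2]
  have := Finset.le_sup (f := fun i => (D.bag i).card) (Finset.mem_univ ⟨i, Finset.mem_range.1 hi⟩)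
  rw [TreeDecomposition.width]
  omega

/-- Each arc lies in the square of some bag, so reading the arcs costs a factor polynomial in the
width only. -/
theorem length_arcs_le (hG : ∀ v, ¬ G.Adj v v) (hA : IsArcList G A) (hB : IsBagLists D.bag B) :
    A.length ≤ m * (maxSize B * maxSize B) := by
  rw [← List.toFinset_card_of_nodup hA.1]
  calc A.toFinset.card ≤ (Finset.univ.biUnion fun i => D.bag i ×ˢ D.bag i).card := by
        refine Finset.card_le_card fun e he => ?_
        obtain ⟨i, h1, h2⟩ := exists_bag_of_adj (D := D) hG ((hA.2 e.1 e.2).1 (List.mem_toFinset.1 he))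
        exact Finset.mem_biUnion.2 ⟨i, Finset.mem_univ i, Finset.mem_product.2 ⟨h1, h2⟩⟩
    _ ≤ (Finset.univ : Finset (Fin m)).card * (maxSize B * maxSize B) := by
        refine Finset.card_biUnion_le_card_mul _ _ _ fun i _ => ?_
        have := length_le_maxSize B i
        rw [← List.toFinset_card_of_nodup (hB i).1, (hB i).2] at this
        rw [Finset.card_product]
        exact Nat.mul_le_mul this this
    _ = m * (maxSize B * maxSize B) := by simp

theorem length_links_lt (hF : IsEdgeList D.tree F) : F.length < m := by
  classical
  have h : (F.map fun e => s(e.1, e.2)).toFinset = D.tree.edgeFinset := by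
    ext e
    induction e with
    | h i j => rw [List.mem_toFinset, hF.2, SimpleGraph.mem_edgeFinset, SimpleGraph.mem_edgeSet]
  have := D.isTree.card_edgeFinset
  rw [← h, List.toFinset_card_of_nodup hF.1, List.length_map, Fintype.card_fin] at this
  omega

/-- The factor 15 counts the phases, and 75 = 15 · 5 comes from M + 1 ≤ 5 (N + 1) max(n, m), which
also turns D into D + 1. There is at least one tree node, so max(n, m) is positive and absorbs the
final step. -/
theorem cost_le {K D N M n m a f k b W : ℕ} (hN : N = 2 ^ (W * W)) (hW : W = b + b + 3)
    (hb : b ≤ k + 1) (ha : a ≤ m * (b * b)) (hf : f < m) (hM : M = n + (m + m) + (a + f)) :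
    15 * (K * (N + 1) ^ D * (M + 1)) + 1 ≤
      (75 * K + 1) * 2 ^ (46 * (D + 1)) * (2 ^ (24 * (D + 1))) ^ (k ^ 2) * max n m := by
  set X := max n m with hX
  have hn : n ≤ X := le_max_left _ _
  have hm : m ≤ X := le_max_right _ _
  have hX1 : 1 ≤ X := by omega
  have hbN : b * b ≤ N := by
    have h1 : b * b ≤ W * W := Nat.mul_le_mul (by omega) (by omega)
    have h2 : W * W < 2 ^ (W * W) := Nat.lt_two_pow_self
    omega
  have hM' : M + 1 ≤ 5 * (N + 1) * X := by
    have h1 : a ≤ X * N := ha.trans (Nat.mul_le_mul hm hbN)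
    have h2 : 5 * (N + 1) * X = 5 * (X * N) + 5 * X := by ring
    omega
  have hN' : N + 1 ≤ 2 ^ (24 * k ^ 2 + 46) := by
    -- The square of 2k + 5 is 4k² + 20k + 25, and k ≤ k² gives the coefficient 24; the constant 45
    -- is generous, and one more in the exponent pays for the 1 in N + 1.
    have h1 : W * W ≤ 24 * k ^ 2 + 45 := by
      have h2 : W * W ≤ (2 * k + 5) * (2 * k + 5) := Nat.mul_le_mul (by omega) (by omega)
      have h3 : k ≤ k ^ 2 := Nat.le_self_pow (by decide) k
      nlinarith
    have h2 : 2 ^ (W * W) ≤ 2 ^ (24 * k ^ 2 + 45) := Nat.pow_le_pow_right (by decide) h1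
    have h3 := Nat.one_le_two_pow (n := 24 * k ^ 2 + 45)
    rw [hN, pow_succ]
    omega
  clear_value X
  have hpow : (N + 1) ^ (D + 1) ≤ 2 ^ (46 * (D + 1)) * (2 ^ (24 * (D + 1))) ^ (k ^ 2) := by
    refine (Nat.pow_le_pow_left hN' (D + 1)).trans (le_of_eq ?_)
    rw [← pow_mul, ← pow_mul, ← pow_add]
    congr 1
    ring
  have hpos : 1 ≤ (N + 1) ^ (D + 1) * X := Nat.mul_pos (Nat.pow_pos (Nat.succ_pos N)) hX1
  calc 15 * (K * (N + 1) ^ D * (M + 1)) + 1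
      ≤ 15 * (K * (N + 1) ^ D * (5 * (N + 1) * X)) + (N + 1) ^ (D + 1) * X :=
        Nat.add_le_add (Nat.mul_le_mul_left _ (Nat.mul_le_mul_left _ hM')) hpos
    _ = (75 * K + 1) * ((N + 1) ^ (D + 1) * X) := by ring
    _ ≤ (75 * K + 1) * (2 ^ (46 * (D + 1)) * (2 ^ (24 * (D + 1))) ^ (k ^ 2) * X) :=
        Nat.mul_le_mul_left _ (Nat.mul_le_mul_right _ hpow)
    _ = _ := by rw [← mul_assoc, ← mul_assoc]

end RAM

theorem mainTheorem5 :
    ∃ (P : RAM.Prog) (C c : ℕ),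
      ∀ (n m : ℕ) (G : Digraph (Fin n)) (_ : ∀ v, ¬ G.Adj v v)
        (D : TreeDecomposition (Fin m) G.toSimpleGraphInclusive)
        (A : List (Fin n × Fin n)) (F : List (Fin m × Fin m)) (B : Fin m → List (Fin n)),
        IsArcList G A → IsEdgeList D.tree F → IsBagLists D.bag B →
        ∃ (S : List (Fin n)) (t : ℕ),
          RAM.Computes P (encodeInput A F B) (S.map Fin.val) t ∧
          S.Nodup ∧ IsOptimalPDS G S.toFinset ∧
          t ≤ C * c ^ (D.width ^ 2) * max n m := by
  obtain ⟨K, E, hR⟩ := RAM.exists_realizes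
  refine ⟨RAM.compileAll RAM.phases, (75 * K + 1) * 2 ^ (46 * (E + 1)), 2 ^ (24 * (E + 1)),
    fun n m G hG D A F B hA hF hB => ?_⟩
  obtain ⟨S, hS, hopt, hout⟩ := RAM.stage_output hG hA hF hB
  obtain ⟨s, t, hexec, ht, hs⟩ := RAM.halts_compileAll hR (s := RAM.init (encodeInput A F B))
    (r := RAM.init (encodeInput A F B)) (fun _ _ => rfl) (N := RAM.numStates B)
    (M := RAM.outerCap A F) fun k hk => RAM.stage_caps_le A F B (Nat.le_of_lt hk)
  refine ⟨S, t, ⟨s, hexec, fun i hi => ?_⟩, hS, hopt, ht.trans ?_⟩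
  · rw [hs 1 (by decide)]
    exact hout i hi
  · exact RAM.cost_le rfl rfl (RAM.maxSize_le_width hB) (RAM.length_arcs_le hG hA hB)
      (RAM.length_links_lt hF) rfl
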